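/- For a finite nonempty set $E$ with $n=|E|$ and a monotone submodular function $f:2^E\to\mathbb{R}_+$ write $f(e)=f(\{e\})$, $f_S(e)=f(S\cup\{e\})-f(S)$, and let \[ c_f \;=\; 1-\min_{e\in E:\ f(e)\neq 0}\frac{f_{E\setminus\{e\}}(e)}{f(e)}\in[0,1] \] be the total curvature of $f$ (with $c_f=0$ if $f(e)=0$ for all $e$, i.e. if $f\equiv 0$). For $w:E\to[0,1]$ write $w(S)=\sum_{e\in S}w(e)$. Theorem. There is a (single, uniform) randomized algorithm that, given a finite nonempty set $E=\{0,\dots,n-1\}$, a monotone submodular function $f:2^E\to\mathbb{R}_+$ by a value oracle, a weight function $w:E\to[0,1]$ and $\varepsilon\in(0,1)$, always halts and outputs a random set $S\subseteq E$ with $w(S)\le 1$ (with probability one) such that \[ \mathbf{E}[f(S)]\;\ge\;\Bigl(1-\frac{c_f}{e}-\varepsilon\Bigr)f(O), \] where $O$ is any optimal solution, i.e. $w(O)\le 1$ and $f(T)\le f(O)$ for all $T\subseteq E$ with $w(T)\le 1$. If $c_f<1$, then its running time, for all outcomes of its coin tosses, is at most \[ C\cdot\frac{n^4\,q(\log n)}{(1-c_f)^2}\cdot\Bigl(\frac1\varepsilon\Bigl(1+\log\frac1{1-c_f}\Bigr)\Bigr)^{p(1/\varepsilon)/(1-c_f)},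 \] where the constant $C$ and the polynomials $p,q$ do not depend on $E$, $f$, $w$, $\varepsilon$. The model of computation is a real RAM (memory cells for natural numbers, for real numbers and for subsets of $E$, with indirect addressing; programs may contain only natural-number constants) in which each of the following takes unit time: evaluating a fixed expression (built with $+,-$ on natural numbers and with $+,-,\times,/$ on reals), a test (comparison of numbers, membership in a stored set, or a Boolean combination of these), inserting an element in or removing an element from a stored set, a call of the oracle $f$ on a stored set, and tossing an independent coin with a computed success probability. -/

import Mathlib

noncomputable section

namespace SubmodKnapsack

/-! ### Set functions -/

/-- `f` is submodular: `f(S) + f(T) ≥ f(S ∩ T) + f(S ∪ T)` for all `S`, `T`. -/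
def IsSubmodular {E : Type*} [DecidableEq E] (f : Finset E → ℝ) : Prop :=
  ∀ S T : Finset E, f (S ∩ T) + f (S ∪ T) ≤ f S + f T

/-- The marginal value `f_S(T) = f(S ∪ T) - f(S)`. -/
def marginal {E : Type*} [DecidableEq E] (f : Finset E → ℝ) (S T : Finset E) : ℝ :=
  f (S ∪ T) - f S

/-- The total curvature `c_f = 1 - min_e f_{E-e}(e) / f(e)`.  The minimum is over the elements
with `f(e) ≠ 0` (for the others the ratio is `0 / 0` and puts no constraint on `f`); if there is
no such element, then a monotone submodular `f ≥ 0` is identically `0`, hence linear, and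
`c_f = 0`. -/
def curvature {E : Type*} [Fintype E] [DecidableEq E] (f : Finset E → ℝ) : ℝ :=
  open Classical in
  if h : (Finset.univ.filter fun e : E => f {e} ≠ 0).Nonempty then
    1 - (Finset.univ.filter fun e : E => f {e} ≠ 0).inf' h
      fun e => marginal f (Finset.univ.erase e) {e} / f {e}
  else 0

/-- The weight `w(S) = ∑_{e ∈ S} w(e)`. -/
def weight {E : Type*} (w : E → ℝ) (S : Finset E) : ℝ := ∑ e ∈ S, w e

/-- `O` maximizes `f` among the sets of weight at most `1`. -/
def IsOptimal {E : Type*} (f : Finset E → ℝ) (w : E → ℝ) (O : Finset E) : Prop :=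
  weight w O ≤ 1 ∧ ∀ T : Finset E, weight w T ≤ 1 → f T ≤ f O

/-! ### Randomized algorithms: a real RAM with a value oracle

The memory consists of natural-number cells (counters and addresses), real cells, and cells that
hold subsets of the ground set `{0, …, n-1}`; all of them are addressed by natural numbers, with
indirect addressing.  A program is one finite piece of syntax, independent of the instance; the
only constants in it are natural numbers.  Sets are built element by element.  Each executed
command (an assignment, an insertion or a removal of one element, an oracle call, a coin toss, a
test of a conditional or a loop) takes one unit of time. -/

/-- Contents of the memory, for the ground set `Fin n`. -/
structure Store (n : ℕ) where
  nat : ℕ → ℕ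
  real : ℕ → ℝ
  sets : ℕ → Finset (Fin n)

/-- Expressions for natural numbers; subtraction is truncated. -/
inductive NExp where
  | const (k : ℕ)
  | cell (addr : NExp)
  | add (a b : NExp)
  | sub (a b : NExp)

/-- Expressions for real numbers. -/
inductive RExp where
  | ofNat (a : NExp)
  | cell (addr : NExp)
  | add (a b : RExp)
  | sub (a b : RExp)
  | mul (a b : RExp)
  | div (a b : RExp)

/-- Tests: comparison of naturals, comparison of reals, membership of the element with index `i`
in the set stored at `addr`, and Boolean combinations. -/
inductive BExp where
  | natLt (a b : NExp)
  | realLt (a b : RExp)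
  | mem (i addr : NExp)
  | not (a : BExp)
  | and (a b : BExp)

/-- Commands. -/
inductive Cmd where
  | skip
  /-- `nat[addr] := val` -/
  | setNat (addr val : NExp)
  /-- `real[addr] := val` -/
  | setReal (addr : NExp) (val : RExp)
  /-- add the element with index `i` to `sets[addr]` -/
  | insert (addr i : NExp)
  /-- remove the element with index `i` from `sets[addr]` -/
  | erase (addr i : NExp)
  /-- oracle call: `real[addr] := f(sets[s])` -/
  | query (addr s : NExp)
  /-- independent coin toss: `nat[addr] := 1` with probability `p` and `nat[addr] := 0` with
  probability `1 - p`, where `p` is first truncated to `[0,1]` -/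
  | flip (addr : NExp) (p : RExp)
  | seq (a b : Cmd)
  | ite (c : BExp) (a b : Cmd)
  | loop (c : BExp) (body : Cmd)

variable {n : ℕ}

def NExp.eval (σ : Store n) : NExp → ℕ
  | .const k => k
  | .cell a => σ.nat (a.eval σ)
  | .add a b => a.eval σ + b.eval σ
  | .sub a b => a.eval σ - b.eval σ

def RExp.eval (σ : Store n) : RExp → ℝ
  | .ofNat a => (a.eval σ : ℝ)
  | .cell a => σ.real (a.eval σ)
  | .add a b => a.eval σ + b.eval σ
  | .sub a b => a.eval σ - b.eval σ
  | .mul a b => a.eval σ * b.eval σ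
  | .div a b => a.eval σ / b.eval σ

def BExp.holds (σ : Store n) : BExp → Prop
  | .natLt a b => a.eval σ < b.eval σ
  | .realLt a b => a.eval σ < b.eval σ
  | .mem i a => ∃ h : i.eval σ < n, (⟨i.eval σ, h⟩ : Fin n) ∈ σ.sets (a.eval σ)
  | .not a => ¬ a.holds σ
  | .and a b => a.holds σ ∧ b.holds σ

def Store.setNat (σ : Store n) (addr val : ℕ) : Store n :=
  { σ with nat := Function.update σ.nat addr val }

def Store.setReal (σ : Store n) (addr : ℕ) (val : ℝ) : Store n :=
  { σ with real := Function.update σ.real addr val }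

def Store.setSet (σ : Store n) (addr : ℕ) (S : Finset (Fin n)) : Store n :=
  { σ with sets := Function.update σ.sets addr S }

/-- Add the element with index `i` to the set at `addr` (no effect if `i ≥ n`). -/
def Store.insertAt (σ : Store n) (addr i : ℕ) : Store n :=
  if h : i < n then σ.setSet addr (Insert.insert ⟨i, h⟩ (σ.sets addr)) else σ

/-- Remove the element with index `i` from the set at `addr` (no effect if `i ≥ n`). -/
def Store.eraseAt (σ : Store n) (addr i : ℕ) : Store n :=
  if h : i < n then σ.setSet addr ((σ.sets addr).erase ⟨i, h⟩) else σ

/-- The success probability of a coin: `p` truncated to `[0,1]`. -/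
def clamp (p : ℝ) : ℝ := max 0 (min p 1)

/-- The coin that shows `true` with probability `clamp p`. -/
def coin (p : ℝ) : PMF Bool :=
  PMF.ofFintype (fun b => ENNReal.ofReal (if b then clamp p else 1 - clamp p)) (by
    have h0 : 0 ≤ clamp p := le_max_left _ _
    have h1 : clamp p ≤ 1 := max_le zero_le_one (min_le_right _ _)
    rw [Fintype.sum_bool]
    simp only [if_true, Bool.false_eq_true, if_false]
    rw [← ENNReal.ofReal_add h0 (by linarith)]
    simp)

/-- A configuration: the stack of commands still to be executed, and the memory. -/
structure Config (n : ℕ) where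
  stack : List Cmd
  store : Store n

/-- One unit of time, with value oracle `f`; a configuration with an empty stack has halted and
does not change any more. -/
def step (f : Finset (Fin n) → ℝ) : Config n → PMF (Config n)
  | ⟨[], σ⟩ => PMF.pure ⟨[], σ⟩
  | ⟨.skip :: K, σ⟩ => PMF.pure ⟨K, σ⟩
  | ⟨.setNat a v :: K, σ⟩ => PMF.pure ⟨K, σ.setNat (a.eval σ) (v.eval σ)⟩
  | ⟨.setReal a v :: K, σ⟩ => PMF.pure ⟨K, σ.setReal (a.eval σ) (v.eval σ)⟩
  | ⟨.insert a i :: K, σ⟩ => PMF.pure ⟨K, σ.insertAt (a.eval σ) (i.eval σ)⟩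
  | ⟨.erase a i :: K, σ⟩ => PMF.pure ⟨K, σ.eraseAt (a.eval σ) (i.eval σ)⟩
  | ⟨.query a s :: K, σ⟩ => PMF.pure ⟨K, σ.setReal (a.eval σ) (f (σ.sets (s.eval σ)))⟩
  | ⟨.flip a p :: K, σ⟩ =>
      (coin (p.eval σ)).map fun b => ⟨K, σ.setNat (a.eval σ) (if b then 1 else 0)⟩
  | ⟨.seq c d :: K, σ⟩ => PMF.pure ⟨c :: d :: K, σ⟩
  | ⟨.ite t c d :: K, σ⟩ =>
      open Classical in PMF.pure ⟨(if t.holds σ then c else d) :: K, σ⟩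
  | ⟨.loop t c :: K, σ⟩ =>
      open Classical in PMF.pure ⟨if t.holds σ then c :: .loop t c :: K else K, σ⟩

/-- The distribution of the configuration after `T` units of time. -/
def run (f : Finset (Fin n) → ℝ) : ℕ → Config n → PMF (Config n)
  | 0, c => PMF.pure c
  | T + 1, c => (step f c).bind (run f T)

/-- The initial configuration: `nat[0] = n`, `real[0] = ε`, `real[i + 1] = w(i)` for `i < n`, and
all other cells are `0` or empty. -/
def init (prog : Cmd) (w : Fin n → ℝ) (ε : ℝ) : Config n where
  stack := [prog]
  store :=
    { nat := fun a => if a = 0 then n else 0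
      real := fun a =>
        if a = 0 then ε else if h : a - 1 < n then w ⟨a - 1, h⟩ else 0
      sets := fun _ => ∅ }

/-- On the given instance the program halts within `T` units of time, whatever the outcomes of
its coin tosses. -/
def HaltsWithin (prog : Cmd) (f : Finset (Fin n) → ℝ) (w : Fin n → ℝ) (ε : ℝ) (T : ℕ) : Prop :=
  ∀ c ∈ (run f T (init prog w ε)).support, c.stack = []

/-- The distribution of the set in `sets[0]` after `T` units of time.  It is the distribution of
the output if the program halts within `T` units of time. -/
def output (prog : Cmd) (f : Finset (Fin n) → ℝ) (w : Fin n → ℝ) (ε : ℝ) (T : ℕ) :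
    PMF (Finset (Fin n)) :=
  (run f T (init prog w ε)).map fun c => c.store.sets 0

/-- The expectation of `f(S)` for a random set `S` with distribution `μ`. -/
def expect (μ : PMF (Finset (Fin n))) (f : Finset (Fin n) → ℝ) : ℝ :=
  ∑ S : Finset (Fin n), (μ S).toReal * f S

end SubmodKnapsack

end

/-! Write `f = g + l`, where `l(e) = f(E) - f(E - e)` (`lin`) is the part of the value of `e` that
is never lost and `g` (`curved`) is the rest. Then `g` is again monotone with diminishing returns,
and the curvature `c` gives `l(O) ≥ (1 - c) f(O)`, hence `g(O) ≤ c f(O)`. It therefore suffices to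
find a feasible `T` with `f(T) ≥ (1 - 1/e) g(O) + l(O)` up to `O(f(O)/K)`, where `K = ⌈8/ε⌉`.

Such a set comes from a distorted greedy algorithm with `m = K` stages. At stage `t` the gains of
`g` count with the factor `coef m t`, which grows by `1 + 1/m` per stage from about `1/e` to `1`,
while `l` always counts fully. The potential `coef * G + (1 - coef) * g(O)` plus linear terms never
drops, up to rounding (`Split.progress_succ`); it starts at `(1 - coef m 0) g(O)` plus the linear
part of the small elements and ends at `G` plus the linear part of the chosen ones.

The knapsack constraint is handled by replacing `O`, at a loss of `2 f(O)/K`, by at most `8 K^3`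
large elements `L` and small elements `A` that leave some room (`exists_large_small`). Each large
element owns a slot. In every stage its slot picks the lightest element of the same class of linear
values whose gain reaches a guessed threshold; so the pick is no heavier than the large element and
almost as good (`Split.slotPick_spec`). In the end each slot keeps the pick of only one stage. Such
a choice is a scenario, and `G` is the average of `g` over all scenarios; a pick thus contributes a
fraction `1/m` of its gain (`le_avg_update`). Small elements belong to all scenarios. They are added
by density until their weight makes up for giving up another fraction `1/m` of what is left of `A`
(`small_stage`). Each stage wastes a little weight, which is what the spare room is for.

A best scenario is at least as good as the average. Picks of different slots may coincide, so that
linear value would be missing; it is restored by filling each class with its lightest missing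
elements. Counting elements above each weight threshold, class by class, shows that the large
elements still weigh at most as much as `L` (`Split.exists_fills`).

The optimal set is unknown, but the run depends on it only through a bound for small weights, two
units of measurement and a number of small integers. All these are enumerated, every candidate is
checked, and the best feasible one is kept. Only the first three guesses depend on `n`, with `n +
1`, `O(log n)` and `O(log n)` values. The algorithm tosses no coin, and its running time is `n^4
(log n)^2` times a function of `ε`, whatever the curvature; the stated bound only grows when `c`
grows.

To run this on the RAM, the memory is divided into arrays and the algorithm is written in a small
language with bounded loops, which has a functional meaning `Prog.den` and a syntactic cost
`Prog.cost`; `Prog.exec` transfers both to the machine. -/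

noncomputable section
namespace SubmodKnapsack
open Finset
variable {n : ℕ}

/-! ### Monotone set functions with diminishing returns -/

/-- Monotone set functions with diminishing returns. -/
structure MonoDR {E : Type*} [DecidableEq E] (g : Finset E → ℝ) : Prop where
  mono : ∀ A B, A ⊆ B → g A ≤ g B
  dr : ∀ A B e, A ⊆ B → g (insert e B) - g B ≤ g (insert e A) - g A

section
variable {E : Type*} [DecidableEq E] {g f : Finset E → ℝ}

lemma MonoDR.union_le (h : MonoDR g) (X Y : Finset E) :
    g (X ∪ Y) - g X ≤ ∑ e ∈ Y, (g (insert e X) - g X) := by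
  induction Y using Finset.induction_on with
  | empty => simp
  | insert a s ha ih =>
    rw [sum_insert ha, union_insert]
    have := h.dr X (X ∪ s) a subset_union_left
    linarith

lemma MonoDR.gain_nonneg (h : MonoDR g) (A : Finset E) (e : E) : 0 ≤ g (insert e A) - g A :=
  sub_nonneg.2 (h.mono _ _ (subset_insert _ _))

lemma MonoDR.of_submodular (hm : Monotone f) (hs : IsSubmodular f) : MonoDR f where
  mono _ _ h := hm h
  dr A B e h := by
    by_cases he : e ∈ B
    · rw [insert_eq_of_mem he]
      have := hm (subset_insert e A)
      simp only [sub_self, sub_nonneg]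
      exact this
    · have := hs (insert e A) B
      rw [insert_inter_of_notMem he, inter_eq_left.2 h, insert_union, union_eq_right.2 h] at this
      linarith

lemma weight_insert {w : E → ℝ} {A : Finset E} {e : E} (h : e ∉ A) :
    weight w (insert e A) = weight w A + w e := by
  simp [weight, sum_insert h, add_comm]

lemma weight_union {w : E → ℝ} {A B : Finset E} (h : Disjoint A B) :
    weight w (A ∪ B) = weight w A + weight w B := by
  simp [weight, sum_union h]

lemma weight_sdiff {w : E → ℝ} {A B : Finset E} (h : B ⊆ A) :
    weight w (A \ B) = weight w A - weight w B := by
  have := Finset.sum_sdiff (f := w) h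
  simp only [weight]; linarith

omit [DecidableEq E] in
lemma weight_mono {w : E → ℝ} (hw : ∀ e, 0 ≤ w e) {A B : Finset E} (h : A ⊆ B) :
    weight w A ≤ weight w B :=
  sum_le_sum_of_subset_of_nonneg h fun i _ _ => hw i

omit [DecidableEq E] in
lemma weight_nonneg {w : E → ℝ} (hw : ∀ e, 0 ≤ w e) (A : Finset E) : 0 ≤ weight w A :=
  sum_nonneg fun i _ => hw i

/-- By submodularity, removing `X K` after the other parts costs at least as much as removing it
from all of `O`; the sum telescopes. -/
lemma sum_drop_le (hs : IsSubmodular f) {O : Finset E} {X : ℕ → Finset E} (K : ℕ)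
    (hd : ∀ i < K, ∀ j < i, Disjoint (X i) (X j)) :
    ∑ i ∈ range K, (f O - f (O \ X i)) ≤ f O - f (O \ (range K).biUnion X) := by
  induction K with
  | zero => simp
  | succ K ih =>
    rw [sum_range_succ]
    have h1 := ih fun i hi => hd i (by omega)
    have h2 := hs (O \ (range K).biUnion X) (O \ X K)
    have hdis : Disjoint ((range K).biUnion X) (X K) := by
      rw [disjoint_biUnion_left]
      intro i hi
      exact (hd K (by omega) i (mem_range.1 hi)).symm
    have e1 : (O \ (range K).biUnion X) ∪ (O \ X K) = O := by
      ext x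
      have : x ∈ (range K).biUnion X → x ∉ X K := fun a => disjoint_left.1 hdis a
      simp only [mem_union, mem_sdiff]; tauto
    have e2 : (O \ (range K).biUnion X) ∩ (O \ X K) = O \ (range (K + 1)).biUnion X := by
      rw [range_add_one, biUnion_insert]
      ext x; simp only [mem_inter, mem_sdiff, mem_union]; tauto
    rw [e1, e2] at h2
    linarith

/-- Averaging: the losses of the disjoint parts add up to at most `f O`. This is the pigeonhole
principle by which inconvenient elements of `O` are discarded. -/
lemma exists_cheap_drop (hs : IsSubmodular f) (h0 : ∀ S, 0 ≤ f S) {O : Finset E}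
    {X : ℕ → Finset E} {K : ℕ} (hK : 0 < K) (hd : ∀ i < K, ∀ j < i, Disjoint (X i) (X j)) :
    ∃ i < K, f O - f (O \ X i) ≤ f O / K := by
  by_contra! hc
  have h1 := sum_drop_le hs (O := O) K hd
  have h2 : ∑ i ∈ range K, f O / K < ∑ i ∈ range K, (f O - f (O \ X i)) :=
    sum_lt_sum_of_nonempty ⟨0, by simpa⟩ fun i hi => hc i (mem_range.1 hi)
  rw [sum_const, card_range, nsmul_eq_mul, mul_div_cancel₀ _ (by positivity)] at h2
  have := h0 (O \ (range K).biUnion X)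
  linarith

end

/-! ### Linear part, curved part and curvature -/

/-- The contribution of `e` that is never lost: the marginal value at the end. -/
def lin (f : Finset (Fin n) → ℝ) (e : Fin n) : ℝ := f univ - f (univ.erase e)

/-- The curved part of `f`. -/
def curved (f : Finset (Fin n) → ℝ) (S : Finset (Fin n)) : ℝ := f S - weight (lin f) S

section
variable {f : Finset (Fin n) → ℝ}

lemma lin_nonneg (h : MonoDR f) (e : Fin n) : 0 ≤ lin f e :=
  sub_nonneg.2 (h.mono _ _ (erase_subset _ _))

lemma lin_le_gain (h : MonoDR f) {A : Finset (Fin n)} {e : Fin n} (he : e ∉ A) :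
    lin f e ≤ f (insert e A) - f A := by
  have := h.dr A (univ.erase e) e (fun x hx => by
    rw [mem_erase]; exact ⟨fun hxe => he (hxe ▸ hx), mem_univ _⟩)
  rwa [insert_erase (mem_univ _)] at this

lemma curved_insert {A : Finset (Fin n)} {e : Fin n} (he : e ∉ A) :
    curved f (insert e A) - curved f A = f (insert e A) - f A - lin f e := by
  simp only [curved, weight_insert he]; ring

lemma MonoDR.curved (h : MonoDR f) : MonoDR (curved f) where
  mono A B hAB := by
    obtain ⟨C, hC, rfl⟩ : ∃ C, Disjoint A C ∧ B = A ∪ C :=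
      ⟨B \ A, disjoint_sdiff, (union_sdiff_of_subset hAB).symm⟩
    clear hAB
    induction C using Finset.induction_on with
    | empty => simp
    | insert a s ha ih =>
      have hs := ih (disjoint_of_subset_right (subset_insert _ _) hC)
      have ha' : a ∉ A ∪ s := by
        rw [mem_union, not_or]
        exact ⟨disjoint_right.1 hC (mem_insert_self _ _), ha⟩
      rw [union_insert]
      have := curved_insert (f := f) ha'
      have := lin_le_gain h ha'
      linarith
  dr A B e hAB := by
    by_cases he : e ∈ B
    · rw [insert_eq_of_mem he, sub_self]
      by_cases hA : e ∈ A
      · rw [insert_eq_of_mem hA, sub_self]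
      · rw [curved_insert hA]
        linarith [lin_le_gain h hA]
    · rw [curved_insert he, curved_insert fun hA => he (hAB hA)]
      linarith [h.dr A B e hAB]

lemma curved_nonneg (h : MonoDR f) (h0 : ∀ S, 0 ≤ f S) (S : Finset (Fin n)) : 0 ≤ curved f S := by
  have := h.curved.mono ∅ S (empty_subset _)
  have h1 : SubmodKnapsack.curved f ∅ = f ∅ := by simp [SubmodKnapsack.curved, weight]
  linarith [h0 ∅]

/-- The gain is largest at the empty set. The bound limits the thresholds that have to be tried for
a slot. -/
lemma curved_gain_le (h : MonoDR f) (h0 : ∀ S, 0 ≤ f S) (A : Finset (Fin n)) (e : Fin n) :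
    curved f (insert e A) - curved f A ≤ f {e} := by
  have h1 := h.curved.dr ∅ A e (empty_subset _)
  have h2 : SubmodKnapsack.curved f ∅ = f ∅ := by simp [SubmodKnapsack.curved, weight]
  have h3 : SubmodKnapsack.curved f (insert e ∅) = f {e} - lin f e := by
    simp [SubmodKnapsack.curved, weight]
  linarith [h0 ∅, lin_nonneg h e]

lemma lin_le_single (h : MonoDR f) (h0 : ∀ S, 0 ≤ f S) (e : Fin n) : lin f e ≤ f {e} := by
  have := lin_le_gain h (notMem_empty e)
  simp only [insert_empty_eq] at this
  linarith [h0 ∅]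

/-- Monotonicity of the curved part. It bounds the linear value lost when `O` is thinned out by the
loss in `f`, which is known to be small. -/
lemma lin_drop_le (h : MonoDR f) {O X : Finset (Fin n)} (hX : X ⊆ O) :
    weight (lin f) X ≤ f O - f (O \ X) := by
  have := h.curved.mono (O \ X) O sdiff_subset
  simp only [SubmodKnapsack.curved, weight_sdiff hX] at this
  linarith

/-- As `f ∅` may be positive, one element has to pay for it, which is why `O` must be nonempty. -/
lemma le_sum_single (h : MonoDR f) (h0 : ∀ S, 0 ≤ f S) {O : Finset (Fin n)} (hO : O.Nonempty) :
    f O ≤ ∑ e ∈ O, f {e} := by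
  obtain ⟨a, ha⟩ := hO
  have := h.union_le ∅ (O.erase a)
  have h2 := h.dr ∅ (O.erase a) a (empty_subset _)
  rw [insert_erase ha] at h2
  rw [← add_sum_erase _ _ ha]
  simp only [empty_union, insert_empty_eq] at this h2
  have h3 : ∑ e ∈ O.erase a, (f {e} - f ∅) ≤ ∑ e ∈ O.erase a, f {e} :=
    sum_le_sum fun i _ => by linarith [h0 ∅]
  linarith

lemma marginal_erase (f : Finset (Fin n) → ℝ) (e : Fin n) :
    marginal f (univ.erase e) {e} = lin f e := by
  simp only [marginal, lin, union_singleton, insert_erase (mem_univ e)]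

lemma curvature_mul_le (h : MonoDR f) (h0 : ∀ S, 0 ≤ f S) (e : Fin n) :
    (1 - curvature f) * f {e} ≤ lin f e := by
  classical
  by_cases he : f {e} = 0
  · rw [he, mul_zero]; exact lin_nonneg h e
  have hmem : e ∈ univ.filter fun e : Fin n => f {e} ≠ 0 := by simpa using he
  have hne : (univ.filter fun e : Fin n => f {e} ≠ 0).Nonempty := ⟨e, hmem⟩
  have hc : curvature f = 1 - (univ.filter fun e : Fin n => f {e} ≠ 0).inf' hne
      fun e => marginal f (univ.erase e) {e} / f {e} := by
    simp only [curvature]; rw [dif_pos]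
  have h1 := inf'_le (fun e => marginal f (univ.erase e) {e} / f {e}) hmem
  rw [hc, sub_sub_cancel]
  rw [marginal_erase] at h1
  have hpos : 0 < f {e} := lt_of_le_of_ne (h0 _) (Ne.symm he)
  rwa [le_div_iff₀ hpos] at h1

lemma curvature_mem (h : MonoDR f) (h0 : ∀ S, 0 ≤ f S) : 0 ≤ curvature f ∧ curvature f ≤ 1 := by
  classical
  unfold curvature
  split_ifs with hne
  · obtain ⟨e, he, heq⟩ := exists_mem_eq_inf' hne
      fun e => marginal f (univ.erase e) {e} / f {e}
    have heq' : _ = _ := heq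
    rw [heq', marginal_erase]
    have h1 := lin_le_single h h0 e
    have h2 := lin_nonneg h e
    have h3 : lin f e / f {e} ≤ 1 := div_le_one_of_le₀ h1 (h0 _)
    have h4 : 0 ≤ lin f e / f {e} := div_nonneg h2 (h0 _)
    constructor <;> linarith
  · simp

/-- The only place where the curvature enters the guarantee: it makes the curved part of `O` at most
`curvature f * f O`. -/
lemma curvature_sum_le (h : MonoDR f) (h0 : ∀ S, 0 ≤ f S) {O : Finset (Fin n)}
    (hO : O.Nonempty) : (1 - curvature f) * f O ≤ weight (lin f) O := by
  have h1 := le_sum_single h h0 hO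
  have h2 := (curvature_mem h h0).2
  calc (1 - curvature f) * f O ≤ (1 - curvature f) * ∑ e ∈ O, f {e} :=
        mul_le_mul_of_nonneg_left h1 (by linarith)
    _ = ∑ e ∈ O, (1 - curvature f) * f {e} := by rw [mul_sum]
    _ ≤ weight (lin f) O := sum_le_sum fun e _ => curvature_mul_le h h0 e

end


/-! ### Splitting a feasible set into large and small elements -/

section
variable {E : Type*} [DecidableEq E] {f : Finset E → ℝ} {w : E → ℝ}

/-- If elements are collected one at a time until the weight first reaches `γ`, the last one
overshoots by at most `θ`. -/
lemma exists_chunk {A : Finset E} {γ θ : ℝ} (hγ : 0 ≤ γ) (hθ : 0 ≤ θ) (hA : ∀ e ∈ A, w e ≤ θ)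
    (h : γ ≤ weight w A) : ∃ X ⊆ A, γ ≤ weight w X ∧ weight w X ≤ γ + θ := by
  induction A using Finset.induction_on with
  | empty => exact ⟨∅, subset_rfl, h, by simp [weight]; linarith⟩
  | insert a s ha ih =>
    by_cases hs : γ ≤ weight w s
    · obtain ⟨X, hX, h1⟩ := ih (fun e he => hA e (mem_insert_of_mem he)) hs
      exact ⟨X, hX.trans (subset_insert _ _), h1⟩
    · refine ⟨_, subset_rfl, h, ?_⟩
      rw [weight_insert ha]
      have := hA a (mem_insert_self _ _)
      linarith

lemma exists_chunks {γ θ : ℝ} (hγ : 0 ≤ γ) (hθ : 0 ≤ θ) (q : ℕ) :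
    ∀ A : Finset E, (∀ e ∈ A, w e ≤ θ) → q * (γ + θ) ≤ weight w A →
    ∃ X : ℕ → Finset E, (∀ i < q, X i ⊆ A ∧ γ ≤ weight w (X i)) ∧
      ∀ i < q, ∀ j < i, Disjoint (X i) (X j) := by
  induction q with
  | zero => exact fun A _ _ => ⟨fun _ => ∅, by simp, by simp⟩
  | succ q ih =>
    intro A hA h
    push_cast at h
    have hq : (0 : ℝ) ≤ q * (γ + θ) := by positivity
    obtain ⟨Y, hYA, hY1, hY2⟩ := exists_chunk hγ hθ hA (by linarith)
    obtain ⟨X, hX, hd⟩ := ih (A \ Y) (fun e he => hA e (mem_sdiff.1 he).1)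
      (by rw [weight_sdiff hYA]; linarith)
    refine ⟨fun i => if i = q then Y else X i, fun i hi => ?_, fun i hi j hj => ?_⟩
    · by_cases hiq : i = q
      · simp [hiq, hYA, hY1]
      · simp only [hiq, if_false]
        have := hX i (by omega)
        exact ⟨this.1.trans sdiff_subset, this.2⟩
    · have hjq : j ≠ q := by omega
      simp only [hjq, if_false]
      by_cases hiq : i = q
      · simp only [hiq, if_true]
        exact (disjoint_of_subset_left (hX j (by omega)).1 sdiff_disjoint).symm
      · simp only [hiq, if_false]
        exact hd i (by omega) j hj

/-- The elements of `O` that are heavy at one of the first `i` scales. -/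
def heavy (w : E → ℝ) (O : Finset E) (M : ℕ) : ℕ → Finset E
  | 0 => ∅
  | i + 1 => heavy w O M i ∪ O.filter fun o => (1 - weight w (heavy w O M i)) / M < w o

lemma heavy_subset (O : Finset E) (M i : ℕ) : heavy w O M i ⊆ O := by
  induction i with
  | zero => exact empty_subset _
  | succ i ih => exact union_subset ih (filter_subset _ _)

lemma heavy_mono (O : Finset E) (M : ℕ) : Monotone (heavy w O M) :=
  monotone_nat_of_le_succ fun _ => subset_union_left

/-- The threshold decreases from level to level, so elements that entered early also exceed the
current one. -/
lemma lt_of_mem_heavy (hw : ∀ e, 0 ≤ w e) {O : Finset E} {M i : ℕ} {a : E}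
    (ha : a ∈ heavy w O M i) : (1 - weight w (heavy w O M i)) / M < w a := by
  induction i with
  | zero => exact absurd ha (notMem_empty _)
  | succ i ih =>
    have h1 : (1 - weight w (heavy w O M (i + 1))) / M ≤ (1 - weight w (heavy w O M i)) / M := by
      have := weight_mono hw (heavy_mono (w := w) O M (Nat.le_succ i))
      gcongr
    rcases mem_union.1 ha with h | h
    · exact h1.trans_lt (ih h)
    · exact h1.trans_lt (mem_filter.1 h).2

/-- The new elements of a level each weigh more than a fraction `1 / M` of the remaining capacity
and fit into it together, so a level adds at most `M` of them. -/
lemma card_heavy_le (hw : ∀ e, 0 ≤ w e) {O : Finset E} (hO : weight w O ≤ 1) {M : ℕ}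
    (hM : 0 < M) (i : ℕ) : (heavy w O M i).card ≤ i * M := by
  induction i with
  | zero => simp [heavy]
  | succ i ih =>
    set L := heavy w O M i
    set G := (O.filter fun o => (1 - weight w L) / M < w o) \ L with hG
    have hL : L ⊆ O := heavy_subset O M i
    have hM' : (0 : ℝ) < M := by exact_mod_cast hM
    have e1 : heavy w O M (i + 1) = L ∪ G := by
      rw [hG, union_sdiff_self_eq_union]; rfl
    have hGw : weight w G ≤ 1 - weight w L := by
      have hd : Disjoint L G := disjoint_sdiff
      have : weight w (L ∪ G) ≤ weight w O := by
        rw [← e1]; exact weight_mono hw (heavy_subset _ _ _)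
      rw [weight_union hd] at this
      linarith
    have hGl : ∀ o ∈ G, (1 - weight w L) / M < w o := fun o ho =>
      (mem_filter.1 (mem_sdiff.1 ho).1).2
    have hc : G.card ≤ M := by
      by_contra! hlt
      have hne : G.Nonempty := card_pos.1 (by omega)
      have h1 : ∑ o ∈ G, (1 - weight w L) / M < weight w G := sum_lt_sum_of_nonempty hne hGl
      rw [sum_const, nsmul_eq_mul] at h1
      have h2 : (0:ℝ) ≤ (1 - weight w L) / M := by
        have : weight w L ≤ 1 := (weight_mono hw hL).trans hO
        exact div_nonneg (by linarith) hM'.le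
      have h3 : (M : ℝ) * ((1 - weight w L) / M) ≤ G.card * ((1 - weight w L) / M) :=
        mul_le_mul_of_nonneg_right (by exact_mod_cast hlt.le) h2
      rw [mul_div_cancel₀ _ hM'.ne'] at h3
      linarith
    rw [e1]
    calc (L ∪ G).card ≤ L.card + G.card := card_union_le _ _
      _ ≤ i * M + M := by omega
      _ = (i + 1) * M := by ring

/-- A feasible set contains, up to a small loss in value, few large elements `L` and small
elements `A` that leave some room in the knapsack. -/
lemma exists_large_small (hm : Monotone f) (hs : IsSubmodular f) (h0 : ∀ S, 0 ≤ f S)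
    (hw : ∀ e, 0 ≤ w e) {O : Finset E} (hO : weight w O ≤ 1) {K M : ℕ} (hK : 0 < K)
    (hM : K * (3 * K + 1) + 3 * K ≤ M) :
    ∃ L A : Finset E, L ⊆ O ∧ A ⊆ O ∧ Disjoint L A ∧ L.card ≤ K * M ∧ weight w L ≤ 1 ∧
      (∀ e ∈ A, w e ≤ (1 - weight w L) / M) ∧ (∀ e ∈ L, (1 - weight w L) / M < w e) ∧
      weight w A ≤ (1 - weight w L) - 3 * K * ((1 - weight w L) / M) ∧
      f O - f (L ∪ A) ≤ 2 * (f O / K) := by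
  have hM0 : 0 < M := by nlinarith
  have hM' : (0 : ℝ) < M := by exact_mod_cast hM0
  have hK' : (0 : ℝ) < K := by exact_mod_cast hK
  -- The increments of `heavy` are disjoint, so one of the first `K` can be dropped cheaply. Without
  -- it, every element of `O` is either in `L` or below the threshold that belongs to `L`.
  obtain ⟨i, hi, hdrop⟩ := exists_cheap_drop (f := f) (O := O)
    (X := fun i => heavy w O M (i + 1) \ heavy w O M i) hs h0 hK (by
      intro i _ j hj
      have : heavy w O M (j + 1) ⊆ heavy w O M i := heavy_mono O M hj
      exact disjoint_of_subset_right (sdiff_subset.trans this) sdiff_disjoint)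
  set L := heavy w O M i with hL
  set W := 1 - weight w L with hW
  have hLO : L ⊆ O := heavy_subset O M i
  have hLw : weight w L ≤ 1 := (weight_mono hw hLO).trans hO
  have hW0 : 0 ≤ W := by linarith
  set A₁ := O \ heavy w O M (i + 1) with hA₁
  have hA₁L : Disjoint L A₁ :=
    disjoint_of_subset_left (heavy_mono O M (Nat.le_succ i)) disjoint_sdiff
  have hA₁small : ∀ e ∈ A₁, w e ≤ W / M := by
    intro e he
    by_contra! hc
    refine (mem_sdiff.1 he).2 (mem_union_right _ (mem_filter.2 ⟨(mem_sdiff.1 he).1, hc⟩))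
  have hsplit : O \ (heavy w O M (i + 1) \ L) = L ∪ A₁ := by
    ext x
    have h1 : x ∈ L → x ∈ O := fun h => hLO h
    have h2 : x ∈ L → x ∈ heavy w O M (i + 1) := fun h => heavy_mono O M (Nat.le_succ i) h
    simp only [mem_sdiff, mem_union, A₁]; tauto
  rw [hsplit] at hdrop
  have hA₁w : weight w A₁ ≤ W := by
    have : weight w (L ∪ A₁) ≤ weight w O :=
      weight_mono hw (union_subset hLO sdiff_subset)
    rw [weight_union hA₁L] at this
    linarith
  have hfO : 0 ≤ f O / K := div_nonneg (h0 O) hK'.le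
  have hcard : L.card ≤ K * M :=
    (card_heavy_le hw hO hM0 i).trans (Nat.mul_le_mul_right _ hi.le)
  have hlarge : ∀ e ∈ L, W / M < w e := fun e he => lt_of_mem_heavy hw he
  by_cases hcase : weight w A₁ ≤ W - 3 * K * (W / M)
  · exact ⟨L, A₁, hLO, sdiff_subset, hA₁L, hcard, hLw, hA₁small, hlarge, hcase, by linarith⟩
  · push Not at hcase
    have hWM : 0 ≤ W / M := div_nonneg hW0 hM'.le
    -- If `A₁` leaves too little room, it is heavy enough for `K` disjoint chunks, each at least as
    -- heavy as the required room; this is the meaning of the lower bound on `M`. The cheapest chunk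
    -- is dropped.
    obtain ⟨X, hX, hd⟩ := exists_chunks (w := w) (γ := 3 * K * (W / M)) (θ := W / M)
      (by positivity) hWM K A₁ hA₁small (by
        refine le_trans ?_ hcase.le
        have h1 : ((K * (3 * K + 1) + 3 * K : ℕ) : ℝ) * (W / M) ≤ M * (W / M) :=
          mul_le_mul_of_nonneg_right (by exact_mod_cast hM) hWM
        rw [mul_div_cancel₀ _ hM'.ne'] at h1
        push_cast at h1
        linarith)
    obtain ⟨j, hj, hdrop2⟩ := exists_cheap_drop (f := f) (O := L ∪ A₁) hs h0 hK hd
    have hXd : Disjoint L (X j) := disjoint_of_subset_right (hX j hj).1 hA₁L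
    have hsplit2 : (L ∪ A₁) \ X j = L ∪ (A₁ \ X j) := by
      rw [union_sdiff_distrib, sdiff_eq_self_of_disjoint hXd]
    rw [hsplit2] at hdrop2
    refine ⟨L, A₁ \ X j, hLO, sdiff_subset.trans sdiff_subset,
      disjoint_of_subset_right sdiff_subset hA₁L, hcard, hLw,
      fun e he => hA₁small e (mem_sdiff.1 he).1, hlarge, ?_, ?_⟩
    · rw [weight_sdiff (hX j hj).1]
      have := (hX j hj).2
      linarith
    · have : f (L ∪ A₁) / K ≤ f O / K := by
        have : f (L ∪ A₁) ≤ f O := hm (union_subset hLO sdiff_subset)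
        gcongr
      linarith

/-! ### Domination of weights -/

/-- Above each threshold, `T` has at most as many elements as `L`. -/
def Dominated (w : E → ℝ) (T L : Finset E) : Prop :=
  ∀ z : ℝ, (T.filter fun e => z ≤ w e).card ≤ (L.filter fun e => z ≤ w e).card

/-- The heaviest element of `T` is matched with an element of `L` that is at least as heavy;
removing both keeps domination. -/
lemma Dominated.weight_le (hw : ∀ e, 0 ≤ w e) {T L : Finset E} (h : Dominated w T L) :
    weight w T ≤ weight w L := by
  induction hc : T.card generalizing T L with
  | zero =>
    rw [card_eq_zero] at hc
    subst hc
    exact (weight_nonneg hw L).trans' (by simp [weight])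
  | succ c ih =>
    have hT : T.Nonempty := card_pos.1 (by omega)
    obtain ⟨x, hx, hxm⟩ := exists_max_image T w hT
    have hx' := h (w x)
    have h1 : 0 < (T.filter fun e => w x ≤ w e).card :=
      card_pos.2 ⟨x, mem_filter.2 ⟨hx, le_rfl⟩⟩
    obtain ⟨o, ho⟩ := card_pos.1 (h1.trans_le hx')
    rw [mem_filter] at ho
    have hdom : Dominated w (T.erase x) (L.erase o) := by
      intro z
      by_cases hz : z ≤ w x
      · rw [filter_erase, filter_erase, card_erase_of_mem (mem_filter.2 ⟨hx, hz⟩),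
          card_erase_of_mem (mem_filter.2 ⟨ho.1, hz.trans ho.2⟩)]
        have := h z
        omega
      · rw [filter_eq_empty_iff.2]
        · simp
        · intro e he
          have := hxm e (mem_of_mem_erase he)
          intro h'
          exact hz (h'.trans this)
    have := ih hdom (by rw [card_erase_of_mem hx]; omega)
    have e1 : weight w T = w x + weight w (T.erase x) := (add_sum_erase _ _ hx).symm
    have e2 : weight w L = w o + weight w (L.erase o) := (add_sum_erase _ _ ho.1).symm
    linarith [ho.2]

/-- Adding the lightest missing element of a class `C` keeps domination, as long as `L ⊆ C` has
more elements. -/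
lemma Dominated.insert_lightest {T L C : Finset E} (h : Dominated w T L) (hL : L ⊆ C)
    (hc : T.card < L.card) {x : E} (hxT : x ∉ T)
    (hmin : ∀ e ∈ C, e ∉ T → w x ≤ w e) : Dominated w (insert x T) L := by
  intro z
  by_cases hz : z ≤ w x
  · have hxz : x ∉ T.filter fun e => z ≤ w e := fun hh => hxT (mem_filter.1 hh).1
    rw [filter_insert, if_pos hz, card_insert_of_notMem hxz]
    -- An element of `L` lighter than `z` is lighter than `x`, hence already in `T` by the choice of
    -- `x`. So `T` has no fewer elements below `z` than `L`, and the strict inequality of the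
    -- cardinalities must come from above `z`.
    have h1 : (L.filter fun e => ¬ z ≤ w e) ⊆ T.filter fun e => ¬ z ≤ w e := by
      intro e he
      rw [mem_filter] at he ⊢
      refine ⟨?_, he.2⟩
      by_contra hcon
      exact he.2 (hz.trans (hmin e (hL he.1) hcon))
    have h2 := card_le_card h1
    have h3 := card_filter_add_card_filter_not (s := T) (fun e => z ≤ w e)
    have h4 := card_filter_add_card_filter_not (s := L) (fun e => z ≤ w e)
    omega
  · rw [filter_insert, if_neg hz]
    exact h z

end


/-! ### The algorithm as a function of the guesses -/

/-- Extension by zero to all natural numbers. -/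
def natExt (w : Fin n → ℝ) (x : ℕ) : ℝ := if h : x < n then w ⟨x, h⟩ else 0

/-- Insertion of the element with index `x`, if there is one. -/
def ins (A : Finset (Fin n)) (x : ℕ) : Finset (Fin n) := if h : x < n then insert ⟨x, h⟩ A else A

/-- Membership of the element with index `x`. -/
def HasIdx (A : Finset (Fin n)) (x : ℕ) : Prop := ∃ h : x < n, (⟨x, h⟩ : Fin n) ∈ A

@[simp] lemma natExt_val (w : Fin n → ℝ) (e : Fin n) : natExt w e = w e := by
  simp [natExt]

lemma natExt_of_le (w : Fin n → ℝ) {x : ℕ} (h : n ≤ x) : natExt w x = 0 := by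
  simp [natExt, not_lt.2 h]

@[simp] lemma ins_val (A : Finset (Fin n)) (e : Fin n) : ins A e = insert e A := by
  simp [ins]

lemma ins_of_le (A : Finset (Fin n)) {x : ℕ} (h : n ≤ x) : ins A x = A := by
  simp [ins, not_lt.2 h]

@[simp] lemma hasIdx_val (A : Finset (Fin n)) (e : Fin n) : HasIdx A e ↔ e ∈ A := by
  simp [HasIdx]

lemma mem_ins {A : Finset (Fin n)} {x : ℕ} {e : Fin n} : e ∈ ins A x ↔ e ∈ A ∨ x = e := by
  unfold ins
  split_ifs with h
  · rw [mem_insert, Fin.ext_iff]; simp only; constructor <;> rintro (h | h) <;> simp [h]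
  · constructor
    · exact Or.inl
    · rintro (h' | rfl)
      · exact h'
      · exact absurd e.2 h

lemma subset_ins (A : Finset (Fin n)) (x : ℕ) : A ⊆ ins A x := fun _ h => mem_ins.2 (Or.inl h)

/-- The set that consists of `S` and the picks `pk (i + k * τ i)` of the slots `i < j`. -/
def pickUpTo (k : ℕ) (pk τ : ℕ → ℕ) (S : Finset (Fin n)) : ℕ → Finset (Fin n)
  | 0 => S
  | j + 1 => ins (pickUpTo k pk τ S j) (pk (j + k * τ j))

lemma mem_pickUpTo {k : ℕ} {pk τ : ℕ → ℕ} {S : Finset (Fin n)} {j : ℕ} {e : Fin n} :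
    e ∈ pickUpTo k pk τ S j ↔ e ∈ S ∨ ∃ i < j, pk (i + k * τ i) = e := by
  induction j with
  | zero => simp [pickUpTo]
  | succ j ih =>
    rw [pickUpTo, mem_ins, ih, or_assoc]
    refine or_congr_right ⟨?_, ?_⟩
    · rintro (⟨i, hi, h⟩ | h)
      · exact ⟨i, by omega, h⟩
      · exact ⟨j, by omega, h⟩
    · rintro ⟨i, hi, h⟩
      rcases Nat.lt_succ_iff_lt_or_eq.1 hi with h' | rfl
      · exact Or.inl ⟨i, h', h⟩
      · exact Or.inr h

/-- The set that consists of `S` and the picks of all slots. -/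
def pickSet (k : ℕ) (pk τ : ℕ → ℕ) (S : Finset (Fin n)) : Finset (Fin n) := pickUpTo k pk τ S k

lemma mem_pickSet {k : ℕ} {pk τ : ℕ → ℕ} {S : Finset (Fin n)} {e : Fin n} :
    e ∈ pickSet k pk τ S ↔ e ∈ S ∨ ∃ i < k, pk (i + k * τ i) = e := mem_pickUpTo

lemma pickSet_insert (k : ℕ) (pk τ : ℕ → ℕ) (S : Finset (Fin n)) (e : Fin n) :
    pickSet k pk τ (insert e S) = insert e (pickSet k pk τ S) := by
  ext x; simp only [mem_pickSet, mem_insert, or_assoc]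

lemma pickSet_mono {k : ℕ} {pk τ : ℕ → ℕ} {S S' : Finset (Fin n)} (h : S ⊆ S') :
    pickSet k pk τ S ⊆ pickSet k pk τ S' := fun _ hx =>
  mem_pickSet.2 ((mem_pickSet.1 hx).imp_left fun a => h a)

/-- A choice of one time for each slot, as a function on the natural numbers. -/
def scenario {k m : ℕ} (τ : Fin k → Fin m) (i : ℕ) : ℕ := if h : i < k then τ ⟨i, h⟩ else 0

lemma scenario_of_lt {k m : ℕ} (τ : Fin k → Fin m) {i : ℕ} (h : i < k) :
    scenario τ i = τ ⟨i, h⟩ := by simp [scenario, h]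

/-- The average of `g` over all scenarios. -/
def avg (g : Finset (Fin n) → ℝ) (m k : ℕ) (pk : ℕ → ℕ) (S : Finset (Fin n)) : ℝ :=
  (∑ τ : Fin k → Fin m, g (pickSet k pk (scenario τ) S)) / (m : ℝ) ^ k

lemma avg_insert_sub (g : Finset (Fin n) → ℝ) (m k : ℕ) (pk : ℕ → ℕ) (S : Finset (Fin n))
    (e : Fin n) : avg g m k pk (insert e S) - avg g m k pk S =
      (∑ τ : Fin k → Fin m, (g (insert e (pickSet k pk (scenario τ) S)) -
        g (pickSet k pk (scenario τ) S))) / (m : ℝ) ^ k := by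
  simp only [avg, pickSet_insert, sum_sub_distrib, sub_div]

lemma MonoDR.avg {g : Finset (Fin n) → ℝ} (hg : MonoDR g) (m k : ℕ) (pk : ℕ → ℕ) :
    MonoDR (avg g m k pk) where
  mono A B h := by
    unfold SubmodKnapsack.avg
    gcongr with τ
    exact hg.mono _ _ (pickSet_mono h)
  dr A B e h := by
    rw [avg_insert_sub, avg_insert_sub]
    exact div_le_div_of_nonneg_right (sum_le_sum fun τ _ => hg.dr _ _ _ (pickSet_mono h))
      (by positivity)

/-- If `φ` does not depend on the time of slot `i`, each of the `m` possible times carries the same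
share of the sum. -/
lemma sum_filter_eq_div {k m : ℕ} (i : Fin k) (t : Fin m) (φ : (Fin k → Fin m) → ℝ)
    (hφ : ∀ τ, φ (Function.update τ i t) = φ τ) :
    ∑ τ with τ i = t, φ τ = (∑ τ, φ τ) / m := by
  have hm : (m : ℝ) ≠ 0 := by
    have := t.pos
    positivity
  rw [eq_div_iff hm, ← sum_fiberwise univ (fun τ : Fin k → Fin m => τ i) φ]
  have : ∀ s ∈ (univ : Finset (Fin m)),
      ∑ τ with τ i = s, φ τ = ∑ τ with τ i = t, φ τ := by
    intro s _
    refine sum_nbij' (fun τ => Function.update τ i t) (fun τ => Function.update τ i s) ?_ ?_ ?_ ?_ ?_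
    · intro τ _; simp
    · intro τ _; simp
    · intro τ h
      rw [mem_filter] at h
      simp [← h.2]
    · intro τ h
      rw [mem_filter] at h
      simp [← h.2]
    · intro τ _; rw [hφ]
  rw [sum_congr rfl this, sum_const, card_univ, Fintype.card_fin, nsmul_eq_mul, mul_comm]

/-- A new pick gains at least a fraction `1 / m` of its average gain at any later time. -/
lemma le_avg_update {g : Finset (Fin n) → ℝ} (hg : MonoDR g) {m k i t : ℕ} (hi : i < k)
    (ht : t < m) {pk pk' : ℕ → ℕ} {S S' : Finset (Fin n)} (hS : S ⊆ S')
    (hp : pk (i + k * t) = n)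
    (hpk : ∀ q < k * m, pk q < n → pk' q = pk q) (e : Fin n) :
    (avg g m k pk' (insert e S') - avg g m k pk' S') / m ≤
      avg g m k (Function.update pk (i + k * t) e) S - avg g m k pk S := by
  classical
  set p := i + k * t with hpdef
  have hidx : ∀ j < k, ∀ s, j + k * s = p → j = i ∧ s = t := by
    intro j hj s h
    have h1 : (j + k * s) % k = (i + k * t) % k := by rw [h]
    have h2 : (j + k * s) / k = (i + k * t) / k := by rw [h]
    rw [Nat.add_mul_mod_self_left, Nat.add_mul_mod_self_left, Nat.mod_eq_of_lt hj,
      Nat.mod_eq_of_lt hi] at h1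
    rw [Nat.add_mul_div_left _ _ (by omega), Nat.add_mul_div_left _ _ (by omega),
      Nat.div_eq_of_lt hj, Nat.div_eq_of_lt hi] at h2
    omega
  -- Slot `i` is moved to time `t`, where it has no pick yet because the index `n` stands for no
  -- element. So `Y τ` contains `S` and the picks of the other slots only, and it does not depend on
  -- `τ i`.
  let Y : (Fin k → Fin m) → Finset (Fin n) := fun τ =>
    pickSet k pk (scenario (Function.update τ ⟨i, hi⟩ ⟨t, ht⟩)) S
  let φ : (Fin k → Fin m) → ℝ := fun τ => g (insert e (Y τ)) - g (Y τ)
  have hφ : ∀ τ, φ (Function.update τ ⟨i, hi⟩ ⟨t, ht⟩) = φ τ := by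
    intro τ; simp [φ, Y]
  have hterm : ∀ τ : Fin k → Fin m, g (pickSet k (Function.update pk p e) (scenario τ) S) -
      g (pickSet k pk (scenario τ) S) = if τ ⟨i, hi⟩ = ⟨t, ht⟩ then φ τ else 0 := by
    intro τ
    split_ifs with h
    · have hY : Y τ = pickSet k pk (scenario τ) S := by simp [Y, ← h]
      simp only [φ, hY]
      congr 2
      ext x
      rw [mem_insert, mem_pickSet, mem_pickSet]
      constructor
      · rintro (hx | ⟨j, hj, hx⟩)
        · exact Or.inr (Or.inl hx)
        · by_cases hjp : j + k * scenario τ j = p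
          · rw [hjp, Function.update_self] at hx
            exact Or.inl (Fin.ext hx.symm)
          · rw [Function.update_of_ne hjp] at hx
            exact Or.inr (Or.inr ⟨j, hj, hx⟩)
      · rintro (rfl | hx | ⟨j, hj, hx⟩)
        · refine Or.inr ⟨i, hi, ?_⟩
          rw [scenario_of_lt τ hi, h, ← hpdef, Function.update_self]
        · exact Or.inl hx
        · refine Or.inr ⟨j, hj, ?_⟩
          rw [Function.update_of_ne, hx]
          intro hjp
          rw [hjp, hp] at hx
          exact absurd x.2 (by omega)
    · have : pickSet k (Function.update pk p e) (scenario τ) S = pickSet k pk (scenario τ) S := by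
        ext x
        rw [mem_pickSet, mem_pickSet]
        refine or_congr_right (exists_congr fun j => and_congr_right fun hj => ?_)
        rw [Function.update_of_ne]
        intro hjp
        obtain ⟨rfl, hs⟩ := hidx j hj _ hjp
        rw [scenario_of_lt τ hi] at hs
        exact h (Fin.ext hs)
      rw [this, sub_self]
  have hY : ∀ τ, Y τ ⊆ pickSet k pk' (scenario τ) S' := by
    intro τ x hx
    rw [mem_pickSet] at hx ⊢
    rcases hx with hx | ⟨j, hj, hx⟩
    · exact Or.inl (hS hx)
    · right
      refine ⟨j, hj, ?_⟩
      by_cases hji : j = i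
      · subst hji
        rw [scenario_of_lt _ hj, Function.update_self] at hx
        simp only at hx
        rw [hp] at hx
        exact absurd x.2 (by omega)
      · rw [scenario_of_lt _ hj, Function.update_of_ne (by simpa [Fin.ext_iff] using hji),
          ← scenario_of_lt τ hj] at hx
        rw [hpk _ _ (by rw [hx]; exact x.2), hx]
        have h1 : scenario τ j < m := by rw [scenario_of_lt τ hj]; exact (τ _).2
        calc j + k * scenario τ j < k + k * scenario τ j := by omega
          _ = k * (scenario τ j + 1) := by ring
          _ ≤ k * m := Nat.mul_le_mul_left _ h1
  -- Only the scenarios with `τ i = t` see the new pick, and in these the old pick set is `Y τ`.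
  -- They form a fraction `1 / m` of all scenarios.
  have h1 : avg g m k (Function.update pk p e) S - avg g m k pk S =
      (∑ τ, φ τ) / m / (m : ℝ) ^ k := by
    rw [← sum_filter_eq_div ⟨i, hi⟩ ⟨t, ht⟩ φ hφ, avg, avg, ← sub_div, ← sum_sub_distrib,
      sum_congr rfl fun τ _ => hterm τ, sum_filter]
  rw [h1, avg_insert_sub, div_right_comm]
  gcongr with τ
  exact hg.dr _ _ _ (hY τ)

open Classical in
/-- The best index below `j` among the candidates, scanned in increasing order; it is `N` if there
is no candidate. -/
def argBest (N : ℕ) (cand : ℕ → Prop) (better : ℕ → ℕ → Prop) : ℕ → ℕ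
  | 0 => N
  | j + 1 => if cand j ∧ (¬ argBest N cand better j < N ∨ better j (argBest N cand better j))
      then j else argBest N cand better j

/-- Transitivity is required among candidates only: comparing densities by cross-multiplication is
transitive for positive weights, but not in general. -/
lemma argBest_spec {N : ℕ} {cand : ℕ → Prop} {better : ℕ → ℕ → Prop}
    (hirr : ∀ a, ¬ better a a)
    (htr : ∀ a b c, cand a → cand b → cand c → better a b → better b c → better a c) {j : ℕ}
    (hj : j ≤ N) :
    (argBest N cand better j = N ∧ ∀ e < j, ¬ cand e) ∨
      (argBest N cand better j < j ∧ cand (argBest N cand better j) ∧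
        ∀ e < j, cand e → ¬ better e (argBest N cand better j)) := by
  induction j with
  | zero => left; simp [argBest]
  | succ j ih =>
    have ih := ih (by omega)
    rw [argBest]
    split_ifs with h
    · right
      refine ⟨by omega, h.1, fun e he hc hb => ?_⟩
      rcases Nat.lt_succ_iff_lt_or_eq.1 he with he' | rfl
      · rcases ih with ⟨_, h2⟩ | ⟨h1, h2, h3⟩
        · exact h2 e he' hc
        · rcases h.2 with h4 | h4
          · omega
          · exact h3 e he' hc (htr _ _ _ hc h.1 h2 hb h4)
      · exact hirr _ hb
    · rcases ih with ⟨h1, h2⟩ | ⟨h1, h2, h3⟩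
      · left
        refine ⟨h1, fun e he hc => ?_⟩
        rcases Nat.lt_succ_iff_lt_or_eq.1 he with he' | rfl
        · exact h2 e he' hc
        · exact h ⟨hc, Or.inl (by omega)⟩
      · right
        refine ⟨by omega, h2, fun e he hc hb => ?_⟩
        rcases Nat.lt_succ_iff_lt_or_eq.1 he with he' | rfl
        · exact h3 e he' hc hb
        · exact h ⟨hc, Or.inr hb⟩

/-- An instance of the problem, with the number `m` of stages and the number `k` of slots. -/
structure Inst (n : ℕ) where
  f : Finset (Fin n) → ℝ
  w : Fin n → ℝ
  m : ℕ
  k : ℕ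

/-- The quantities that the algorithm guesses. -/
structure Guess where
  om : ℝ
  y : ℝ
  de : ℝ
  cls : ℕ → ℕ → ℕ
  thr : ℕ → ℕ → ℕ
  beta : ℕ → ℕ
  tau : ℕ → ℕ
  fil : ℕ → ℕ

namespace Inst
variable (I : Inst n)

/-- The average of the curved part over all scenarios. -/
def G (pk : ℕ → ℕ) (S : Finset (Fin n)) : ℝ := avg (curved I.f) I.m I.k pk S

/-- The index `x` belongs to a large element whose linear part is about `c * de`. -/
def InClass (om de : ℝ) (c x : ℕ) : Prop :=
  om < natExt I.w x ∧ ¬ natExt (lin I.f) x < c * de ∧ natExt (lin I.f) x < (c + 1) * de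

/-- The lightest element of a class whose gain reaches the threshold. -/
def slotPick (om de : ℝ) (c th p : ℕ) (pk : ℕ → ℕ) (S : Finset (Fin n)) : ℕ :=
  argBest n (fun e => I.InClass om de c e ∧
      ¬ I.G (Function.update pk p e) S - I.G pk S < th * de)
    (fun e b => natExt I.w e < natExt I.w b) n

/-- The picks after the first `i` slots have been treated at stage `t`. -/
def slots (om de : ℝ) (c th : ℕ → ℕ) (t : ℕ) (pk : ℕ → ℕ) (S : Finset (Fin n)) : ℕ → ℕ → ℕ
  | 0 => pk
  | i + 1 => Function.update (slots om de c th t pk S i) (i + I.k * t)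
      (I.slotPick om de (c i) (th i) (i + I.k * t) (slots om de c th t pk S i) S)

/-- The distorted gain of a small element. -/
def smallVal (a : ℝ) (pk : ℕ → ℕ) (S : Finset (Fin n)) (e : ℕ) : ℝ :=
  a * (I.G pk (ins S e) - I.G pk S) + natExt (lin I.f) e

/-- The small element of the largest density. -/
def smallPick (om a : ℝ) (pk : ℕ → ℕ) (S : Finset (Fin n)) : ℕ :=
  argBest n (fun e => 0 < natExt I.w e ∧ ¬ om < natExt I.w e ∧ ¬ HasIdx S e)
    (fun e b => I.smallVal a pk S b * natExt I.w e < I.smallVal a pk S e * natExt I.w b) n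

open Classical in
/-- `j` rounds of the density greedy algorithm, stopped as soon as the weight reaches `B`. -/
def smallRun (om a B : ℝ) (pk : ℕ → ℕ) (S : Finset (Fin n)) : ℕ → Finset (Fin n)
  | 0 => S
  | j + 1 => if weight I.w (smallRun om a B pk S j) < B then
      ins (smallRun om a B pk S j) (I.smallPick om a pk (smallRun om a B pk S j))
    else smallRun om a B pk S j

/-- The weight of the curved part at stage `t`. -/
def coef (m t : ℕ) : ℝ := ((m : ℝ) / (m + 1)) ^ m * (((m : ℝ) + 1) / m) ^ t

/-- One stage of the algorithm. -/
def stage (g : Guess) (t : ℕ) (s : (ℕ → ℕ) × Finset (Fin n)) : (ℕ → ℕ) × Finset (Fin n) :=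
  (I.slots g.om g.de (g.cls t) (g.thr t) t s.1 s.2 I.k,
    I.smallRun g.om (coef I.m t) (g.beta t * g.y)
      (I.slots g.om g.de (g.cls t) (g.thr t) t s.1 s.2 I.k) s.2 n)

/-- The elements of weight zero. -/
def zeros : Finset (Fin n) := univ.filter fun e => ¬ 0 < I.w e

/-- The state after `t` stages. -/
def state (g : Guess) (pk : ℕ → ℕ) : ℕ → (ℕ → ℕ) × Finset (Fin n)
  | 0 => (pk, I.zeros)
  | t + 1 => I.stage g t (state g pk t)

/-- The set after `j` missing large elements have been filled in. -/
def fills (g : Guess) (T : Finset (Fin n)) : ℕ → Finset (Fin n)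
  | 0 => T
  | j + 1 => ins (fills g T j) (argBest n
      (fun e => I.InClass g.om g.de (g.fil j) e ∧ ¬ HasIdx (fills g T j) e)
      (fun e b => natExt I.w e < natExt I.w b) n)

/-- The candidate that belongs to a guess. -/
def candidate (g : Guess) (pk : ℕ → ℕ) : Finset (Fin n) :=
  I.fills g (pickSet I.k (I.state g pk I.m).1 g.tau (I.state g pk I.m).2) I.k

end Inst


/-! ### The small elements in one stage -/

namespace Inst
variable {I : Inst n}

lemma smallPick_spec (I : Inst n) (om a : ℝ) (pk : ℕ → ℕ) (S : Finset (Fin n)) :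
    (I.smallPick om a pk S = n ∧ ∀ e, 0 < I.w e → I.w e ≤ om → e ∈ S) ∨
    ∃ b : Fin n, I.smallPick om a pk S = b ∧ 0 < I.w b ∧ I.w b ≤ om ∧ b ∉ S ∧
      ∀ e : Fin n, 0 < I.w e → I.w e ≤ om → e ∉ S →
        I.smallVal a pk S e * I.w b ≤ I.smallVal a pk S b * I.w e := by
  rcases argBest_spec (N := n)
      (cand := fun e => 0 < natExt I.w e ∧ ¬ om < natExt I.w e ∧ ¬ HasIdx S e)
      (better := fun e b =>
        I.smallVal a pk S b * natExt I.w e < I.smallVal a pk S e * natExt I.w b)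
      (fun x => lt_irrefl _) (by
        intro x y z hx hy hz h1 h2
        rw [← div_lt_div_iff₀ hy.1 hx.1] at h1
        rw [← div_lt_div_iff₀ hz.1 hy.1] at h2
        rw [← div_lt_div_iff₀ hz.1 hx.1]
        exact h2.trans h1) le_rfl with h | h
  · left
    refine ⟨h.1, fun e h1 h2 => ?_⟩
    by_contra h3
    exact h.2 e e.2 ⟨by simpa, by simpa using h2, by simpa using h3⟩
  · right
    obtain ⟨h1, ⟨h2, h3, h4⟩, h5⟩ := h
    refine ⟨⟨_, h1⟩, rfl, ?_, ?_, ?_, fun e he1 he2 he3 => ?_⟩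
    · rw [← natExt_val I.w]; exact h2
    · rw [← natExt_val I.w]; exact not_lt.1 h3
    · rw [← hasIdx_val]; exact h4
    · have := h5 e e.2 ⟨by simpa, by simpa using he2, by simpa using he3⟩
      rw [not_lt] at this
      rw [← natExt_val I.w e, ← natExt_val I.w ⟨_, h1⟩]
      exact this

/-- `j` rounds of the density greedy algorithm. -/
def greedy (I : Inst n) (om a : ℝ) (pk : ℕ → ℕ) (S : Finset (Fin n)) : ℕ → Finset (Fin n)
  | 0 => S
  | j + 1 => ins (greedy I om a pk S j) (I.smallPick om a pk (greedy I om a pk S j))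

section
variable {om a : ℝ} {pk : ℕ → ℕ} {S : Finset (Fin n)}

lemma greedy_mono : Monotone (I.greedy om a pk S) :=
  monotone_nat_of_le_succ fun _ => subset_ins _ _

lemma greedy_succ (j : ℕ) :
    (I.greedy om a pk S (j + 1) = I.greedy om a pk S j ∧
      ∀ e, 0 < I.w e → I.w e ≤ om → e ∈ I.greedy om a pk S j) ∨
    ∃ b : Fin n, I.greedy om a pk S (j + 1) = insert b (I.greedy om a pk S j) ∧ 0 < I.w b ∧
      I.w b ≤ om ∧ b ∉ I.greedy om a pk S j ∧
      ∀ e : Fin n, 0 < I.w e → I.w e ≤ om → e ∉ I.greedy om a pk S j →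
        I.smallVal a pk (I.greedy om a pk S j) e * I.w b ≤
          I.smallVal a pk (I.greedy om a pk S j) b * I.w e := by
  rcases I.smallPick_spec om a pk (I.greedy om a pk S j) with h | ⟨b, hb, h⟩
  · left
    exact ⟨by rw [greedy, h.1, ins_of_le _ le_rfl], h.2⟩
  · right
    exact ⟨b, by rw [greedy, hb, ins_val], h⟩

lemma mem_greedy {j : ℕ} {e : Fin n} (he : e ∈ I.greedy om a pk S j) :
    e ∈ S ∨ 0 < I.w e ∧ I.w e ≤ om := by
  induction j with
  | zero => exact Or.inl he
  | succ j ih =>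
    rcases I.greedy_succ (om := om) (a := a) (pk := pk) (S := S) j with h | ⟨b, hb, h⟩
    · exact ih (h.1 ▸ he)
    · rw [hb, mem_insert] at he
      rcases he with rfl | he
      · exact Or.inr ⟨h.1, h.2.1⟩
      · exact ih he

/-- A round that adds nothing finds all small elements present, and any other round enlarges the
set; hence `n` rounds exhaust the small elements. -/
lemma greedy_full (j : ℕ) :
    (∀ e, 0 < I.w e → I.w e ≤ om → e ∈ I.greedy om a pk S j) ∨
      j ≤ (I.greedy om a pk S j).card := by
  induction j with
  | zero => right; omega
  | succ j ih =>
    rcases I.greedy_succ (om := om) (a := a) (pk := pk) (S := S) j with h | ⟨b, hb, h⟩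
    · left; rw [h.1]; exact h.2
    · rcases ih with h' | h'
      · exact absurd (h' b h.1 h.2.1) h.2.2.1
      · right
        rw [hb, card_insert_of_notMem h.2.2.1]
        omega

lemma mem_greedy_full {e : Fin n} (h1 : 0 < I.w e) (h2 : I.w e ≤ om) :
    e ∈ I.greedy om a pk S n := by
  rcases I.greedy_full (om := om) (a := a) (pk := pk) (S := S) n with h | h
  · exact h e h1 h2
  · have : I.greedy om a pk S n = univ := by
      rw [← card_eq_iff_eq_univ, Fintype.card_fin]
      exact le_antisymm (card_finset_fin_le _) h
    rw [this]; exact mem_univ _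

lemma weight_greedy_succ_le (hom : 0 ≤ om) (j : ℕ) :
    weight I.w (I.greedy om a pk S (j + 1)) ≤ weight I.w (I.greedy om a pk S j) + om := by
  rcases I.greedy_succ (om := om) (a := a) (pk := pk) (S := S) j with h | ⟨b, hb, h⟩
  · rw [h.1]; linarith
  · rw [hb, weight_insert h.2.2.1]; linarith [h.2.1]

/-- The stopping weight only truncates the greedy sequence, so the analysis can be made on that
sequence, which does not depend on `B`. -/
lemma smallRun_eq (B : ℝ) (j : ℕ) :
    ∃ r ≤ j, I.smallRun om a B pk S j = I.greedy om a pk S r ∧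
      (∀ r' < r, weight I.w (I.greedy om a pk S r') < B) ∧
      (r = j ∨ B ≤ weight I.w (I.greedy om a pk S r)) := by
  induction j with
  | zero => exact ⟨0, le_rfl, rfl, by simp, Or.inl rfl⟩
  | succ j ih =>
    obtain ⟨r, hr, h1, h2, h3⟩ := ih
    by_cases hB : weight I.w (I.smallRun om a B pk S j) < B
    · have hrj : r = j := by
        rcases h3 with h3 | h3
        · exact h3
        · rw [h1] at hB; linarith
      subst hrj
      refine ⟨r + 1, le_rfl, by rw [smallRun, if_pos hB, h1]; rfl, fun r' hr' => ?_, Or.inl rfl⟩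
      rcases Nat.lt_succ_iff_lt_or_eq.1 hr' with h | rfl
      · exact h2 r' h
      · rwa [h1] at hB
    · refine ⟨r, by omega, by rw [smallRun, if_neg hB, h1], h2, Or.inr ?_⟩
      rw [h1] at hB; exact not_lt.1 hB

end

/-- With a suitable stopping weight, the greedy algorithm makes the required progress. -/
lemma small_stage {om a y κ κ' W : ℝ} {pk : ℕ → ℕ} {A S : Finset (Fin n)} {Bm : ℕ}
    (hw : ∀ e, 0 ≤ I.w e) (hG : MonoDR (I.G pk)) (hl : ∀ e, 0 ≤ lin I.f e) (ha : 0 ≤ a)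
    (hκ0 : 0 ≤ κ') (hκκ : κ' ≤ κ) (hκ1 : κ ≤ 1) (hA : ∀ o ∈ A, I.w o ≤ om)
    (hAS : ∀ o ∈ A, o ∉ S → 0 < I.w o) (hom : 0 ≤ om) (hy : 0 ≤ y)
    (hB : ∀ X : Finset (Fin n), (∀ e ∈ X, e ∈ S ∨ 0 < I.w e ∧ I.w e ≤ om) →
      weight I.w X ≤ W → weight I.w X ≤ Bm * y)
    (hφ : om ≤ W - weight I.w S - κ * weight I.w (A \ S)) :
    ∃ β ≤ Bm, ∃ S₁, I.smallRun om a (β * y) pk S n = S₁ ∧ S ⊆ S₁ ∧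
      (∀ e ∈ S₁, e ∈ S ∨ 0 < I.w e ∧ I.w e ≤ om) ∧
      W - weight I.w S - κ * weight I.w (A \ S) - (2 * om + y) ≤
        W - weight I.w S₁ - κ' * weight I.w (A \ S₁) ∧
      a * I.G pk S + weight (lin I.f) S + κ * weight (lin I.f) (A \ S) +
          (κ - κ') * (a * ∑ o ∈ A \ S₁, (I.G pk (insert o S₁) - I.G pk S₁)) ≤
        a * I.G pk S₁ + weight (lin I.f) S₁ + κ' * weight (lin I.f) (A \ S₁) := by
  classical
  set X : ℕ → Finset (Fin n) := I.greedy om a pk S with hX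
  have hXm : Monotone X := greedy_mono
  have hX0 : X 0 = S := rfl
  -- The weight in use if a fraction `κ'` of the missing part of `A` stays reserved. Lowering the
  -- fraction from `κ` to `κ'` frees weight, and the greedy algorithm has to use it up again, that
  -- is, to bring `Ψ` back to `Ψ0`.
  set Ψ : Finset (Fin n) → ℝ := fun Y => weight I.w Y + κ' * weight I.w (A \ Y) with hΨ
  set Ψ0 := weight I.w S + κ * weight I.w (A \ S) with hΨ0
  have hΨmono : ∀ Y Z, Y ⊆ Z → Ψ Y ≤ Ψ Z := by
    intro Y Z h
    have h1 : weight I.w (A \ Y) ≤ weight I.w (A \ Z) + weight I.w (Z \ Y) := by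
      rw [← weight_union (disjoint_of_subset_right sdiff_subset sdiff_disjoint)]
      refine weight_mono hw fun x hx => ?_
      rw [mem_sdiff] at hx
      rw [mem_union, mem_sdiff, mem_sdiff]
      tauto
    have h2 : 0 ≤ weight I.w (Z \ Y) := weight_nonneg hw _
    rw [weight_sdiff h] at h1 h2
    simp only [hΨ]
    nlinarith
  have hΨle : ∀ Y Z, Y ⊆ Z → Ψ Z ≤ Ψ Y + (weight I.w Z - weight I.w Y) := by
    intro Y Z h
    have : weight I.w (A \ Z) ≤ weight I.w (A \ Y) := weight_mono hw (sdiff_subset_sdiff subset_rfl h)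
    simp only [hΨ]
    nlinarith
  have hAn : A \ X n = ∅ := by
    rw [sdiff_eq_empty_iff_subset]
    intro o ho
    by_cases hoS : o ∈ S
    · exact hXm (Nat.zero_le n) hoS
    · exact mem_greedy_full (hAS o ho hoS) (hA o ho)
  have hPn : Ψ0 ≤ Ψ (X n) := by
    have h1 : weight I.w (A \ S) ≤ weight I.w (X n \ S) := by
      refine weight_mono hw fun x hx => ?_
      have := sdiff_eq_empty_iff_subset.1 hAn (mem_sdiff.1 hx).1
      exact mem_sdiff.2 ⟨this, (mem_sdiff.1 hx).2⟩
    have hSX : S ⊆ X n := hXm (Nat.zero_le n)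
    rw [weight_sdiff hSX] at h1
    have h2 : 0 ≤ weight I.w (A \ S) := weight_nonneg hw _
    simp only [hΨ, hAn, hΨ0]
    have h3 : weight I.w (∅ : Finset (Fin n)) = 0 := by simp [weight]
    rw [h3]
    nlinarith
  have hex : ∃ r, Ψ0 ≤ Ψ (X r) := ⟨n, hPn⟩
  obtain ⟨r₁, hr₁, hr₁min⟩ : ∃ r, Ψ0 ≤ Ψ (X r) ∧ ∀ r' < r, Ψ (X r') < Ψ0 :=
    ⟨Nat.find hex, Nat.find_spec hex, fun r' h => not_le.1 (Nat.find_min hex h)⟩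
  have hr₁n : r₁ ≤ n := by
    by_contra! h
    exact absurd (hr₁min n h) (not_lt.2 hPn)
  have hΨr₁ : Ψ (X r₁) ≤ Ψ0 + om := by
    rcases r₁ with _ | r
    · have : 0 ≤ weight I.w (A \ S) := weight_nonneg hw _
      simp only [hX0, hΨ, hΨ0]
      nlinarith
    · have h1 := hr₁min r (by omega)
      have h2 := hΨle _ _ (hXm (Nat.le_succ r))
      have h3 := weight_greedy_succ_le (I := I) (a := a) (pk := pk) (S := S) hom r
      change weight I.w (X (r + 1)) ≤ weight I.w (X r) + om at h3
      linarith
  have hXmem : ∀ r, ∀ e ∈ X r, e ∈ S ∨ 0 < I.w e ∧ I.w e ≤ om := fun r e he => mem_greedy he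
  have hwr₁ : weight I.w (X r₁) ≤ W := by
    have : 0 ≤ κ' * weight I.w (A \ X r₁) := mul_nonneg hκ0 (weight_nonneg hw _)
    simp only [hΨ] at hΨr₁
    linarith
  have hBr := hB _ (hXmem r₁) hwr₁
  -- The ideal stopping weight depends on the unknown `A`, so it is rounded up to a multiple of `y`,
  -- and the multiplier is guessed. For `y = 0` the weight itself is zero.
  obtain ⟨β, hβ, hβ1, hβ2⟩ : ∃ β ≤ Bm, weight I.w (X r₁) ≤ β * y ∧
      (β : ℝ) * y ≤ weight I.w (X r₁) + y := by
    rcases hy.eq_or_lt with hy0 | hy0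
    · refine ⟨0, Nat.zero_le _, ?_, ?_⟩
      · rw [← hy0] at hBr ⊢; simpa using hBr
      · have := weight_nonneg hw (X r₁)
        push_cast; linarith
    · refine ⟨⌈weight I.w (X r₁) / y⌉₊, ?_, ?_, ?_⟩
      · rw [Nat.ceil_le, div_le_iff₀ hy0]; exact hBr
      · rw [← div_le_iff₀ hy0]; exact Nat.le_ceil _
      · have := (Nat.ceil_lt_add_one (div_nonneg (weight_nonneg hw (X r₁)) hy)).le
        calc _ ≤ (weight I.w (X r₁) / y + 1) * y := mul_le_mul_of_nonneg_right this hy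
          _ = _ := by field_simp
  obtain ⟨r₂, hr₂n, hrun, hr₂lt, hr₂⟩ :=
    smallRun_eq (I := I) (om := om) (a := a) (pk := pk) (S := S) (β * y) n
  change _ = X r₂ at hrun
  -- Stopping before `r₁` would need the full weight of `X r₁` already; as all later elements have
  -- positive weight, the sets would coincide.
  have hr₁₂ : r₁ ≤ r₂ := by
    by_contra! hlt
    have h1 : β * y ≤ weight I.w (X r₂) := by
      rcases hr₂ with h | h
      · omega
      · exact h
    have h2 := hr₁min r₂ hlt
    have h3 : weight I.w (X r₂) = weight I.w (X r₁) :=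
      le_antisymm (weight_mono hw (hXm hlt.le)) (hβ1.trans h1)
    have h4 : X r₁ ⊆ X r₂ := by
      intro e he
      by_contra hne
      have h5 : weight I.w (insert e (X r₂)) ≤ weight I.w (X r₁) :=
        weight_mono hw (insert_subset he (hXm hlt.le))
      rw [weight_insert hne] at h5
      rcases hXmem r₁ e he with h6 | h6
      · exact hne (hXm (Nat.zero_le _) h6)
      · linarith [h6.1]
    have := hΨmono _ _ h4
    linarith
  have hP₂ : Ψ0 ≤ Ψ (X r₂) := hr₁.trans (hΨmono _ _ (hXm hr₁₂))
  -- The overshoot consists of one element when `r₁` is reached, the rounding by `y`, and one more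
  -- element.
  have hΨr₂ : Ψ (X r₂) ≤ Ψ0 + (2 * om + y) := by
    rcases hr₁₂.eq_or_lt with h | h
    · rw [← h]; linarith
    · obtain ⟨r, rfl⟩ : ∃ r, r₂ = r + 1 := ⟨r₂ - 1, by omega⟩
      have h1 : weight I.w (X r) < β * y := hr₂lt r (by omega)
      have h2 := hΨle _ _ (hXm hr₁₂)
      have h3 := weight_greedy_succ_le (I := I) (a := a) (pk := pk) (S := S) hom r
      change weight I.w (X (r + 1)) ≤ weight I.w (X r) + om at h3
      linarith
  refine ⟨β, hβ, X r₂, hrun, hXm (Nat.zero_le _), hXmem r₂, ?_, ?_⟩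
  · simp only [hΨ] at hΨr₂
    linarith
  · set S₁ := X r₂ with hS₁
    set U := A \ S₁ with hU
    set V := ∑ o ∈ U, (a * (I.G pk (insert o S₁) - I.G pk S₁) + lin I.f o) with hV
    have hVnn : 0 ≤ V := sum_nonneg fun o _ =>
      add_nonneg (mul_nonneg ha (hG.gain_nonneg _ _)) (hl o)
    have hUcand : ∀ o ∈ U, 0 < I.w o ∧ I.w o ≤ om := by
      intro o ho
      rw [mem_sdiff] at ho
      exact ⟨hAS o ho.1 fun h => ho.2 (hXm (Nat.zero_le _) h), hA o ho.1⟩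
    -- `ρ` is the density at the end of all of `U`, the part of `A` that is still missing. By
    -- diminishing returns every element of `U` was at least as valuable in each earlier round, so
    -- each greedy choice has density at least `ρ`.
    obtain ⟨ρ, hρ0, hρV, hρ⟩ : ∃ ρ : ℝ, 0 ≤ ρ ∧ ρ * weight I.w U = V ∧
        ∀ r < r₂, ∀ b : Fin n, 0 ≤ I.w b → (∀ e : Fin n, 0 < I.w e → I.w e ≤ om → e ∉ X r →
          I.smallVal a pk (X r) e * I.w b ≤ I.smallVal a pk (X r) b * I.w e) →
          0 ≤ I.smallVal a pk (X r) b → ρ * I.w b ≤ I.smallVal a pk (X r) b := by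
      rcases U.eq_empty_or_nonempty with h | h
      · refine ⟨0, le_rfl, by simp [hV, h], ?_⟩
        intro r _ b _ _ h0
        simpa using h0
      · have hUpos : 0 < weight I.w U := sum_pos (fun o ho => (hUcand o ho).1) h
        refine ⟨V / weight I.w U, by positivity, by field_simp, ?_⟩
        intro r hr b hb hopt _
        rw [div_mul_eq_mul_div, div_le_iff₀ hUpos]
        calc V * I.w b = ∑ o ∈ U, (a * (I.G pk (insert o S₁) - I.G pk S₁) + lin I.f o) * I.w b := by
              rw [hV, sum_mul]
          _ ≤ ∑ o ∈ U, I.smallVal a pk (X r) b * I.w o := by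
              refine sum_le_sum fun o ho => ?_
              refine le_trans ?_ (hopt o (hUcand o ho).1 (hUcand o ho).2 fun h' =>
                (mem_sdiff.1 ho).2 (hXm hr.le h'))
              refine mul_le_mul_of_nonneg_right ?_ hb
              simp only [smallVal, ins_val, natExt_val]
              have := mul_le_mul_of_nonneg_left (hG.dr _ _ o (hXm hr.le)) ha
              linarith
          _ = I.smallVal a pk (X r) b * weight I.w U := by rw [weight, mul_sum]
    -- An element outside `A` brings its full weight and value. An element of `A` was already
    -- counted with the fraction `κ`, so only `1 - κ` of its weight and linear value is new, but its
    -- curved gain is new entirely.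
    have hinv : ∀ r ≤ r₂, a * I.G pk S + weight (lin I.f) S + κ * weight (lin I.f) (A \ S) +
        ρ * (weight I.w (X r) + κ * weight I.w (A \ X r) - Ψ0) ≤
        a * I.G pk (X r) + weight (lin I.f) (X r) + κ * weight (lin I.f) (A \ X r) := by
      intro r
      induction r with
      | zero => intro _; simp only [hX0, hΨ0]; linarith
      | succ r ih =>
        intro hr
        have ih := ih (by omega)
        rcases I.greedy_succ (om := om) (a := a) (pk := pk) (S := S) r with h | ⟨b, hb, h⟩
        · change X (r + 1) = X r ∧ _ at h
          rw [h.1]; exact ih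
        · change X (r + 1) = insert b (X r) at hb
          obtain ⟨h1, h2, h3, h4⟩ := h
          change b ∉ X r at h3
          have hval : I.smallVal a pk (X r) b =
              a * (I.G pk (insert b (X r)) - I.G pk (X r)) + lin I.f b := by
            simp [smallVal]
          have hg : 0 ≤ a * (I.G pk (insert b (X r)) - I.G pk (X r)) :=
            mul_nonneg ha (hG.gain_nonneg _ _)
          have hv : ρ * I.w b ≤ I.smallVal a pk (X r) b :=
            hρ r (by omega) b h1.le h4 (by rw [hval]; linarith [hl b])
          rw [hval] at hv
          rw [hb, weight_insert h3, weight_insert h3]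
          by_cases hbA : b ∈ A
          · have hsub : b ∈ A \ X r := mem_sdiff.2 ⟨hbA, h3⟩
            have e1 : ∀ v : Fin n → ℝ, weight v (A \ insert b (X r)) = weight v (A \ X r) - v b := by
              intro v
              rw [sdiff_insert, weight, weight, ← add_sum_erase _ _ hsub]
              ring
            rw [e1, e1]
            nlinarith
          · have e1 : A \ insert b (X r) = A \ X r := by
              ext x
              simp only [mem_sdiff, mem_insert]
              constructor
              · tauto
              · rintro ⟨hx, hx'⟩
                refine ⟨hx, ?_⟩
                rintro (rfl | h)
                · exact hbA hx
                · exact hx' h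
            rw [e1]
            nlinarith
    have h1 := hinv r₂ le_rfl
    have hVeq : V = a * ∑ o ∈ U, (I.G pk (insert o S₁) - I.G pk S₁) + weight (lin I.f) U := by
      rw [hV, sum_add_distrib, mul_sum]; rfl
    -- The freed weight `(κ - κ') * weight I.w U` has been used again at density at least `ρ`, and
    -- `ρ * weight I.w U = V`.
    have h2 : (κ - κ') * V ≤ ρ * (weight I.w S₁ + κ * weight I.w U - Ψ0) := by
      rw [← hρV]
      have h3 : Ψ0 ≤ weight I.w S₁ + κ' * weight I.w U := hP₂
      have h4 := mul_le_mul_of_nonneg_left h3 hρ0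
      nlinarith
    rw [hVeq] at h2
    change _ ≤ a * I.G pk S₁ + weight (lin I.f) S₁ + κ * weight (lin I.f) U at h1
    linarith

end Inst


/-! ### Good guesses exist -/

/-- A state depends only on the choices made before it. So good choices that are found adaptively,
each in view of the current state, can be collected into one guess fixed in advance. -/
lemma exists_choices {α σ : Type*} {F : ℕ → σ → α → σ} {run : (ℕ → α) → ℕ → σ} {s₀ : σ}
    (h0 : ∀ d, run d 0 = s₀) (hs : ∀ d i, run d (i + 1) = F i (run d i) (d i)) {P : α → Prop}
    {Inv : ℕ → σ → Prop} {N : ℕ} (hP : ∃ a, P a) (base : Inv 0 s₀)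
    (step : ∀ i < N, ∀ s, Inv i s → ∃ a, P a ∧ Inv (i + 1) (F i s a)) :
    ∃ d, (∀ i, P (d i)) ∧ Inv N (run d N) := by
  have hcongr : ∀ i d d', (∀ j < i, d j = d' j) → run d i = run d' i := by
    intro i
    induction i with
    | zero => intro d d' _; rw [h0, h0]
    | succ i ih =>
      intro d d' h
      rw [hs, hs, ih d d' fun j hj => h j (by omega), h i (by omega)]
  induction N with
  | zero =>
    obtain ⟨a, ha⟩ := hP
    exact ⟨fun _ => a, fun _ => ha, by rwa [h0]⟩
  | succ N ih =>
    obtain ⟨d, hd, hN⟩ := ih fun i hi => step i (by omega)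
    obtain ⟨a, ha, hI⟩ := step N (by omega) _ hN
    refine ⟨Function.update d N a, fun i => ?_, ?_⟩
    · by_cases h : i = N
      · rw [h, Function.update_self]; exact ha
      · rw [Function.update_of_ne h]; exact hd i
    · rw [hs, Function.update_self, hcongr N _ d fun j hj => Function.update_of_ne hj.ne _ _]
      exact hI

lemma le_avg {g : Finset (Fin n) → ℝ} (hg : MonoDR g) {m : ℕ} (hm : 0 < m) (k : ℕ) (pk : ℕ → ℕ)
    {O X : Finset (Fin n)} (h : O ⊆ X) : g O ≤ avg g m k pk X := by
  have hmk : (0 : ℝ) < (m : ℝ) ^ k := by positivity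
  rw [avg, le_div_iff₀ hmk]
  calc g O * (m : ℝ) ^ k = ∑ _τ : Fin k → Fin m, g O := by simp [mul_comm]
    _ ≤ _ := sum_le_sum fun τ _ => hg.mono _ _ fun x hx => mem_pickSet.2 (Or.inl (h hx))

lemma exists_avg_le {g : Finset (Fin n) → ℝ} {m : ℕ} (hm : 0 < m) (k : ℕ) (pk : ℕ → ℕ)
    (X : Finset (Fin n)) : ∃ τ : Fin k → Fin m, avg g m k pk X ≤ g (pickSet k pk (scenario τ) X) := by
  have hmk : (0 : ℝ) < (m : ℝ) ^ k := by positivity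
  have : Nonempty (Fin m) := ⟨⟨0, hm⟩⟩
  by_contra! hc
  have h1 := sum_lt_sum_of_nonempty (univ_nonempty (α := Fin k → Fin m)) fun τ _ => hc τ
  rw [avg, sum_const, card_univ] at h1
  simp only [Fintype.card_pi, Fintype.card_fin, prod_const, card_univ, nsmul_eq_mul,
    Nat.cast_pow] at h1
  rw [mul_div_cancel₀ _ hmk.ne'] at h1
  exact lt_irrefl _ h1

namespace Inst
variable {I : Inst n} {om y de W : ℝ} {l Bm : ℕ} {o : ℕ → Fin n} {A : Finset (Fin n)} {c : ℕ → ℕ}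

/-- The class of `e`: its linear part in units of `de`. -/
def classOf (I : Inst n) (de : ℝ) (e : Fin n) : ℕ := ⌊lin I.f e / de⌋₊

/-- What is needed of the large elements `o 0, …, o (l - 1)`, the small elements `A` and the guessed
quantities for the analysis of a run of the algorithm. -/
structure Split (I : Inst n) (om y de W : ℝ) (l Bm : ℕ) (o : ℕ → Fin n) (A : Finset (Fin n))
    (c : ℕ → ℕ) : Prop where
  dr : MonoDR I.f
  nonneg : ∀ S, 0 ≤ I.f S
  w_nonneg : ∀ e, 0 ≤ I.w e
  m_pos : 0 < I.m
  l_le : l ≤ I.k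
  om_nonneg : 0 ≤ om
  y_nonneg : 0 ≤ y
  de_pos : 0 < de
  room : weight I.w A + I.m * (2 * om + y) ≤ W
  small : ∀ e ∈ A, I.w e ≤ om
  large : ∀ i < l, om < I.w (o i)
  cls : ∀ i < l, c i = I.classOf de (o i)
  cls_empty : ∀ i, l ≤ i → ∀ e : Fin n, I.classOf de e ≠ c i
  cls_le : ∀ i, c i ≤ Bm
  wt_le : ∀ X : Finset (Fin n), (∀ e ∈ X, I.w e ≤ om) → weight I.w X ≤ W →
    weight I.w X ≤ Bm * y
  val_le : ∀ e, I.f {e} ≤ Bm * de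
  inj : ∀ i < l, ∀ j < l, o i = o j → i = j

lemma inClass_iff (hde : 0 < de) (hl : ∀ e, 0 ≤ lin I.f e) (j : ℕ) (e : Fin n) :
    I.InClass om de j e ↔ om < I.w e ∧ I.classOf de e = j := by
  rw [InClass, natExt_val, natExt_val, not_lt, classOf,
    Nat.floor_eq_iff (div_nonneg (hl e) hde.le), le_div_iff₀ hde, div_lt_iff₀ hde]

namespace Split
variable (h : Split I om y de W l Bm o A c)
include h

lemma G_dr (pk : ℕ → ℕ) : MonoDR (I.G pk) := h.dr.curved.avg _ _ _

lemma lin_nonneg (e : Fin n) : 0 ≤ lin I.f e := SubmodKnapsack.lin_nonneg h.dr e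

/-- The threshold is the gain of the true element `o i`, rounded down to a multiple of `de`. Then `o
i` is itself a candidate, so the lightest candidate is no heavier, and it loses less than `de`. A
slot without a large element is given an empty class and picks nothing. -/
lemma slotPick_spec {pk : ℕ → ℕ} {S : Finset (Fin n)} {i t : ℕ} (hi : i < I.k) (ht : t < I.m)
    (hp : pk (i + I.k * t) = n) :
    ∃ th ≤ Bm, (l ≤ i ∧ I.slotPick om de (c i) th (i + I.k * t) pk S = n) ∨
      (i < l ∧ ∃ b : Fin n, I.slotPick om de (c i) th (i + I.k * t) pk S = b ∧
        I.w b ≤ I.w (o i) ∧ om < I.w b ∧ I.classOf de b = c i ∧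
        I.G (Function.update pk (i + I.k * t) (o i)) S - I.G pk S - de ≤
          I.G (Function.update pk (i + I.k * t) b) S - I.G pk S) := by
  set p := i + I.k * t with hpdef
  set th := ⌊(I.G (Function.update pk p (o i)) S - I.G pk S) / de⌋₊ with hth
  have hspec := argBest_spec (N := n)
    (cand := fun e => I.InClass om de (c i) e ∧
      ¬ I.G (Function.update pk p e) S - I.G pk S < th * de)
    (better := fun e b => natExt I.w e < natExt I.w b)
    (fun _ => lt_irrefl _) (fun _ _ _ _ _ _ h1 h2 => h1.trans h2) le_rfl
  have hgain0 : 0 ≤ I.G (Function.update pk p (o i)) S - I.G pk S := by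
    have := le_avg_update h.dr.curved hi ht (subset_refl S) hp (pk' := pk) (fun _ _ _ => rfl) (o i)
    refine le_trans (div_nonneg ?_ (Nat.cast_nonneg _)) this
    exact (h.G_dr pk).gain_nonneg S (o i)
  have hgain1 : I.G (Function.update pk p (o i)) S - I.G pk S ≤ Bm * de := by
    have hmk : (0 : ℝ) < (I.m : ℝ) ^ I.k := by have := h.m_pos; positivity
    rw [G, G, avg, avg, ← sub_div, ← sum_sub_distrib, div_le_iff₀ hmk]
    calc _ ≤ ∑ _τ : Fin I.k → Fin I.m, (Bm * de : ℝ) := by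
          refine sum_le_sum fun τ _ => ?_
          have hsub : pickSet I.k (Function.update pk p (o i)) (scenario τ) S ⊆
              insert (o i) (pickSet I.k pk (scenario τ) S) := by
            intro x hx
            rw [mem_insert, mem_pickSet]
            rcases mem_pickSet.1 hx with hx | ⟨j, hj, hx⟩
            · exact Or.inr (Or.inl hx)
            · by_cases hjp : j + I.k * scenario τ j = p
              · rw [hjp, Function.update_self] at hx
                exact Or.inl (Fin.ext hx.symm)
              · rw [Function.update_of_ne hjp] at hx
                exact Or.inr (Or.inr ⟨j, hj, hx⟩)
          have h1 := h.dr.curved.mono _ _ hsub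
          have h2 := curved_gain_le h.dr h.nonneg (pickSet I.k pk (scenario τ) S) (o i)
          linarith [h.val_le (o i)]
      _ = _ := by simp [mul_comm]
  have hthle : (th : ℝ) * de ≤ I.G (Function.update pk p (o i)) S - I.G pk S := by
    rw [← le_div_iff₀ h.de_pos]
    exact Nat.floor_le (div_nonneg hgain0 h.de_pos.le)
  have hthge : I.G (Function.update pk p (o i)) S - I.G pk S < (th + 1) * de := by
    rw [← div_lt_iff₀ h.de_pos]
    exact Nat.lt_floor_add_one _
  refine ⟨th, ?_, ?_⟩
  · rw [hth]
    refine Nat.floor_le_of_le ?_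
    rwa [div_le_iff₀ h.de_pos]
  · rcases lt_or_ge i l with hil | hil
    · right
      refine ⟨hil, ?_⟩
      have hcand : I.InClass om de (c i) (o i) :=
        (inClass_iff h.de_pos h.lin_nonneg _ _).2 ⟨h.large i hil, (h.cls i hil).symm⟩
      rcases hspec with ⟨_, h2⟩ | ⟨h1, ⟨h2, h3⟩, h4⟩
      · exact absurd ⟨hcand, not_lt.2 hthle⟩ (h2 (o i) (o i).2)
      · refine ⟨⟨_, h1⟩, rfl, ?_, ?_⟩
        · have := not_lt.1 (h4 (o i) (o i).2 ⟨hcand, not_lt.2 hthle⟩)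
          rw [natExt_val] at this
          rw [← natExt_val I.w ⟨_, h1⟩]
          exact this
        · have h5 := (inClass_iff h.de_pos h.lin_nonneg (c i) ⟨_, h1⟩).1 h2
          refine ⟨h5.1, h5.2, ?_⟩
          have h6 := not_lt.1 h3
          simp only
          linarith
    · left
      refine ⟨hil, ?_⟩
      rcases hspec with ⟨h1, _⟩ | ⟨h1, ⟨h2, _⟩, _⟩
      · exact h1
      · exact absurd ((inClass_iff h.de_pos h.lin_nonneg (c i) ⟨_, h1⟩).1 h2).2 (h.cls_empty i hil _)

end Split

/-- The pick of slot `i` at stage `t` is as it should be. -/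
def PickOK (I : Inst n) (om de : ℝ) (l : ℕ) (o : ℕ → Fin n) (c : ℕ → ℕ) (pk : ℕ → ℕ)
    (i t : ℕ) : Prop :=
  (l ≤ i ∧ pk (i + I.k * t) = n) ∨ (i < l ∧ ∃ b : Fin n, pk (i + I.k * t) = b ∧
    I.w b ≤ I.w (o i) ∧ om < I.w b ∧ I.classOf de b = c i)

namespace Split
variable (h : Split I om y de W l Bm o A c)
include h

/-- With suitable thresholds, the slots make the required progress. -/
lemma slots_stage {pk : ℕ → ℕ} {S : Finset (Fin n)} {t : ℕ} (ht : t < I.m)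
    (hp : ∀ p, I.k * t ≤ p → p < I.k * I.m → pk p = n) :
    ∃ th : ℕ → ℕ, (∀ i, th i ≤ Bm) ∧ ∃ q, I.slots om de c th t pk S I.k = q ∧
      (∀ p, p < I.k * t ∨ I.k * (t + 1) ≤ p → q p = pk p) ∧
      (∀ i < I.k, I.PickOK om de l o c q i t) ∧
      ∀ S', S ⊆ S' → I.G pk S + ∑ i ∈ range l, ((I.G q (insert (o i) S') - I.G q S') / I.m - de) ≤
        I.G q S := by
  -- The gains are measured at an arbitrary later state `pk'`, `S'` that extends the present picks.
  -- This allows the induction over the slots and, afterwards, a comparison at the end of the stage.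
  let Inv : ℕ → (ℕ → ℕ) → Prop := fun i q =>
    (∀ p, p < I.k * t ∨ i + I.k * t ≤ p → q p = pk p) ∧
    (∀ j < i, I.PickOK om de l o c q j t) ∧
    ∀ pk' S', S ⊆ S' → (∀ p < I.k * I.m, q p < n → pk' p = q p) →
      I.G pk S + ∑ j ∈ range (min i l), ((I.G pk' (insert (o j) S') - I.G pk' S') / I.m - de) ≤
        I.G q S
  obtain ⟨th, hth, hI1, hI2, hI3⟩ := exists_choices (α := ℕ) (s₀ := pk) (N := I.k)
    (F := fun i q a => Function.update q (i + I.k * t)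
      (I.slotPick om de (c i) a (i + I.k * t) q S))
    (run := fun th => I.slots om de c th t pk S) (P := fun a => a ≤ Bm) (Inv := Inv)
    (fun _ => rfl) (fun _ _ => rfl) ⟨0, Nat.zero_le _⟩ ⟨by simp, by simp, by simp⟩ (by
      rintro i hi q ⟨h1, h2, h3⟩
      have hlt : i + I.k * t < I.k * I.m := by
        calc i + I.k * t < I.k + I.k * t := by omega
          _ = I.k * (t + 1) := by ring
          _ ≤ I.k * I.m := Nat.mul_le_mul_left _ ht
      have hq : q (i + I.k * t) = n := by
        rw [h1 _ (Or.inr le_rfl)]; exact hp _ (by omega) hlt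
      obtain ⟨th, hth, hsp⟩ := h.slotPick_spec (S := S) hi ht hq
      refine ⟨th, hth, ?_, ?_, ?_⟩
      · intro p hpp
        rw [Function.update_of_ne (by omega)]
        exact h1 p (by omega)
      · intro j hj
        rcases Nat.lt_succ_iff_lt_or_eq.1 hj with hj | rfl
        · have := h2 j hj
          rw [PickOK] at this ⊢
          rwa [Function.update_of_ne (by omega)]
        · rw [PickOK, Function.update_self]
          rcases hsp with hsp | ⟨hjl, b, hb, hb2⟩
          · exact Or.inl hsp
          · exact Or.inr ⟨hjl, b, hb, hb2.1, hb2.2.1, hb2.2.2.1⟩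
      · intro pk' S' hS' hpk'
        have hext : ∀ p < I.k * I.m, q p < n → pk' p = q p := by
          intro p hpm hpn
          have hne : p ≠ i + I.k * t := by rintro rfl; omega
          rw [hpk' p hpm (by rwa [Function.update_of_ne hne]), Function.update_of_ne hne]
        have h4 := h3 pk' S' hS' hext
        rcases hsp with ⟨hil, hsp⟩ | ⟨hil, b, hb, _, _, _, hb5⟩
        · have e : Function.update q (i + I.k * t) (I.slotPick om de (c i) th (i + I.k * t) q S) =
              q := by rw [hsp, Function.update_eq_iff]; exact ⟨hq.symm, fun _ _ => rfl⟩
          rw [e, min_eq_right (by omega)]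
          rwa [min_eq_right hil] at h4
        · rw [min_eq_left (by omega), sum_range_succ, hb]
          rw [min_eq_left hil.le] at h4
          have h5 := le_avg_update h.dr.curved hi ht hS' hq hext (o i)
          change (I.G pk' (insert (o i) S') - I.G pk' S') / I.m ≤
            I.G (Function.update q (i + I.k * t) (o i)) S - I.G q S at h5
          linarith)
  refine ⟨th, hth, _, rfl, ?_, hI2, fun S' hS' => ?_⟩
  · intro p hpp
    exact hI1 p (by rwa [show I.k + I.k * t = I.k * (t + 1) by ring])
  · have := hI3 _ S' hS' fun _ _ _ => rfl
    rwa [min_eq_right h.l_le] at this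

/-- The progress made after `t` stages. -/
def Progress (I : Inst n) (om y de W : ℝ) (l : ℕ) (o : ℕ → Fin n) (A : Finset (Fin n))
    (c : ℕ → ℕ) (t : ℕ) (s : (ℕ → ℕ) × Finset (Fin n)) : Prop :=
  (∀ t' < t, ∀ i < I.k, I.PickOK om de l o c s.1 i t') ∧
  (∀ p, I.k * t ≤ p → p < I.k * I.m → s.1 p = n) ∧
  I.zeros ⊆ s.2 ∧ (∀ e ∈ s.2, I.w e ≤ om) ∧
  (I.m - t : ℝ) * (2 * om + y) ≤
    W - weight I.w s.2 - (1 - t / I.m) * weight I.w (A \ s.2) ∧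
  (1 - coef I.m 0) * curved I.f ((range l).image o ∪ A) + weight (lin I.f) A - t * (I.k * de) ≤
    coef I.m t * I.G s.1 s.2 + (1 - coef I.m t) * curved I.f ((range l).image o ∪ A) +
      weight (lin I.f) s.2 + (1 - t / I.m) * weight (lin I.f) (A \ s.2)

omit h in
lemma coef_nonneg (m t : ℕ) : 0 ≤ coef m t := by unfold coef; positivity

omit h in
lemma coef_succ {m : ℕ} (hm : 0 < m) (t : ℕ) : coef m (t + 1) = coef m t + coef m t / m := by
  have : (m : ℝ) ≠ 0 := by positivity
  rw [coef, coef, pow_succ]; field_simp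

omit h in
lemma coef_self {m : ℕ} (hm : 0 < m) : coef m m = 1 := by
  have : (m : ℝ) ≠ 0 := by positivity
  rw [coef, ← mul_pow]
  have : (m : ℝ) / (m + 1) * ((m + 1) / m) = 1 := by field_simp
  rw [this, one_pow]

omit h in
lemma coef_mono {m : ℕ} (hm : 0 < m) : Monotone (coef m) :=
  monotone_nat_of_le_succ fun t => by
    rw [coef_succ hm]
    have := coef_nonneg m t
    linarith [div_nonneg this (Nat.cast_nonneg m)]

/-- The elements of weight zero are free and are taken before the first stage. Hence a small element
that is missing later has positive weight and thus a density. -/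
lemma progress_zero {pk : ℕ → ℕ} (hpk : ∀ p < I.k * I.m, pk p = n) :
    Progress I om y de W l o A c 0 (pk, I.zeros) := by
  have hz : weight I.w I.zeros = 0 := by
    refine sum_eq_zero fun e he => ?_
    simp only [zeros, mem_filter, not_lt] at he
    exact le_antisymm he.2 (h.w_nonneg e)
  refine ⟨by simp, fun p _ => hpk p, subset_rfl, fun e he => ?_, ?_, ?_⟩
  · simp only [zeros, mem_filter, not_lt] at he
    exact he.2.trans h.om_nonneg
  · have h1 : weight I.w (A \ I.zeros) ≤ weight I.w A := weight_mono h.w_nonneg sdiff_subset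
    have h2 := h.room
    simp only [hz]
    push_cast
    simp only [zero_div, sub_zero]
    linarith
  · have h1 : weight (lin I.f) A ≤ weight (lin I.f) I.zeros + weight (lin I.f) (A \ I.zeros) := by
      rw [← weight_union disjoint_sdiff]
      exact weight_mono h.lin_nonneg (by rw [union_sdiff_self_eq_union]; exact subset_union_right)
    have h2 : 0 ≤ coef I.m 0 * I.G pk I.zeros := by
      refine mul_nonneg (coef_nonneg _ _) ?_
      exact (curved_nonneg h.dr h.nonneg ∅).trans
        (le_avg h.dr.curved h.m_pos _ _ (empty_subset _))
    push_cast
    simp only [zero_div, sub_zero, zero_mul]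
    linarith

lemma progress_succ {t : ℕ} (ht : t < I.m) {s : (ℕ → ℕ) × Finset (Fin n)}
    (hs : Progress I om y de W l o A c t s) :
    ∃ th : ℕ → ℕ, (∀ i, th i ≤ Bm) ∧ ∃ β ≤ Bm, ∀ g : Guess, g.om = om → g.y = y → g.de = de →
      g.cls t = c → g.thr t = th → g.beta t = β →
      Progress I om y de W l o A c (t + 1) (I.stage g t s) := by
  obtain ⟨pk, S⟩ := s
  obtain ⟨hpick, hnone, hz, hsm, hroom, hval⟩ := hs
  simp only at hpick hnone hz hsm hroom hval
  obtain ⟨th, hth, q, hq, hq1, hq2, hq3⟩ := h.slots_stage (S := S) ht hnone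
  have hm : (0 : ℝ) < I.m := by exact_mod_cast h.m_pos
  have htm : (t : ℝ) + 1 ≤ I.m := by exact_mod_cast ht
  have hom := h.om_nonneg
  have hy := h.y_nonneg
  have hκ : (1 - ((t + 1 : ℕ) : ℝ) / I.m) = 1 - t / I.m - 1 / I.m := by push_cast; ring
  have hκ0 : 0 ≤ 1 - t / I.m - 1 / (I.m : ℝ) := by
    rw [← hκ, sub_nonneg, div_le_one hm]; exact_mod_cast ht
  have h1m : 0 < 1 / (I.m : ℝ) := by positivity
  have hw := h.w_nonneg
  -- The spare room `(m - t) * (2 * om + y)` pays for the overshoot of this stage and of all later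
  -- ones.
  obtain ⟨β, hβ, S₁, hS₁, hSS₁, hmem, hroom', hval'⟩ := small_stage (I := I) (om := om)
    (a := coef I.m t) (y := y) (κ := 1 - t / I.m) (κ' := 1 - t / I.m - 1 / I.m) (W := W) (pk := q)
    (A := A) (S := S) (Bm := Bm) hw (h.G_dr q) h.lin_nonneg (coef_nonneg _ _) hκ0
    (by linarith) (by have : (0:ℝ) ≤ t / I.m := by positivity
                      linarith) h.small
    (fun o ho hoS => by
      by_contra hc
      exact hoS (hz (by simpa [zeros] using hc))) hom hy
    (fun X hX hXW => h.wt_le X (fun e he => (hX e he).elim (fun h' => hsm e h') fun h' => h'.2) hXW)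
    (by nlinarith)
  refine ⟨th, hth, β, hβ, fun g g1 g2 g3 g4 g5 g6 => ?_⟩
  have hst : I.stage g t (pk, S) = (q, S₁) := by
    simp only [stage, g1, g2, g3, g4, g5, g6, hq, hS₁]
  rw [hst]
  refine ⟨fun t' ht' i hi => ?_, fun p hp1 hp2 => ?_, hz.trans hSS₁, fun e he => ?_, ?_, ?_⟩
  · rcases Nat.lt_succ_iff_lt_or_eq.1 ht' with h' | rfl
    · have := hpick t' h' i hi
      simp only [PickOK] at this ⊢
      rwa [hq1 _ (Or.inl _)]
      calc i + I.k * t' < I.k + I.k * t' := by omega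
        _ = I.k * (t' + 1) := by ring
        _ ≤ I.k * t := Nat.mul_le_mul_left _ h'
    · exact hq2 i hi
  · change q p = n
    rw [hq1 p (Or.inr hp1)]
    exact hnone p ((Nat.mul_le_mul_left _ (Nat.le_succ t)).trans hp1) hp2
  · rcases hmem e he with h' | h'
    · exact hsm e h'
    · exact h'.2
  · rw [hκ]
    push_cast
    linarith
  · rw [hκ, coef_succ h.m_pos]
    push_cast
    set O' := (range l).image o ∪ A with hO'
    set a := coef I.m t with ha
    have ha0 : 0 ≤ a := coef_nonneg _ _
    have ha1 : a ≤ 1 := by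
      rw [← coef_self h.m_pos]; exact coef_mono h.m_pos ht.le
    have h5 := hq3 S₁ hSS₁
    have h6 : curved I.f O' - I.G q S₁ ≤ ∑ i ∈ range l, (I.G q (insert (o i) S₁) - I.G q S₁) +
        ∑ e ∈ A \ S₁, (I.G q (insert e S₁) - I.G q S₁) := by
      have h7 := (h.G_dr q).union_le S₁ ((range l).image o ∪ (A \ S₁))
      have h8 : ∑ e ∈ (range l).image o ∪ (A \ S₁), (I.G q (insert e S₁) - I.G q S₁) ≤
          ∑ e ∈ (range l).image o, (I.G q (insert e S₁) - I.G q S₁) +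
          ∑ e ∈ A \ S₁, (I.G q (insert e S₁) - I.G q S₁) := by
        rw [← sum_union_inter]
        exact le_add_of_nonneg_right (sum_nonneg fun e _ => (h.G_dr q).gain_nonneg _ _)
      rw [sum_image fun i hi j hj => h.inj i (by simpa using hi) j (by simpa using hj)] at h8
      have h9 : curved I.f O' ≤ I.G q (S₁ ∪ ((range l).image o ∪ (A \ S₁))) := by
        refine le_avg h.dr.curved h.m_pos _ _ fun x hx => ?_
        simp only [hO', mem_union, mem_sdiff] at hx ⊢
        tauto
      linarith
    rw [sum_sub_distrib, ← sum_div, sum_const, card_range, nsmul_eq_mul] at h5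
    have hlk : (l : ℝ) * de ≤ I.k * de :=
      mul_le_mul_of_nonneg_right (by exact_mod_cast h.l_le) h.de_pos.le
    have hlk0 : 0 ≤ (l : ℝ) * de := mul_nonneg (Nat.cast_nonneg _) h.de_pos.le
    have h10 := mul_le_mul_of_nonneg_left h5 ha0
    have h11 := mul_le_mul_of_nonneg_left h6 (mul_nonneg ha0 h1m.le)
    have h12 : a * (l * de) ≤ I.k * de := by nlinarith
    have e1 : ∀ x : ℝ, x / I.m = 1 / I.m * x := fun x => by ring
    rw [e1 (∑ i ∈ range l, (I.G q (insert (o i) S₁) - I.G q S₁))] at h10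
    rw [e1 a]
    generalize (1 : ℝ) / I.m = η at *
    nlinarith

end Split

end Inst


/-! ### Completing the large elements and the whole guess -/

lemma Dominated.card_le {E : Type*} {w : E → ℝ} (hw : ∀ e, 0 ≤ w e) {T L : Finset E}
    (h : Dominated w T L) : T.card ≤ L.card := by
  have := h 0
  rwa [filter_true_of_mem fun e _ => hw e, filter_true_of_mem fun e _ => hw e] at this

namespace Inst
variable {I : Inst n} {om y de W : ℝ} {l Bm : ℕ} {o : ℕ → Fin n} {A : Finset (Fin n)} {c : ℕ → ℕ}

/-- A run reads finitely many guessed numbers, so a guess fits into a finite vector of digits.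
Moreover, the stages do not read `tau` and `fil`, which can be chosen afterwards. -/
lemma state_congr {g g' : Guess} (h1 : g.om = g'.om) (h2 : g.y = g'.y) (h3 : g.de = g'.de)
    {pk : ℕ → ℕ} {t : ℕ} (h4 : ∀ s < t, ∀ i < I.k, g.cls s i = g'.cls s i)
    (h5 : ∀ s < t, ∀ i < I.k, g.thr s i = g'.thr s i) (h6 : ∀ s < t, g.beta s = g'.beta s) :
    I.state g pk t = I.state g' pk t := by
  induction t with
  | zero => rfl
  | succ t ih =>
    have hsl : ∀ i ≤ I.k, ∀ q S, I.slots g.om g.de (g.cls t) (g.thr t) t q S i =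
        I.slots g'.om g'.de (g'.cls t) (g'.thr t) t q S i := by
      intro i
      induction i with
      | zero => intros; rfl
      | succ i ih =>
        intro hi q S
        rw [slots, slots, ih (by omega), h1, h3, h4 t (by omega) i hi, h5 t (by omega) i hi]
    rw [state, state, ih (fun s hs => h4 s (by omega)) (fun s hs => h5 s (by omega))
      fun s hs => h6 s (by omega)]
    rw [stage, stage, hsl I.k le_rfl, h1, h2, h6 t (by omega)]

lemma fills_congr {g g' : Guess} (h1 : g.om = g'.om) (h3 : g.de = g'.de) {T : Finset (Fin n)}
    {j : ℕ} (h : ∀ i < j, g.fil i = g'.fil i) : I.fills g T j = I.fills g' T j := by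
  induction j with
  | zero => rfl
  | succ j ih => rw [fills, fills, ih fun i hi => h i (by omega), h1, h3, h j (by omega)]

lemma candidate_congr {g g' : Guess} (h1 : g.om = g'.om) (h2 : g.y = g'.y) (h3 : g.de = g'.de)
    {pk : ℕ → ℕ} (h4 : ∀ s < I.m, ∀ i < I.k, g.cls s i = g'.cls s i)
    (h5 : ∀ s < I.m, ∀ i < I.k, g.thr s i = g'.thr s i) (h6 : ∀ s < I.m, g.beta s = g'.beta s)
    (h7 : ∀ i < I.k, g.tau i = g'.tau i) (h8 : ∀ i < I.k, g.fil i = g'.fil i) :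
    I.candidate g pk = I.candidate g' pk := by
  rw [candidate, candidate, state_congr h1 h2 h3 h4 h5 h6, fills_congr h1 h3 h8]
  congr 1
  ext x
  rw [mem_pickSet, mem_pickSet]
  refine or_congr_right (exists_congr fun i => and_congr_right fun hi => ?_)
  rw [h7 i hi]

namespace Split
variable (h : Split I om y de W l Bm o A c)
include h

lemma exists_state {pk : ℕ → ℕ} (hpk : ∀ p < I.k * I.m, pk p = n) :
    ∃ (thr : ℕ → ℕ → ℕ) (beta : ℕ → ℕ), (∀ t i, thr t i ≤ Bm) ∧ (∀ t, beta t ≤ Bm) ∧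
      ∀ tau fil, Progress I om y de W l o A c I.m
        (I.state ⟨om, y, de, fun _ => c, thr, beta, tau, fil⟩ pk I.m) := by
  obtain ⟨d, hd, hI⟩ := exists_choices (α := (ℕ → ℕ) × ℕ) (s₀ := (pk, I.zeros)) (N := I.m)
    (F := fun t s a => I.stage ⟨om, y, de, fun _ => c, fun _ => a.1, fun _ => a.2,
      fun _ => 0, fun _ => 0⟩ t s)
    (run := fun d t => I.state ⟨om, y, de, fun _ => c, fun t => (d t).1, fun t => (d t).2,
      fun _ => 0, fun _ => 0⟩ pk t)
    (P := fun a => (∀ i, a.1 i ≤ Bm) ∧ a.2 ≤ Bm) (Inv := Progress I om y de W l o A c)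
    (fun _ => rfl) (fun _ _ => rfl) ⟨(fun _ => 0, 0), by simp⟩ (h.progress_zero hpk) (by
      intro t ht s hs
      obtain ⟨th, hth, β, hβ, hP⟩ := h.progress_succ ht hs
      exact ⟨(th, β), ⟨hth, hβ⟩, hP _ rfl rfl rfl rfl rfl rfl⟩)
  refine ⟨fun t => (d t).1, fun t => (d t).2, fun t => (hd t).1, fun t => (hd t).2, ?_⟩
  intro tau fil
  convert hI using 1
  apply state_congr <;> intros <;> rfl

omit h in
lemma card_image_range (hinj : ∀ i < l, ∀ j < l, o i = o j → i = j) :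
    ((range l).image o).card = l := by
  rw [card_image_of_injOn, card_range]
  intro i hi j hj
  exact hinj i (by simpa using hi) j (by simpa using hj)

/-- With suitable fill classes, all large slots are filled in the end. -/
lemma exists_fills {pk tau : ℕ → ℕ} {S : Finset (Fin n)} (hS : ∀ e ∈ S, I.w e ≤ om)
    (hpk : ∀ i < I.k, I.PickOK om de l o c pk i (tau i)) :
    ∃ fil : ℕ → ℕ, (∀ i, fil i ≤ Bm) ∧ ∀ g : Guess, g.om = om → g.de = de → g.fil = fil →
      ∃ T, I.fills g (pickSet I.k pk tau S) I.k = T ∧ pickSet I.k pk tau S ⊆ T ∧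
        weight I.w T ≤ weight I.w S + weight I.w ((range l).image o) ∧
        weight (lin I.f) S + weight (lin I.f) ((range l).image o) - l * de ≤
          weight (lin I.f) T := by
  classical
  set T₀ := pickSet I.k pk tau S with hT₀
  set L := (range l).image o with hL
  have hLcard : L.card = l := card_image_range h.inj
  let Tl : Finset (Fin n) → Finset (Fin n) := fun T => T.filter fun e => om < I.w e
  -- Domination is required separately in each class, since the linear value is controlled by the
  -- numbers of elements in the classes.
  let Inv : ℕ → Finset (Fin n) → Prop := fun j T =>
    (∀ q, Dominated I.w ((Tl T).filter fun e => I.classOf de e = q)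
      (L.filter fun e => I.classOf de e = q)) ∧
    (T.filter fun e => ¬ om < I.w e) = S ∧ T₀ ⊆ T ∧ (j ≤ (Tl T).card ∨ l ≤ (Tl T).card)
  have hbase : Inv 0 T₀ := by
    refine ⟨fun q z => ?_, ?_, subset_rfl, Or.inl (Nat.zero_le _)⟩
    · have hmem : ∀ e, om < I.w e → e ∈ T₀ → ∃ i < l, pk (i + I.k * tau i) = e ∧
          I.w e ≤ I.w (o i) ∧ I.classOf de e = I.classOf de (o i) := by
        intro e he heT
        rcases mem_pickSet.1 heT with h1 | ⟨i, hi, h1⟩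
        · exact absurd (hS e h1) (not_le.2 he)
        · rcases hpk i hi with ⟨_, h2⟩ | ⟨h2, b, hb, h3, _, h4⟩
          · rw [h2] at h1; exact absurd e.2 (by omega)
          · rw [hb] at h1
            have hbe : b = e := Fin.ext h1
            subst hbe
            exact ⟨i, h2, hb, h3, h4.trans (h.cls i h2)⟩
      set J := (range l).filter fun i => I.classOf de (o i) = q ∧ z ≤ I.w (o i) with hJ
      have h1 : ((L.filter fun e => I.classOf de e = q).filter fun e => z ≤ I.w e) = J.image o := by
        rw [filter_filter, hL, filter_image]
      rw [h1, card_image_of_injOn fun i hi j hj => h.inj i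
        (by have := (mem_filter.1 hi).1; simpa using this) j
        (by have := (mem_filter.1 hj).1; simpa using this)]
      have h2 : (((Tl T₀).filter fun e => I.classOf de e = q).filter fun e => z ≤ I.w e) ⊆
          J.biUnion fun i => univ.filter fun e : Fin n => pk (i + I.k * tau i) = e := by
        intro e he
        simp only [mem_filter, Tl] at he
        obtain ⟨i, hi, h3, h4, h5⟩ := hmem e he.1.1.2 he.1.1.1
        rw [mem_biUnion]
        refine ⟨i, mem_filter.2 ⟨mem_range.2 hi, by rw [← h5]; exact he.1.2, he.2.trans h4⟩, ?_⟩
        simpa using h3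
      refine (card_le_card h2).trans ?_
      refine card_biUnion_le.trans ?_
      rw [card_eq_sum_ones]
      refine sum_le_sum fun i _ => card_le_one.2 fun a ha b hb => ?_
      simp only [mem_filter, mem_univ, true_and] at ha hb
      exact Fin.ext (ha.symm.trans hb)
    · ext e
      rw [mem_filter]
      constructor
      · rintro ⟨h1, h2⟩
        rcases mem_pickSet.1 h1 with h3 | ⟨i, hi, h3⟩
        · exact h3
        · rcases hpk i hi with ⟨_, h4⟩ | ⟨_, b, hb, _, h4, _⟩
          · rw [h4] at h3; exact absurd e.2 (by omega)
          · rw [hb] at h3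
            have hbe : b = e := Fin.ext h3
            exact absurd (hbe ▸ h4) h2
      · intro h1
        exact ⟨mem_pickSet.2 (Or.inl h1), not_lt.2 (hS e h1)⟩
  obtain ⟨fil, hfil, hI⟩ := exists_choices (α := ℕ) (s₀ := T₀) (N := I.k)
    (F := fun _ T a => ins T (argBest n (fun e => I.InClass om de a e ∧ ¬ HasIdx T e)
      (fun e b => natExt I.w e < natExt I.w b) n))
    (run := fun fil j => I.fills ⟨om, y, de, fun _ => c, fun _ => c, c, c, fil⟩ T₀ j)
    (P := fun a => a ≤ Bm) (Inv := Inv) (fun _ => rfl) (fun _ _ => rfl) ⟨0, Nat.zero_le _⟩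
    hbase (by
      rintro j hj T ⟨h1, h2, h3, h4⟩
      have hspec := fun a => argBest_spec (N := n)
        (cand := fun e => I.InClass om de a e ∧ ¬ HasIdx T e)
        (better := fun e b => natExt I.w e < natExt I.w b)
        (fun _ => lt_irrefl _) (fun _ _ _ _ _ _ h1 h2 => h1.trans h2) le_rfl
      rcases le_or_gt l (Tl T).card with hl | hl
      -- Nothing is missing any more. The class `c l` has no elements, so choosing it leaves the set
      -- unchanged.
      · refine ⟨c l, h.cls_le l, ?_⟩
        rcases hspec (c l) with h5 | h5
        · rw [h5.1, ins_of_le _ le_rfl]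
          exact ⟨h1, h2, h3, Or.inr hl⟩
        · exact absurd ((inClass_iff h.de_pos h.lin_nonneg _ ⟨_, h5.1⟩).1 h5.2.1.1).2
            (h.cls_empty l le_rfl _)
      -- Fewer than `l` large elements are present, so some class has fewer of them than `L`; its
      -- lightest missing element is added.
      · obtain ⟨q, hq⟩ : ∃ q, ((Tl T).filter fun e => I.classOf de e = q).card <
            (L.filter fun e => I.classOf de e = q).card := by
          by_contra! hc
          have e1 := card_eq_sum_card_fiberwise (s := L) (t := univ.image (I.classOf de))
            (f := I.classOf de) fun e _ => by simp
          have e2 := card_eq_sum_card_fiberwise (s := Tl T) (t := univ.image (I.classOf de))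
            (f := I.classOf de) fun e _ => by simp
          have := sum_le_sum fun q (_ : q ∈ univ.image (I.classOf de)) => hc q
          omega
        have hLq : ∀ e ∈ L, ∃ i < l, o i = e := fun e he => by simpa [hL] using he
        obtain ⟨e₀, he₀⟩ := card_pos.1 (lt_of_le_of_lt (Nat.zero_le _) hq)
        obtain ⟨i₀, hi₀, rfl⟩ := hLq e₀ (mem_filter.1 he₀).1
        have hqB : q ≤ Bm := by
          rw [← (mem_filter.1 he₀).2, ← h.cls i₀ hi₀]; exact h.cls_le _
        refine ⟨q, hqB, ?_⟩
        obtain ⟨e₁, he₁, he₁T⟩ : ∃ e ∈ L.filter fun e => I.classOf de e = q,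
            e ∉ (Tl T).filter fun e => I.classOf de e = q := by
          by_contra! hc
          exact absurd (card_le_card hc) (not_le.2 hq)
        have hlarge : ∀ e ∈ L, om < I.w e := fun e he => by
          obtain ⟨i, hi, rfl⟩ := hLq e he
          exact h.large i hi
        rw [mem_filter] at he₁
        rcases hspec q with h5 | ⟨h5, ⟨h6, h7⟩, h8⟩
        · refine absurd ⟨(inClass_iff h.de_pos h.lin_nonneg q e₁).2 ⟨hlarge e₁ he₁.1, he₁.2⟩, ?_⟩
            (h5.2 e₁ e₁.2)
          rw [hasIdx_val]
          intro h9
          exact he₁T (mem_filter.2 ⟨mem_filter.2 ⟨h9, hlarge e₁ he₁.1⟩, he₁.2⟩)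
        · obtain ⟨b, hb⟩ : ∃ b : Fin n, argBest n (fun e => I.InClass om de q e ∧ ¬ HasIdx T e)
              (fun e b => natExt I.w e < natExt I.w b) n = b := ⟨⟨_, h5⟩, rfl⟩
          rw [hb] at h6 h7 h8 ⊢
          rw [hasIdx_val] at h7
          rw [inClass_iff h.de_pos h.lin_nonneg] at h6
          rw [ins_val]
          have hTl : Tl (insert b T) = insert b (Tl T) := by
            simp only [Tl]; rw [filter_insert, if_pos h6.1]
          have hbT : b ∉ Tl T := fun hh => h7 (mem_filter.1 hh).1
          refine ⟨fun q' => ?_, ?_, h3.trans (subset_insert _ _), ?_⟩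
          · rw [hTl, filter_insert]
            split_ifs with hq'
            · rw [h6.2] at hq'
              subst hq'
              refine (h1 q).insert_lightest (C := univ.filter fun e =>
                om < I.w e ∧ I.classOf de e = q) ?_ hq (fun hh => hbT (mem_filter.1 hh).1) ?_
              · intro e he
                rw [mem_filter] at he
                exact mem_filter.2 ⟨mem_univ _, hlarge e he.1, he.2⟩
              · intro e he heT
                rw [mem_filter] at he
                have h9 : e ∉ T := fun hh =>
                  heT (mem_filter.2 ⟨mem_filter.2 ⟨hh, he.2.1⟩, he.2.2⟩)
                have := h8 e e.2 ⟨(inClass_iff h.de_pos h.lin_nonneg q e).2 he.2, by simpa using h9⟩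
                simpa using this
            · exact h1 q'
          · rw [filter_insert, if_neg (not_not.2 h6.1)]; exact h2
          · rw [hTl, card_insert_of_notMem hbT]
            rcases h4 with h4 | h4 <;> omega)
  refine ⟨fil, hfil, fun g g1 g2 g3 => ?_⟩
  obtain ⟨T, hT⟩ : ∃ T, I.fills g T₀ I.k = T := ⟨_, rfl⟩
  refine ⟨T, hT, ?_⟩
  have hI' : Inv I.k T := by
    rw [← hT, fills_congr (g' := ⟨om, y, de, fun _ => c, fun _ => c, c, c, fil⟩) g1 g2
      fun i _ => by rw [g3]]
    exact hI
  obtain ⟨h1, h2, h3, h4⟩ := hI'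
  have hcardle : ∀ q, ((Tl T).filter fun e => I.classOf de e = q).card ≤
      (L.filter fun e => I.classOf de e = q).card := fun q => (h1 q).card_le h.w_nonneg
  set C := (univ : Finset (Fin n)).image (I.classOf de) with hC
  have e1 := card_eq_sum_card_fiberwise (s := L) (t := C) (f := I.classOf de) fun e _ => by simp [hC]
  have e2 := card_eq_sum_card_fiberwise (s := Tl T) (t := C) (f := I.classOf de)
    fun e _ => by simp [hC]
  -- No class has too many elements and the total is at least `l`, so all classes have exactly the
  -- right number.
  have hcardeq : ∀ q ∈ C, ((Tl T).filter fun e => I.classOf de e = q).card =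
      (L.filter fun e => I.classOf de e = q).card := by
    have hle : l ≤ (Tl T).card := by
      have := h.l_le
      rcases h4 with h4 | h4 <;> omega
    refine (sum_eq_sum_iff_of_le fun q _ => hcardle q).1 ?_
    have := sum_le_sum fun q (_ : q ∈ C) => hcardle q
    omega
  have hsplit : ∀ v : Fin n → ℝ, weight v T = weight v S + weight v (Tl T) := by
    intro v
    rw [← h2, weight, ← sum_filter_add_sum_filter_not T (fun e => om < I.w e), add_comm]
    rfl
  have hfib : ∀ (v : Fin n → ℝ) (X : Finset (Fin n)),
      weight v X = ∑ q ∈ C, weight v (X.filter fun e => I.classOf de e = q) := by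
    intro v X
    exact (sum_fiberwise_of_maps_to (t := C) (fun e _ => by simp [hC]) v).symm
  refine ⟨h3, ?_, ?_⟩
  · rw [hsplit]
    have : weight I.w (Tl T) ≤ weight I.w L := by
      rw [hfib _ (Tl T), hfib _ L]
      exact sum_le_sum fun q _ => (h1 q).weight_le h.w_nonneg
    linarith
  · rw [hsplit]
    -- With equal numbers in all classes, the linear values rounded down to multiples of `de` have
    -- equal sums; undoing the rounding costs at most `de` for each element of `L`.
    have h5 : weight (fun e => (I.classOf de e : ℝ) * de) (Tl T) =
        weight (fun e => (I.classOf de e : ℝ) * de) L := by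
      rw [hfib _ (Tl T), hfib _ L]
      refine sum_congr rfl fun q hq => ?_
      have hconst : ∀ X : Finset (Fin n), weight (fun e => (I.classOf de e : ℝ) * de)
          (X.filter fun e => I.classOf de e = q) =
          (X.filter fun e => I.classOf de e = q).card * (q * de) := by
        intro X
        rw [weight, sum_congr rfl fun e he => by rw [(mem_filter.1 he).2], sum_const, nsmul_eq_mul]
      rw [hconst, hconst, hcardeq q hq]
    have h6 : weight (fun e => (I.classOf de e : ℝ) * de) (Tl T) ≤ weight (lin I.f) (Tl T) := by
      refine sum_le_sum fun e _ => ?_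
      rw [← le_div_iff₀ h.de_pos]
      exact Nat.floor_le (div_nonneg (h.lin_nonneg e) h.de_pos.le)
    have h7 : weight (lin I.f) L - l * de ≤ weight (fun e => (I.classOf de e : ℝ) * de) L := by
      have : ∑ e ∈ L, (lin I.f e - de) ≤ weight (fun e => (I.classOf de e : ℝ) * de) L := by
        refine sum_le_sum fun e _ => ?_
        have := (Nat.lt_floor_add_one (lin I.f e / de)).le
        rw [div_le_iff₀ h.de_pos] at this
        simp only [classOf]
        linarith
      rw [sum_sub_distrib, sum_const, hLcard, nsmul_eq_mul] at this
      exact this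
    linarith

/-- There is a guess whose candidate is feasible and good. -/
lemma exists_guess (hdis : Disjoint ((range l).image o) A)
    (hW : weight I.w ((range l).image o) + W ≤ 1) {pk : ℕ → ℕ}
    (hpk : ∀ p < I.k * I.m, pk p = n) :
    ∃ g : Guess, g.om = om ∧ g.y = y ∧ g.de = de ∧ (∀ t i, g.cls t i ≤ Bm) ∧
      (∀ t i, g.thr t i ≤ Bm) ∧ (∀ t, g.beta t ≤ Bm) ∧ (∀ i, g.tau i < I.m) ∧
      (∀ i, g.fil i ≤ Bm) ∧ weight I.w (I.candidate g pk) ≤ 1 ∧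
      (1 - coef I.m 0) * curved I.f ((range l).image o ∪ A) +
        weight (lin I.f) ((range l).image o ∪ A) - (I.m + 1) * (I.k * de) ≤
        I.f (I.candidate g pk) := by
  obtain ⟨thr, beta, hthr, hbeta, hprog⟩ := h.exists_state hpk
  obtain ⟨pk', S, hst⟩ : ∃ pk' S, ∀ tau fil,
      I.state ⟨om, y, de, fun _ => c, thr, beta, tau, fil⟩ pk I.m = (pk', S) :=
    ⟨(I.state ⟨om, y, de, fun _ => c, thr, beta, fun _ => 0, fun _ => 0⟩ pk I.m).1,
      (I.state ⟨om, y, de, fun _ => c, thr, beta, fun _ => 0, fun _ => 0⟩ pk I.m).2,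
      fun tau fil => by rw [Prod.mk.eta]; apply state_congr <;> intros <;> rfl⟩
  have hP := hprog (fun _ => 0) fun _ => 0
  rw [hst] at hP
  obtain ⟨hpick, _, _, hsm, hroom, hval⟩ := hP
  simp only at hpick hsm hroom hval
  -- The averaging over scenarios is undone here: one scenario is at least as good as the average.
  obtain ⟨τ, hτ⟩ := exists_avg_le (g := curved I.f) h.m_pos I.k pk' S
  have hm : (I.m : ℝ) ≠ 0 := by have := h.m_pos; positivity
  have htau : ∀ i, scenario τ i < I.m := by
    intro i
    rw [scenario]
    split_ifs
    · exact (τ _).2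
    · exact h.m_pos
  obtain ⟨fil, hfil, hT⟩ := h.exists_fills (tau := scenario τ) hsm
    fun i hi => hpick _ (htau i) i hi
  obtain ⟨T, hT1, hT2, hT3, hT4⟩ := hT ⟨om, y, de, fun _ => c, thr, beta, scenario τ, fil⟩ rfl rfl rfl
  have hcand : I.candidate ⟨om, y, de, fun _ => c, thr, beta, scenario τ, fil⟩ pk = T := by
    rw [candidate, hst]; exact hT1
  refine ⟨⟨om, y, de, fun _ => c, thr, beta, scenario τ, fil⟩, rfl, rfl, rfl,
    fun _ => h.cls_le, hthr, hbeta, htau, hfil, ?_, ?_⟩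
  · rw [hcand]
    rw [div_self hm] at hroom
    linarith
  · rw [hcand]
    rw [div_self hm, coef_self h.m_pos] at hval
    have h1 := h.dr.curved.mono _ _ hT2
    have h2 : curved I.f T = I.f T - weight (lin I.f) T := rfl
    have h3 : (l : ℝ) * de ≤ I.k * de :=
      mul_le_mul_of_nonneg_right (by exact_mod_cast h.l_le) h.de_pos.le
    have h4 : I.G pk' S ≤ curved I.f (pickSet I.k pk' (scenario τ) S) := hτ
    rw [weight_union hdis]
    linarith

end Split

end Inst


/-! ### Dyadic guesses and the bookkeeping of the losses -/

lemma exists_dyadic {a X : ℝ} (h : a ≤ X) {J : ℕ} (hJ : 0 < J) :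
    ∃ j < J, a * 2 ^ j ≤ X ∧ (j + 1 = J ∨ X < a * 2 ^ (j + 1)) := by
  induction J with
  | zero => omega
  | succ J ih =>
    rcases Nat.eq_zero_or_pos J with rfl | hJ'
    · exact ⟨0, by omega, by simpa using h, Or.inl rfl⟩
    · obtain ⟨j, hj, h1, h2⟩ := ih hJ'
      rcases h2 with rfl | h2
      · rcases le_or_gt (a * 2 ^ (j + 1)) X with h3 | h3
        · exact ⟨j + 1, by omega, h3, Or.inl rfl⟩
        · exact ⟨j, by omega, h1, Or.inr h3⟩
      · exact ⟨j, by omega, h1, Or.inr h2⟩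

/-- Both bounds come from `1 + x ≤ exp x`, for `x = 1 / K` and `x = -1 / (K + 1)`. The lower bound
is needed too, because the linear part enters the guarantee with the factor `coef K 0`. -/
lemma coef_zero_bounds {K : ℕ} (hK : 0 < K) :
    1 / Real.exp 1 ≤ Inst.coef K 0 ∧ Inst.coef K 0 ≤ 1 / Real.exp 1 + 1 / K := by
  have hK' : (0 : ℝ) < K := by exact_mod_cast hK
  have he : 1 / Real.exp 1 = Real.exp (-1) := by rw [Real.exp_neg, one_div]
  simp only [Inst.coef, pow_zero, mul_one, he]
  constructor
  · have h1 : ((K : ℝ) + 1) / K ≤ Real.exp (1 / K) := by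
      have := Real.add_one_le_exp (1 / (K : ℝ))
      rwa [show (1 : ℝ) / K + 1 = (K + 1) / K by field_simp; ring] at this
    have h2 : (((K : ℝ) + 1) / K) ^ K ≤ Real.exp 1 := by
      calc _ ≤ Real.exp (1 / K) ^ K := by gcongr
        _ = Real.exp 1 := by rw [← Real.exp_nat_mul]; congr 1; field_simp
    have h3 : ((K : ℝ) / (K + 1)) ^ K = ((((K : ℝ) + 1) / K) ^ K)⁻¹ := by
      rw [← inv_pow, inv_div]
    rw [h3, Real.exp_neg]
    exact inv_anti₀ (by positivity) h2
  · have h1 : (K : ℝ) / (K + 1) ≤ Real.exp (-(1 / (K + 1))) := by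
      have := Real.add_one_le_exp (-(1 / ((K : ℝ) + 1)))
      rwa [show -(1 / ((K : ℝ) + 1)) + 1 = K / (K + 1) by field_simp; ring] at this
    have h2 : ((K : ℝ) / (K + 1)) ^ (K + 1) ≤ Real.exp (-1) := by
      calc _ ≤ Real.exp (-(1 / (K + 1))) ^ (K + 1) := by gcongr
        _ = Real.exp (-1) := by
          rw [← Real.exp_nat_mul]; congr 1; push_cast; field_simp
    have h3 : ((K : ℝ) / (K + 1)) ^ K = ((K : ℝ) / (K + 1)) ^ (K + 1) * (1 + 1 / K) := by
      rw [pow_succ]; field_simp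
    have h4 : Real.exp (-1) ≤ 1 := Real.exp_le_one_iff.2 (by norm_num)
    rw [h3]
    have h5 : 0 ≤ 1 / (K : ℝ) := by positivity
    nlinarith

lemma succ_div_sq_le {K : ℝ} (hK : 1 ≤ K) : (K + 1) / K ^ 2 ≤ 2 / K := by
  have h : 0 < K := by linarith
  rw [div_le_div_iff₀ (by positivity) h]
  nlinarith

/-- Here `q` is `f O / K`. Losses arise from thinning out `O`, in `f` and in its linear part, from
replacing `coef K 0` by `1 / e`, and from rounding. -/
lemma combine_losses {x c₀ r q F F' l' cF d : ℝ} (hx : 0 ≤ x) (hxc : x ≤ c₀) (hcx : c₀ ≤ x + r)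
    (hc : c₀ ≤ 1) (hq : 0 ≤ q) (hl' : 0 ≤ l') (hF : 0 ≤ F) (hF' : F - F' ≤ 2 * q)
    (hlin : F - cF - 2 * q ≤ l') (hd : d ≤ 2 * q) (hqr : q = r * F) :
    F - x * cF - 7 * q ≤ (1 - c₀) * (F' - l') + l' - d := by
  have h1 := mul_le_mul_of_nonneg_left (show F - 2 * q ≤ F' by linarith) (sub_nonneg.2 hc)
  have h2 := mul_le_mul_of_nonneg_right hxc hl'
  have h3 := mul_le_mul_of_nonneg_left hlin hx
  have h4 := mul_le_mul_of_nonneg_right hcx hF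
  have h5 := mul_le_mul_of_nonneg_right hxc hq
  have h6 := mul_nonneg (hx.trans hxc) hq
  linarith

namespace Inst

/-- On every instance there is a guess within the bounds whose candidate is feasible and good. -/
theorem exists_good_guess {I : Inst n} {K J : ℕ} {M₁ : ℝ} {O : Finset (Fin n)}
    (hK : 0 < K) (hIm : I.m = K) (hIk : I.k = 8 * K ^ 3)
    (hmono : Monotone I.f) (hsub : IsSubmodular I.f) (h0 : ∀ S, 0 ≤ I.f S)
    (hw : ∀ e, 0 ≤ I.w e ∧ I.w e ≤ 1) (hO : IsOptimal I.f I.w O) (hOne : O.Nonempty)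
    (hM₁ : 0 < M₁) (hM₁le : ∀ e, I.f {e} ≤ M₁) (hM₁e : ∃ e, I.f {e} = M₁)
    (hJ : 0 < J) (hnJ : n ≤ 2 ^ (J - 1)) {pk : ℕ → ℕ} (hpk : ∀ p < I.k * I.m, pk p = n) :
    ∃ es ≤ n, ∃ j₁ < J, ∃ j₂ < J, ∃ g : Guess, g.om = natExt I.w es ∧ g.y = g.om * 2 ^ j₁ ∧
      g.de = M₁ / (8 * K ^ 5 : ℕ) * 2 ^ j₂ ∧ (∀ t i, g.cls t i ≤ 16 * K ^ 5 + 1) ∧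
      (∀ t i, g.thr t i ≤ 16 * K ^ 5 + 1) ∧ (∀ t, g.beta t ≤ 16 * K ^ 5 + 1) ∧
      (∀ i, g.tau i < I.m) ∧ (∀ i, g.fil i ≤ 16 * K ^ 5 + 1) ∧
      weight I.w (I.candidate g pk) ≤ 1 ∧
      (1 - curvature I.f / Real.exp 1 - 7 / K) * I.f O ≤ I.f (I.candidate g pk) := by
  classical
  have hdr := MonoDR.of_submodular hmono hsub
  have hw0 : ∀ e, 0 ≤ I.w e := fun e => (hw e).1
  have hK' : (0 : ℝ) < K := by exact_mod_cast hK
  have hK1 : (1 : ℝ) ≤ K := by exact_mod_cast hK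
  -- With this value `K * M = 8 * K ^ 3` is the number of slots, and `M` is at least the bound `3 *
  -- K ^ 2 + 4 * K` needed for the splitting.
  set M := 8 * K ^ 2 with hM
  have hM' : (0 : ℝ) < M := by simp only [hM]; push_cast; positivity
  obtain ⟨L, A, hLO, hAO, hdis, hLcard, hLw, hsmall, hlarge, hroom, hloss⟩ :=
    exists_large_small (M := M) hmono hsub h0 hw0 hO.1 hK (by simp only [hM]; nlinarith)
  set W := 1 - weight I.w L with hW
  have hW0 : 0 ≤ W := by linarith
  have hWM : 0 ≤ W / M := by positivity
  have hOPT1 : ∀ e, I.f {e} ≤ I.f O := fun e => hO.2 _ (by simpa [weight] using (hw e).2)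
  have hOPT2 : I.f O ≤ n * M₁ := by
    refine (le_sum_single hdr h0 hOne).trans ((sum_le_sum fun e _ => hM₁le e).trans ?_)
    rw [sum_const, nsmul_eq_mul]
    have : (O.card : ℝ) ≤ n := by exact_mod_cast card_finset_fin_le O
    gcongr
  have hnJ' : (n : ℝ) ≤ 2 ^ (J - 1) := by exact_mod_cast hnJ
  -- The largest weight in `A` separates small from large. If `A` is empty, the index `n` stands for
  -- weight zero.
  obtain ⟨es, hes, hom0, hom1, homA⟩ : ∃ es ≤ n, 0 ≤ natExt I.w es ∧ natExt I.w es ≤ W / M ∧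
      ∀ e ∈ A, I.w e ≤ natExt I.w es := by
    rcases A.eq_empty_or_nonempty with h | h
    · refine ⟨n, le_rfl, ?_, ?_, by simp [h]⟩ <;> rw [natExt_of_le _ le_rfl]
      exact hWM
    · obtain ⟨e, he, hmax⟩ := exists_max_image A I.w h
      refine ⟨e, e.2.le, ?_⟩
      rw [natExt_val]
      exact ⟨hw0 e, hsmall e he, hmax⟩
  -- The unit `y` should be within a factor two of `W / M`. If `j₁` reaches its limit instead, then
  -- `y ≥ n * om`, which bounds the weight of any set of small elements. So `J` doublings suffice.
  obtain ⟨j₁, hj₁, hy1, hy2⟩ := exists_dyadic hom1 hJ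
  obtain ⟨e₁, he₁⟩ := hM₁e
  obtain ⟨j₂, hj₂, hd1, hd2⟩ := exists_dyadic (a := M₁) (X := I.f O) (by rw [← he₁]; exact hOPT1 e₁) hJ
  set om := natExt I.w es with hom
  set y := om * 2 ^ j₁ with hy
  set Q : ℝ := ((8 * K ^ 5 : ℕ) : ℝ) with hQ
  have hQ' : Q = 8 * (K : ℝ) ^ 5 := by simp only [hQ]; push_cast; ring
  have hQ0 : 0 < Q := by rw [hQ']; positivity
  set de := M₁ / Q * 2 ^ j₂ with hde
  have hde0 : 0 < de := by positivity
  have hdeQ : Q * de = M₁ * 2 ^ j₂ := by rw [hde]; field_simp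
  -- Since `f O` lies between `M₁` and `n * M₁`, doubling `M₁` fewer than `J` times reaches it
  -- within a factor two.
  have hOPTde : I.f O ≤ 2 * (Q * de) := by
    rw [hdeQ]
    rcases hd2 with h | h
    · have : J - 1 = j₂ := by omega
      rw [this] at hnJ'
      have h1 := mul_le_mul_of_nonneg_right hnJ' hM₁.le
      have h2 : 0 ≤ M₁ * 2 ^ j₂ := by positivity
      linarith
    · rw [pow_succ] at h; linarith
  -- A class number is at most `2 * Q = 16 * K ^ 5`, because no linear value exceeds `f O`. One more
  -- number is reserved for a class without elements, used for slots `i ≥ l`.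
  set Bm := 16 * K ^ 5 + 1 with hBm
  have hBmR : (Bm : ℝ) = 2 * Q + 1 := by rw [hQ', hBm]; push_cast; ring
  let l := L.card
  let o : ℕ → Fin n := fun i => if h : i < l then L.equivFin.symm ⟨i, h⟩ else e₁
  have ho : ∀ i (h : i < l), o i = L.equivFin.symm ⟨i, h⟩ := fun i h => by simp [o, h]
  have himg : (range l).image o = L := by
    ext e
    rw [mem_image]
    constructor
    · rintro ⟨i, hi, rfl⟩
      rw [ho i (mem_range.1 hi)]
      exact (L.equivFin.symm _).2
    · intro he
      refine ⟨L.equivFin ⟨e, he⟩, mem_range.2 (L.equivFin ⟨e, he⟩).2, ?_⟩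
      rw [ho _ (L.equivFin ⟨e, he⟩).2]
      simp
  have hoL : ∀ i < l, o i ∈ L := fun i hi => by
    rw [← himg]; exact mem_image_of_mem _ (mem_range.2 hi)
  have hcls : ∀ e, I.classOf de e ≤ 16 * K ^ 5 := by
    intro e
    refine Nat.floor_le_of_le ?_
    rw [div_le_iff₀ hde0]
    have h1 := lin_le_single hdr h0 e
    have h2 := hOPT1 e
    have h3 : ((16 * K ^ 5 : ℕ) : ℝ) = 2 * Q := by rw [hQ']; push_cast; ring
    rw [h3]
    linarith
  let c : ℕ → ℕ := fun i => if i < l then I.classOf de (o i) else Bm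
  have hsplit : Split I om y de W l Bm o A c := {
    dr := hdr
    nonneg := h0
    w_nonneg := hw0
    m_pos := by omega
    l_le := by rw [hIk]; exact hLcard.trans_eq (by rw [hM]; ring)
    om_nonneg := hom0
    y_nonneg := by positivity
    de_pos := hde0
    room := by
      rw [hIm]
      have h1 : (K : ℝ) * (2 * om + y) ≤ K * (3 * (W / M)) := by
        refine mul_le_mul_of_nonneg_left ?_ hK'.le
        linarith
      linarith
    small := homA
    large := fun i hi => lt_of_le_of_lt hom1 (hlarge _ (hoL i hi))
    cls := fun i hi => by simp [c, hi]
    cls_empty := fun i hi e => by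
      have := hcls e
      simp only [c, not_lt.2 hi, if_false]
      omega
    cls_le := fun i => by
      simp only [c]
      split_ifs
      · exact (hcls _).trans (Nat.le_succ _)
      · exact le_rfl
    wt_le := by
      intro X hX hXW
      have hX' : weight I.w X ≤ n * om := by
        refine (sum_le_sum fun e he => hX e he).trans ?_
        rw [sum_const, nsmul_eq_mul]
        have : (X.card : ℝ) ≤ n := by exact_mod_cast card_finset_fin_le X
        gcongr
      have hy0 : 0 ≤ y := by positivity
      have hB1 : (1 : ℝ) ≤ Bm := by rw [hBmR]; linarith
      rcases hy2 with h | h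
      · have : J - 1 = j₁ := by omega
        rw [this] at hnJ'
        have h1 := mul_le_mul_of_nonneg_right hnJ' hom0
        have h2 := mul_le_mul_of_nonneg_right hB1 hy0
        rw [hy] at h2 ⊢
        linarith
      · rw [pow_succ] at h
        have h1 : W / M < 2 * y := by rw [hy]; linarith
        rw [div_lt_iff₀ hM'] at h1
        have h2 : 2 * (M : ℝ) ≤ Bm := by
          have : 2 * M ≤ Bm := by
            have : K ^ 2 ≤ K ^ 5 := Nat.pow_le_pow_right hK (by norm_num)
            omega
          exact_mod_cast this
        have h3 := mul_le_mul_of_nonneg_right h2 hy0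
        linarith
    val_le := fun e => by
      have h1 := hOPT1 e
      rw [hBmR]
      linarith
    inj := by
      intro i hi j hj hij
      rw [ho i hi, ho j hj] at hij
      have := L.equivFin.symm.injective (Subtype.ext hij)
      simpa using this }
  obtain ⟨g, g1, g2, g3, g4, g5, g6, g7, g8, g9, g10⟩ :=
    hsplit.exists_guess (by rw [himg]; exact hdis) (by rw [himg]; linarith) hpk
  refine ⟨es, hes, j₁, hj₁, j₂, hj₂, g, g1, by rw [g2, g1], g3, g4, g5, g6, g7, g8, g9,
    le_trans ?_ g10⟩
  rw [himg, hIm, hIk]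
  set O' := L ∪ A with hO'
  have hO'O : O' ⊆ O := union_subset hLO hAO
  obtain ⟨c1, c2⟩ := coef_zero_bounds hK
  set c₀ := coef K 0
  set x := 1 / Real.exp 1 with hx
  have hx0 : 0 ≤ x := by positivity
  have hx1 : x ≤ 1 := by
    rw [hx, div_le_one (Real.exp_pos 1)]; exact Real.one_le_exp zero_le_one
  have hc01 : c₀ ≤ 1 := by
    rw [← Split.coef_self hK]
    exact Split.coef_mono hK (Nat.zero_le _)
  have hlinO := curvature_sum_le hdr h0 hOne
  have hlindrop := lin_drop_le hdr (sdiff_subset : O \ O' ⊆ O)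
  rw [weight_sdiff hO'O, Finset.sdiff_sdiff_eq_self hO'O] at hlindrop
  have hcurv : curved I.f O' = I.f O' - weight (lin I.f) O' := rfl
  have hlin0 : 0 ≤ weight (lin I.f) O' := weight_nonneg (lin_nonneg hdr) _
  have hF0 : 0 ≤ I.f O := h0 O
  -- The rounding error is at most `de` for each of the `8 * K ^ 3` slots in each of the `K` stages,
  -- and once more in the fills. The factor `K ^ 5` in `Q` makes this `O(f O / K)`.
  have hcost : ((K : ℝ) + 1) * ((8 * K ^ 3 : ℕ) * de) ≤ 2 * (I.f O / K) := by
    have h1 : Q * de ≤ I.f O := by rw [hdeQ]; exact hd1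
    have h2 : ((K : ℝ) + 1) * ((8 * K ^ 3 : ℕ) * de) = (K + 1) / (K ^ 2) * (Q * de) := by
      rw [hQ']; push_cast; field_simp
    have h3 : ((K : ℝ) + 1) / K ^ 2 ≤ 2 / K := succ_div_sq_le hK1
    rw [h2]
    calc _ ≤ 2 / K * I.f O := mul_le_mul h3 h1 (by positivity) (by positivity)
      _ = _ := by ring
  have hq : 0 ≤ I.f O / K := by positivity
  have e1 : (1 - curvature I.f / Real.exp 1 - 7 / K) * I.f O =
      I.f O - x * (curvature I.f * I.f O) - 7 * (I.f O / K) := by rw [hx]; ring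
  have e2 : (1 - curvature I.f) * I.f O = I.f O - curvature I.f * I.f O := by ring
  have e3 : I.f O / K = 1 / K * I.f O := by ring
  rw [e1, hcurv]
  rw [e2] at hlinO
  exact combine_losses hx0 c1 c2 hc01 hq hlin0 hF0 hloss (by linarith) hcost e3

end Inst


/-! ### Deterministic executions -/

lemma run_add (f : Finset (Fin n) → ℝ) (a b : ℕ) (c : Config n) :
    run f (a + b) c = (run f a c).bind (run f b) := by
  induction a generalizing c with
  | zero => simp [run]
  | succ a ih =>
    rw [Nat.add_right_comm, run, run, PMF.bind_bind]
    congr 1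
    funext d
    exact ih d

/-- The command `c` deterministically turns the memory `σ` into `σ'` in `t` units of time. -/
def Exec (f : Finset (Fin n) → ℝ) (c : Cmd) (σ σ' : Store n) (t : ℕ) : Prop :=
  ∀ K, run f t ⟨c :: K, σ⟩ = PMF.pure ⟨K, σ'⟩

lemma run_succ_of_step {f : Finset (Fin n) → ℝ} {c d : Config n} (h : step f c = PMF.pure d)
    (t : ℕ) : run f (t + 1) c = run f t d := by
  rw [run, h, PMF.pure_bind]

namespace Exec
variable {f : Finset (Fin n) → ℝ} {σ σ₁ σ₂ : Store n} {t t₁ t₂ : ℕ}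

lemma of_step {c : Cmd} (h : ∀ K, step f ⟨c :: K, σ⟩ = PMF.pure ⟨K, σ₁⟩) : Exec f c σ σ₁ 1 := by
  intro K
  rw [run_succ_of_step (h K), run]

lemma seq {c d : Cmd} (h₁ : Exec f c σ σ₁ t₁) (h₂ : Exec f d σ₁ σ₂ t₂) :
    Exec f (.seq c d) σ σ₂ (t₁ + t₂ + 1) := by
  intro K
  rw [run_succ_of_step (by rfl), run_add, h₁, PMF.pure_bind, h₂]

lemma ite_true {b : BExp} {c d : Cmd} (hb : b.holds σ) (h : Exec f c σ σ₁ t) :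
    Exec f (.ite b c d) σ σ₁ (t + 1) := by
  intro K
  rw [run_succ_of_step (by rfl), if_pos hb, h]

lemma ite_false {b : BExp} {c d : Cmd} (hb : ¬ b.holds σ) (h : Exec f d σ σ₁ t) :
    Exec f (.ite b c d) σ σ₁ (t + 1) := by
  intro K
  rw [run_succ_of_step (by rfl), if_neg hb, h]

lemma loop_false {b : BExp} {c : Cmd} (hb : ¬ b.holds σ) : Exec f (.loop b c) σ σ 1 := by
  intro K
  rw [run_succ_of_step (by rfl), if_neg hb, run]

lemma loop_true {b : BExp} {c : Cmd} (hb : b.holds σ) (h₁ : Exec f c σ σ₁ t₁)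
    (h₂ : Exec f (.loop b c) σ₁ σ₂ t₂) : Exec f (.loop b c) σ σ₂ (t₁ + t₂ + 1) := by
  intro K
  rw [run_succ_of_step (by rfl), if_pos hb, run_add, h₁, PMF.pure_bind, h₂]

end Exec

/-! ### A structured language with bounded loops

The natural-number cells and the real cells are divided into 32 arrays each, the cell `i` of the
array `r` having the address `32 * i + r`. -/

/-- The memory, as a family of arrays. -/
structure Mem (n : ℕ) where
  N : Fin 32 → ℕ → ℕ
  R : Fin 32 → ℕ → ℝ
  S : ℕ → Finset (Fin n)

namespace Mem

def toStore (s : Mem n) : Store n where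
  nat a := s.N (Fin.ofNat 32 a) (a / 32)
  real a := s.R (Fin.ofNat 32 a) (a / 32)
  sets := s.S

def setN (s : Mem n) (r : Fin 32) (i v : ℕ) : Mem n :=
  { s with N := Function.update s.N r (Function.update (s.N r) i v) }

def setR (s : Mem n) (r : Fin 32) (i : ℕ) (v : ℝ) : Mem n :=
  { s with R := Function.update s.R r (Function.update (s.R r) i v) }

def setS (s : Mem n) (a : ℕ) (A : Finset (Fin n)) : Mem n :=
  { s with S := Function.update s.S a A }

section
variable (s : Mem n) (r r' : Fin 32) (i i' v : ℕ) (x : ℝ) (a a' : ℕ) (A : Finset (Fin n))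

@[simp] lemma setN_N_self : (s.setN r i v).N r = Function.update (s.N r) i v := by simp [setN]
@[simp] lemma setN_N_ne (h : r' ≠ r) : (s.setN r i v).N r' = s.N r' := by simp [setN, h]
@[simp] lemma setN_R : (s.setN r i v).R = s.R := rfl
@[simp] lemma setN_S : (s.setN r i v).S = s.S := rfl
@[simp] lemma setR_R_self : (s.setR r i x).R r = Function.update (s.R r) i x := by simp [setR]
@[simp] lemma setR_R_ne (h : r' ≠ r) : (s.setR r i x).R r' = s.R r' := by simp [setR, h]
@[simp] lemma setR_N : (s.setR r i x).N = s.N := rfl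
@[simp] lemma setR_S : (s.setR r i x).S = s.S := rfl
@[simp] lemma setS_S_self : (s.setS a A).S a = A := by simp [setS]
@[simp] lemma setS_S_ne (h : a' ≠ a) : (s.setS a A).S a' = s.S a' := by simp [setS, h]
@[simp] lemma setS_N : (s.setS a A).N = s.N := rfl
@[simp] lemma setS_R : (s.setS a A).R = s.R := rfl
end

end Mem

/-- The address of the cell `i` of the array `r`. -/
def addr (r : Fin 32) (i : NExp) : NExp :=
  let d (e : NExp) : NExp := .add e e
  .add (d (d (d (d (d i))))) (.const r)

lemma addr_eval (σ : Store n) (r : Fin 32) (i : NExp) :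
    (addr r i).eval σ = 32 * i.eval σ + r := by
  simp only [addr, NExp.eval]; omega

lemma addr_div (i : ℕ) (r : Fin 32) : (32 * i + r) / 32 = i := by have := r.2; omega

lemma addr_ofNat (i : ℕ) (r : Fin 32) : Fin.ofNat 32 (32 * i + r) = r := by
  ext; have := r.2; simp only [Fin.ofNat]; omega

/-- The cell `0` of the array `r` of natural numbers. -/
def nv (r : Fin 32) : NExp := .cell (.const r)
/-- The cell `i` of the array `r` of natural numbers. -/
def na (r : Fin 32) (i : NExp) : NExp := .cell (addr r i)
/-- The cell `0` of the array `r` of reals. -/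
def rv (r : Fin 32) : RExp := .cell (.const r)
/-- The cell `i` of the array `r` of reals. -/
def ra (r : Fin 32) (i : NExp) : RExp := .cell (addr r i)

section
variable (s : Mem n) (r : Fin 32) (i : NExp)

@[simp] lemma nv_eval : (nv r).eval s.toStore = s.N r 0 := by
  have h1 := addr_div 0 r
  have h2 := addr_ofNat 0 r
  rw [Nat.mul_zero, Nat.zero_add] at h1 h2
  simp only [nv, NExp.eval, Mem.toStore, h1, h2]

@[simp] lemma rv_eval : (rv r).eval s.toStore = s.R r 0 := by
  have h1 := addr_div 0 r
  have h2 := addr_ofNat 0 r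
  rw [Nat.mul_zero, Nat.zero_add] at h1 h2
  simp only [rv, RExp.eval, NExp.eval, Mem.toStore, h1, h2]

@[simp] lemma na_eval : (na r i).eval s.toStore = s.N r (i.eval s.toStore) := by
  simp only [na, NExp.eval, addr_eval]
  simp only [Mem.toStore, addr_div, addr_ofNat]

@[simp] lemma ra_eval : (ra r i).eval s.toStore = s.R r (i.eval s.toStore) := by
  simp only [ra, RExp.eval, addr_eval]
  simp only [Mem.toStore, addr_div, addr_ofNat]

@[simp] lemma toStore_sets (a : ℕ) : s.toStore.sets a = s.S a := rfl
end

attribute [simp] NExp.eval BExp.holds.eq_1 BExp.holds.eq_2 BExp.holds.eq_4 BExp.holds.eq_5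
attribute [simp] RExp.eval.eq_1 RExp.eval.eq_3 RExp.eval.eq_4 RExp.eval.eq_5 RExp.eval.eq_6

@[simp] lemma mem_holds (s : Mem n) (i : NExp) (a : ℕ) :
    (BExp.mem i (.const a)).holds s.toStore ↔ HasIdx (s.S a) (i.eval s.toStore) := Iff.rfl

lemma toStore_update {α : Type*} (F : Fin 32 → ℕ → α) (r : Fin 32) (i : ℕ) (v : α) :
    Function.update (fun a => F (Fin.ofNat 32 a) (a / 32)) (32 * i + r) v =
      fun a => Function.update F r (Function.update (F r) i v) (Fin.ofNat 32 a) (a / 32) := by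
  funext a
  by_cases h : a = 32 * i + r
  · subst h
    simp only [addr_div, addr_ofNat, Function.update_self]
  · rw [Function.update_of_ne h]
    by_cases hr : Fin.ofNat 32 a = r
    · rw [hr, Function.update_self, Function.update_of_ne]
      intro hi
      rw [← hr] at h
      simp only [Fin.ofNat] at h
      omega
    · rw [Function.update_of_ne hr]

lemma toStore_setNat (s : Mem n) (r : Fin 32) (i v : ℕ) :
    s.toStore.setNat (32 * i + r) v = (s.setN r i v).toStore := by
  simp only [Mem.toStore, Store.setNat, Mem.setN, toStore_update]

lemma toStore_setReal (s : Mem n) (r : Fin 32) (i : ℕ) (v : ℝ) :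
    s.toStore.setReal (32 * i + r) v = (s.setR r i v).toStore := by
  simp only [Mem.toStore, Store.setReal, Mem.setR, toStore_update]

/-- Structured commands. In `rep v b c` the loop variable `v` runs from `0` to the value of `b`,
where `v` and `b` are cells `0` of arrays of natural numbers. -/
inductive Prog where
  | skip
  | setN (r : Fin 32) (i v : NExp)
  | setR (r : Fin 32) (i : NExp) (v : RExp)
  | ins (a : ℕ) (i : NExp)
  | del (a : ℕ) (i : NExp)
  | query (r : Fin 32) (a : ℕ)
  | seq (c d : Prog)
  | ite (b : BExp) (c d : Prog)
  | rep (v b : Fin 32) (c : Prog)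

notation:30 a:31 ";;" b:30 => Prog.seq a b

namespace Prog

def compile : Prog → Cmd
  | skip => .skip
  | setN r i v => .setNat (addr r i) v
  | setR r i v => .setReal (addr r i) v
  | ins a i => .insert (.const a) i
  | del a i => .erase (.const a) i
  | query r a => .query (addr r (.const 0)) (.const a)
  | seq c d => .seq c.compile d.compile
  | ite b c d => .ite b c.compile d.compile
  | rep v b c => .seq (.setNat (addr v (.const 0)) (.const 0))
      (.loop (.natLt (nv v) (nv b))
        (.seq c.compile (.setNat (addr v (.const 0)) (.add (nv v) (.const 1)))))

/-- Removal of the element with index `x`, if there is one. -/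
def _root_.SubmodKnapsack.rmv (A : Finset (Fin n)) (x : ℕ) : Finset (Fin n) :=
  if h : x < n then A.erase ⟨x, h⟩ else A

/-- The `j`-th state of a loop with the loop variable `v`. -/
def iter (v : Fin 32) (F : Mem n → Mem n) (s : Mem n) : ℕ → Mem n
  | 0 => s.setN v 0 0
  | j + 1 => (F (iter v F s j)).setN v 0 (j + 1)

open Classical in
/-- The meaning of a structured command. -/
def den (f : Finset (Fin n) → ℝ) : Prog → Mem n → Mem n
  | skip, s => s
  | setN r i v, s => s.setN r (i.eval s.toStore) (v.eval s.toStore)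
  | setR r i v, s => s.setR r (i.eval s.toStore) (v.eval s.toStore)
  | ins a i, s => s.setS a (SubmodKnapsack.ins (s.S a) (i.eval s.toStore))
  | del a i, s => s.setS a (rmv (s.S a) (i.eval s.toStore))
  | query r a, s => s.setR r 0 (f (s.S a))
  | seq c d, s => d.den f (c.den f s)
  | ite b c d, s => if b.holds s.toStore then c.den f s else d.den f s
  | rep v b c, s => iter v (c.den f) s (s.N b 0)

/-- Whether a command may write to an array of natural numbers. -/
def wN : Prog → Fin 32 → Bool
  | setN r _ _, r' => r == r'
  | seq c d, r' => c.wN r' || d.wN r'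
  | ite _ c d, r' => c.wN r' || d.wN r'
  | rep v _ c, r' => v == r' || c.wN r'
  | _, _ => false

/-- Whether a command may write to an array of reals. -/
def wR : Prog → Fin 32 → Bool
  | setR r _ _, r' => r == r'
  | query r _, r' => r == r'
  | seq c d, r' => c.wR r' || d.wR r'
  | ite _ c d, r' => c.wR r' || d.wR r'
  | rep _ _ c, r' => c.wR r'
  | _, _ => false

/-- Whether a command may write to a set. -/
def wS : Prog → ℕ → Bool
  | ins a _, a' => a == a'
  | del a _, a' => a == a'
  | seq c d, a' => c.wS a' || d.wS a'
  | ite _ c d, a' => c.wS a' || d.wS a'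
  | rep _ _ c, a' => c.wS a'
  | _, _ => false

lemma iter_N {v : Fin 32} {F : Mem n → Mem n} {r : Fin 32} (h : r ≠ v)
    (hF : ∀ s, (F s).N r = s.N r) (s : Mem n) (j : ℕ) : (iter v F s j).N r = s.N r := by
  induction j with
  | zero => simp [iter, h]
  | succ j ih => rw [iter, Mem.setN_N_ne _ _ _ _ _ h, hF, ih]

lemma iter_R {v r : Fin 32} {F : Mem n → Mem n} (hF : ∀ s, (F s).R r = s.R r) (s : Mem n) (j : ℕ) :
    (iter v F s j).R r = s.R r := by
  induction j with
  | zero => rfl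
  | succ j ih => rw [iter, Mem.setN_R, hF, ih]

lemma iter_S {v : Fin 32} {a : ℕ} {F : Mem n → Mem n} (hF : ∀ s, (F s).S a = s.S a) (s : Mem n)
    (j : ℕ) : (iter v F s j).S a = s.S a := by
  induction j with
  | zero => rfl
  | succ j ih => rw [iter, Mem.setN_S, hF, ih]

/-- A frame rule: `wN` is computed from the syntax, so for a concrete program the hypothesis is
closed by `rfl`. -/
lemma den_N {f : Finset (Fin n) → ℝ} {r : Fin 32} {c : Prog} (h : c.wN r = false) (s : Mem n) :
    (c.den f s).N r = s.N r := by
  induction c generalizing s with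
  | skip => rfl
  | setN r' i v =>
    simp only [wN, beq_eq_false_iff_ne] at h
    exact Mem.setN_N_ne _ _ _ _ _ h.symm
  | setR r' i v => rfl
  | ins a i => rfl
  | del a i => rfl
  | query r' a => rfl
  | seq c d ih1 ih2 =>
    simp only [wN, Bool.or_eq_false_iff] at h
    rw [den, ih2 h.2, ih1 h.1]
  | ite b c d ih1 ih2 =>
    simp only [wN, Bool.or_eq_false_iff] at h
    rw [den]
    split_ifs
    · exact ih1 h.1 s
    · exact ih2 h.2 s
  | rep v b c ih =>
    simp only [wN, Bool.or_eq_false_iff, beq_eq_false_iff_ne] at h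
    rw [den]
    exact iter_N h.1.symm (ih h.2) _ _

lemma den_R {f : Finset (Fin n) → ℝ} {r : Fin 32} {c : Prog} (h : c.wR r = false) (s : Mem n) :
    (c.den f s).R r = s.R r := by
  induction c generalizing s with
  | skip => rfl
  | setN r' i v => rfl
  | setR r' i v =>
    simp only [wR, beq_eq_false_iff_ne] at h
    exact Mem.setR_R_ne _ _ _ _ _ h.symm
  | ins a i => rfl
  | del a i => rfl
  | query r' a =>
    simp only [wR, beq_eq_false_iff_ne] at h
    exact Mem.setR_R_ne _ _ _ _ _ h.symm
  | seq c d ih1 ih2 =>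
    simp only [wR, Bool.or_eq_false_iff] at h
    rw [den, ih2 h.2, ih1 h.1]
  | ite b c d ih1 ih2 =>
    simp only [wR, Bool.or_eq_false_iff] at h
    rw [den]
    split_ifs
    · exact ih1 h.1 s
    · exact ih2 h.2 s
  | rep v b c ih =>
    exact iter_R (ih h) _ _

lemma den_S {f : Finset (Fin n) → ℝ} {a : ℕ} {c : Prog} (h : c.wS a = false) (s : Mem n) :
    (c.den f s).S a = s.S a := by
  induction c generalizing s with
  | skip => rfl
  | setN r' i v => rfl
  | setR r' i v => rfl
  | ins a' i =>
    simp only [wS, beq_eq_false_iff_ne] at h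
    exact Mem.setS_S_ne _ _ _ _ h.symm
  | del a' i =>
    simp only [wS, beq_eq_false_iff_ne] at h
    exact Mem.setS_S_ne _ _ _ _ h.symm
  | query r' a => rfl
  | seq c d ih1 ih2 =>
    simp only [wS, Bool.or_eq_false_iff] at h
    rw [den, ih2 h.2, ih1 h.1]
  | ite b c d ih1 ih2 =>
    simp only [wS, Bool.or_eq_false_iff] at h
    rw [den]
    split_ifs
    · exact ih1 h.1 s
    · exact ih2 h.2 s
  | rep v b c ih =>
    exact iter_S (ih h) _ _

/-- The command does not write to the arrays in `X`, and these contain the bounds of all its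
loops; moreover, no loop writes to its loop variable. -/
def ok (X : Fin 32 → Bool) : Prog → Bool
  | setN r _ _ => !X r
  | seq c d => c.ok X && d.ok X
  | ite _ c d => c.ok X && d.ok X
  | rep v b c => X b && !X v && !c.wN v && c.ok X
  | _ => true

/-- A bound on the running time, in terms of the bounds of the loops. -/
def cost (β : Fin 32 → ℕ) : Prog → ℕ
  | seq c d => c.cost β + d.cost β + 1
  | ite _ c d => c.cost β + d.cost β + 1
  | rep _ b c => β b * (c.cost β + 3) + 3
  | _ => 1

lemma wN_of_ok {X : Fin 32 → Bool} {c : Prog} (h : c.ok X) {r : Fin 32} (hr : X r) :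
    c.wN r = false := by
  induction c with
  | setN r' i v =>
    simp only [ok, Bool.not_eq_true'] at h
    simp only [wN, beq_eq_false_iff_ne]
    rintro rfl
    simp [h] at hr
  | seq c d ih1 ih2 =>
    simp only [ok, Bool.and_eq_true] at h
    simp [wN, ih1 h.1, ih2 h.2]
  | ite b c d ih1 ih2 =>
    simp only [ok, Bool.and_eq_true] at h
    simp [wN, ih1 h.1, ih2 h.2]
  | rep v b c ih =>
    simp only [ok, Bool.and_eq_true, Bool.not_eq_true'] at h
    simp only [wN, ih h.2, Bool.or_false, beq_eq_false_iff_ne]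
    rintro rfl
    simp [h.1.1.2] at hr
  | _ => rfl

/-- The bounds of the loops lie in arrays that the command never writes to. Hence a bound keeps its
value during the loop, the number of rounds is known in advance, and the costs can be added up
syntactically. -/
theorem exec {f : Finset (Fin n) → ℝ} {X : Fin 32 → Bool} {c : Prog} (h : c.ok X) {s : Mem n}
    {β : Fin 32 → ℕ} (hβ : ∀ r, X r → s.N r 0 ≤ β r) :
    ∃ t ≤ c.cost β, Exec f c.compile s.toStore (c.den f s).toStore t := by
  induction c generalizing s with
  | skip => exact ⟨1, le_rfl, Exec.of_step fun K => rfl⟩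
  | setN r i v =>
    refine ⟨1, le_rfl, Exec.of_step fun K => ?_⟩
    rw [den, ← toStore_setNat, ← addr_eval]; rfl
  | setR r i v =>
    refine ⟨1, le_rfl, Exec.of_step fun K => ?_⟩
    rw [den, ← toStore_setReal, ← addr_eval]; rfl
  | ins a i =>
    refine ⟨1, le_rfl, Exec.of_step fun K => ?_⟩
    simp only [compile, step, den, NExp.eval, Store.insertAt, SubmodKnapsack.ins]
    split_ifs
    · rfl
    · congr 2
      simp [Mem.toStore, Mem.setS]
  | del a i =>
    refine ⟨1, le_rfl, Exec.of_step fun K => ?_⟩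
    simp only [compile, step, den, NExp.eval, Store.eraseAt, rmv]
    split_ifs
    · rfl
    · congr 2
      simp [Mem.toStore, Mem.setS]
  | query r a =>
    refine ⟨1, le_rfl, Exec.of_step fun K => ?_⟩
    have := addr_eval s.toStore r (.const 0)
    simp only [NExp.eval] at this
    rw [den, ← toStore_setReal, ← this]; rfl
  | seq c d ih1 ih2 =>
    simp only [ok, Bool.and_eq_true] at h
    obtain ⟨t1, h1, e1⟩ := ih1 h.1 hβ
    obtain ⟨t2, h2, e2⟩ := ih2 h.2 (s := c.den f s) fun r hr => by
      rw [den_N (wN_of_ok h.1 hr)]; exact hβ r hr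
    exact ⟨t1 + t2 + 1, by simp only [cost]; omega, e1.seq e2⟩
  | ite b c d ih1 ih2 =>
    simp only [ok, Bool.and_eq_true] at h
    rw [den]
    split_ifs with hb
    · obtain ⟨t1, h1, e1⟩ := ih1 h.1 hβ
      exact ⟨t1 + 1, by simp only [cost]; omega, e1.ite_true hb⟩
    · obtain ⟨t1, h1, e1⟩ := ih2 h.2 hβ
      exact ⟨t1 + 1, by simp only [cost]; omega, e1.ite_false hb⟩
  | rep v b c ih =>
    simp only [ok, Bool.and_eq_true, Bool.not_eq_true'] at h
    obtain ⟨⟨⟨hb, hv⟩, hcv⟩, hc⟩ := h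
    have hX : ∀ r, X r → ∀ j, (iter v (c.den f) s j).N r = s.N r := fun r hr j =>
      iter_N (by rintro rfl; simp [hv] at hr) (fun s => den_N (wN_of_ok hc hr) s) s j
    have hvar : ∀ j, (iter v (c.den f) s j).N v 0 = j := by
      intro j; cases j <;> simp [iter]
    have key : ∀ d j, j + d = s.N b 0 → ∃ t ≤ d * (c.cost β + 3) + 1,
        Exec f (.loop (.natLt (nv v) (nv b))
          (.seq c.compile (.setNat (addr v (.const 0)) (.add (nv v) (.const 1)))))
          (iter v (c.den f) s j).toStore (iter v (c.den f) s (s.N b 0)).toStore t := by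
      intro d
      induction d with
      | zero =>
        intro j hj
        refine ⟨1, by omega, ?_⟩
        rw [← hj, Nat.add_zero]
        refine Exec.loop_false ?_
        simp only [BExp.holds, nv_eval, hvar, hX b hb]
        omega
      | succ d ihd =>
        intro j hj
        obtain ⟨t2, h2, e2⟩ := ihd (j + 1) (by omega)
        obtain ⟨t1, h1, e1⟩ := ih hc (s := iter v (c.den f) s j) fun r hr => by
          rw [hX r hr]; exact hβ r hr
        have e3 : Exec f (.setNat (addr v (.const 0)) (.add (nv v) (.const 1)))
            (c.den f (iter v (c.den f) s j)).toStore (iter v (c.den f) s (j + 1)).toStore 1 := by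
          refine Exec.of_step fun K => ?_
          rw [iter, ← toStore_setNat]
          simp only [step, addr_eval, NExp.eval, nv_eval, den_N hcv, hvar]
        refine ⟨t1 + 1 + 1 + t2 + 1, ?_, Exec.loop_true ?_ (e1.seq e3) e2⟩
        · rw [Nat.succ_mul]; omega
        · simp only [BExp.holds, nv_eval, hvar, hX b hb]
          omega
    obtain ⟨t, h1, e1⟩ := key (s.N b 0) 0 (Nat.zero_add _)
    refine ⟨1 + t + 1, ?_, Exec.seq (σ₁ := (s.setN v 0 0).toStore) (Exec.of_step fun K => ?_) e1⟩
    · have : s.N b 0 * (c.cost β + 3) ≤ β b * (c.cost β + 3) := Nat.mul_le_mul_right _ (hβ b hb)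
      simp only [cost]
      omega
    · rw [← toStore_setNat]
      simp only [step, addr_eval, NExp.eval]

/-- Induction along a loop. -/
lemma rep_induction {f : Finset (Fin n) → ℝ} {v b : Fin 32} {c : Prog} {s : Mem n} {M : ℕ}
    (hM : s.N b 0 = M) (P : ℕ → Mem n → Prop) (h0 : P 0 (s.setN v 0 0))
    (hs : ∀ j < M, ∀ s' : Mem n, s'.N v 0 = j →
      (∀ r, (rep v b c).wN r = false → s'.N r = s.N r) →
      (∀ r, c.wR r = false → s'.R r = s.R r) →
      (∀ a, c.wS a = false → s'.S a = s.S a) → P j s' →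
      P (j + 1) ((c.den f s').setN v 0 (j + 1))) :
    P M ((rep v b c).den f s) := by
  rw [den, hM]
  have hvar : ∀ j, (iter v (c.den f) s j).N v 0 = j := by
    intro j; cases j <;> simp [iter]
  have key : ∀ j ≤ M, P j (iter v (c.den f) s j) := by
    intro j
    induction j with
    | zero => exact fun _ => h0
    | succ j ih =>
      intro hj
      refine hs j (by omega) _ (hvar j) (fun r hr => ?_) (fun r hr => ?_) (fun a ha => ?_)
        (ih (by omega))
      · simp only [wN, Bool.or_eq_false_iff, beq_eq_false_iff_ne] at hr
        exact iter_N hr.1.symm (den_N hr.2) _ _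
      · exact iter_R (den_R hr) _ _
      · exact iter_S (den_S ha) _ _
  exact key M le_rfl

end Prog


/-! ### Counting in mixed radix -/

/-- The `i`-th digit of `x` in mixed radix `ρ`. -/
def digit (ρ : ℕ → ℕ) (x i : ℕ) : ℕ := x / (∏ j ∈ range i, ρ j) % ρ i

lemma digit_zero (ρ : ℕ → ℕ) (i : ℕ) : digit ρ 0 i = 0 := by simp [digit]

/-- The product of the lower radices divides `x + 1` exactly when a carry arrives at digit `i`. This
lemma and the next two treat the cases of no carry, a carry that is absorbed, and a carry that is
passed on. -/
lemma digit_succ_of_not_dvd {ρ : ℕ → ℕ} {x i : ℕ} (h : ¬ (∏ j ∈ range i, ρ j) ∣ x + 1) :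
    digit ρ (x + 1) i = digit ρ x i := by
  rw [digit, digit, Nat.succ_div_of_not_dvd h]

lemma digit_succ_of_lt {ρ : ℕ → ℕ} {x i : ℕ} (h : (∏ j ∈ range i, ρ j) ∣ x + 1)
    (h' : digit ρ x i + 1 < ρ i) :
    digit ρ (x + 1) i = digit ρ x i + 1 ∧ ¬ (∏ j ∈ range (i + 1), ρ j) ∣ x + 1 := by
  have e : digit ρ (x + 1) i = digit ρ x i + 1 := by
    rw [digit] at h' ⊢
    rw [digit, Nat.succ_div_of_dvd h, Nat.add_mod_of_add_mod_lt]
    · rw [Nat.mod_eq_of_lt (a := 1) (by omega)]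
    · rw [Nat.mod_eq_of_lt (a := 1) (by omega)]
      exact h'
  refine ⟨e, fun hd => ?_⟩
  rw [prod_range_succ] at hd
  obtain ⟨q, hq⟩ := hd
  rcases Nat.eq_zero_or_pos (∏ j ∈ range i, ρ j) with h0 | h0
  · rw [h0] at hq; simp at hq
  · rw [digit, hq, mul_assoc, Nat.mul_div_cancel_left _ h0, Nat.mul_mod_right] at e
    omega

lemma digit_succ_of_not_lt {ρ : ℕ → ℕ} {x i : ℕ} (hρ : 0 < ρ i) (h : (∏ j ∈ range i, ρ j) ∣ x + 1)
    (h' : ¬ digit ρ x i + 1 < ρ i) :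
    digit ρ (x + 1) i = 0 ∧ (∏ j ∈ range (i + 1), ρ j) ∣ x + 1 := by
  have hlt : digit ρ x i < ρ i := Nat.mod_lt _ hρ
  have hd : ρ i ∣ (x + 1) / ∏ j ∈ range i, ρ j := by
    rw [Nat.succ_div_of_dvd h]
    apply Nat.dvd_of_mod_eq_zero
    rw [Nat.add_mod]
    rw [digit] at h' hlt
    rw [show x / (∏ j ∈ range i, ρ j) % ρ i = ρ i - 1 by omega]
    rcases Nat.lt_or_ge 1 (ρ i) with h1 | h1
    · rw [Nat.mod_eq_of_lt h1, Nat.sub_add_cancel hρ, Nat.mod_self]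
    · rw [show ρ i = 1 by omega, Nat.mod_one]
  refine ⟨Nat.mod_eq_zero_of_dvd hd, ?_⟩
  rw [prod_range_succ]
  obtain ⟨q, hq⟩ := hd
  exact ⟨q, by rw [mul_assoc, ← hq, Nat.mul_div_cancel' h]⟩

/-- Every vector of digits occurs. -/
lemma exists_digit (ρ d : ℕ → ℕ) (l : ℕ) (h : ∀ i < l, d i < ρ i) :
    ∃ x < ∏ j ∈ range l, ρ j, ∀ i < l, digit ρ x i = d i := by
  induction l with
  | zero => exact ⟨0, by simp, by simp⟩
  | succ l ih =>
    obtain ⟨x, hx, hd⟩ := ih fun i hi => h i (by omega)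
    set q := ∏ j ∈ range l, ρ j with hq
    have h1 := h l (by omega)
    refine ⟨x + q * d l, ?_, fun i hi => ?_⟩
    · rw [prod_range_succ, ← hq]
      calc x + q * d l < q + q * d l := by omega
        _ = q * (d l + 1) := by ring
        _ ≤ q * ρ l := Nat.mul_le_mul_left _ h1
    · rcases Nat.lt_succ_iff_lt_or_eq.1 hi with hi | rfl
      · rw [← hd i hi, digit, digit]
        obtain ⟨r, hr⟩ : (∏ j ∈ range (i + 1), ρ j) ∣ q :=
          prod_dvd_prod_of_subset _ _ _ (by intro a; simp only [mem_range]; omega)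
        have hpos : 0 < ∏ j ∈ range i, ρ j := prod_pos fun j hj => by
          have := h j (by rw [mem_range] at hj; omega)
          omega
        rw [hr, prod_range_succ, mul_assoc, mul_assoc, Nat.add_mul_div_left _ _ hpos,
          Nat.add_mul_mod_self_left]
      · rw [digit, ← hq, Nat.add_mul_div_left _ _ (by omega), Nat.div_eq_of_lt hx, Nat.zero_add,
          Nat.mod_eq_of_lt h1]

/-- Summation over all scenarios, by counting. -/
lemma sum_scenario {m k : ℕ} (F : (ℕ → ℕ) → ℝ)
    (hF : ∀ τ τ' : ℕ → ℕ, (∀ i < k, τ i = τ' i) → F τ = F τ') :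
    ∑ x ∈ range (m ^ k), F (digit (fun _ => m) x) = ∑ τ : Fin k → Fin m, F (scenario τ) := by
  rw [sum_range]
  refine Fintype.sum_equiv finFunctionFinEquiv.symm _ _ fun x => hF _ _ fun i hi => ?_
  rw [scenario_of_lt _ hi]
  simp [digit, finFunctionFinEquiv]

namespace Prog

/-- `1` is added to the counter whose digits, multiplied by `st`, are in the array `A`. -/
def odo (A b : Fin 32) (st : NExp) (lim : NExp) : Prog :=
  setN 14 (.const 0) (.const 1) ;;
  rep 21 b (ite (.natLt (.const 0) (nv 14))
    (ite (.natLt (.add (na A (nv 21)) st) lim)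
      (setN A (nv 21) (.add (na A (nv 21)) st) ;; setN 14 (.const 0) (.const 0))
      (setN A (nv 21) (.const 0))) skip)

/-- The flag in cell `14` records whether a carry is pending, that is, whether the product of the
radices treated so far divides `x + 1`. -/
lemma odo_spec {f : Finset (Fin n) → ℝ} {A b : Fin 32} {st lim : NExp} {s : Mem n} {l q x : ℕ}
    {ρ : ℕ → ℕ} (hA : A ≠ 14 ∧ A ≠ 21) (hb : b ≠ 14 ∧ b ≠ 21 ∧ b ≠ A) (hl : s.N b 0 = l)
    (hq : 0 < q) (hρ : ∀ i < l, 0 < ρ i)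
    (hst : ∀ s' : Mem n, (∀ r, r ≠ 14 → r ≠ 21 → r ≠ A → s'.N r = s.N r) → st.eval s'.toStore = q)
    (hlim : ∀ s' : Mem n, (∀ r, r ≠ 14 → r ≠ 21 → r ≠ A → s'.N r = s.N r) → s'.N 21 0 < l →
      lim.eval s'.toStore = q * ρ (s'.N 21 0))
    (hx : ∀ i < l, s.N A i = q * digit ρ x i) :
    ∀ i < l, ((odo A b st lim).den f s).N A i = q * digit ρ (x + 1) i := by
  set s₁ := s.setN 14 0 1 with hs₁
  have main := rep_induction (f := f) (s := s₁) (v := 21) (b := b)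
    (c := ite (.natLt (.const 0) (nv 14))
    (ite (.natLt (.add (na A (nv 21)) st) lim)
      (setN A (nv 21) (.add (na A (nv 21)) st) ;; setN 14 (.const 0) (.const 0))
      (setN A (nv 21) (.const 0))) skip) (M := l) (by rw [hs₁]; simp [hb.1, hl])
    (fun j s' => (∀ i < j, s'.N A i = q * digit ρ (x + 1) i) ∧
      (∀ i < l, j ≤ i → s'.N A i = q * digit ρ x i) ∧
      ((s'.N 14 0 = 1 ∧ (∏ i ∈ range j, ρ i) ∣ x + 1) ∨
        (s'.N 14 0 = 0 ∧ ¬ (∏ i ∈ range j, ρ i) ∣ x + 1))) ?_ ?_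
  · intro i hi
    exact main.1 i hi
  · refine ⟨by simp, ?_, Or.inl ?_⟩
    · intro i hi _
      simp [hs₁, hA, hx i hi]
    · simp [hs₁]
  · intro j hj s' hj' hN hR hS ⟨h1, h2, h3⟩
    have hfr : ∀ r, r ≠ 14 → r ≠ 21 → r ≠ A → s'.N r = s.N r := by
      intro r r1 r2 r3
      rw [hN r (by simp [wN, r1.symm, r2.symm, r3.symm]), hs₁, Mem.setN_N_ne _ _ _ _ _ r1]
    have e1 := hst s' hfr
    have e2 := hlim s' hfr (by omega)
    have e3 := h2 j hj le_rfl
    rw [hj'] at e2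
    have hA' := hA.1.symm
    have h14 : (14 : Fin 32) ≠ 21 := by decide
    rcases h3 with ⟨h3, h4⟩ | ⟨h3, h4⟩
    · have hc : s'.N A j + q < q * ρ j ↔ digit ρ x j + 1 < ρ j := by
        rw [e3, ← Nat.mul_succ]; exact Nat.mul_lt_mul_left hq
      by_cases hlt : digit ρ x j + 1 < ρ j
      · obtain ⟨d1, d2⟩ := digit_succ_of_lt h4 hlt
        have e4 := hc.2 hlt
        simp only [den, BExp.holds.eq_1, NExp.eval, nv_eval, na_eval, h3, hj', e1, e2, e4, if_true,
          zero_lt_one]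
        refine ⟨?_, ?_, Or.inr ⟨?_, d2⟩⟩
        · intro i hi
          simp only [ne_eq, hA.1, hA.2, not_false_eq_true, Mem.setN_N_ne, Mem.setN_N_self]
          rcases Nat.lt_succ_iff_lt_or_eq.1 hi with hi | rfl
          · rw [Function.update_of_ne hi.ne, h1 i hi]
          · rw [Function.update_self, e3, d1, Nat.mul_succ]
        · intro i hi hji
          simp only [ne_eq, hA.1, hA.2, not_false_eq_true, Mem.setN_N_ne, Mem.setN_N_self]
          rw [Function.update_of_ne (by omega), h2 i hi (by omega)]
        · rw [Mem.setN_N_ne _ _ _ _ _ h14]; simp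
      · obtain ⟨d1, d2⟩ := digit_succ_of_not_lt (hρ j hj) h4 hlt
        have e4 := (not_congr hc).2 hlt
        simp only [den, BExp.holds.eq_1, NExp.eval, nv_eval, na_eval, h3, hj', e1, e2, e4, if_true,
          zero_lt_one, if_false]
        refine ⟨?_, ?_, Or.inl ⟨?_, d2⟩⟩
        · intro i hi
          simp only [ne_eq, hA.2, not_false_eq_true, Mem.setN_N_ne, Mem.setN_N_self]
          rcases Nat.lt_succ_iff_lt_or_eq.1 hi with hi | rfl
          · rw [Function.update_of_ne hi.ne, h1 i hi]
          · rw [Function.update_self, d1, Nat.mul_zero]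
        · intro i hi hji
          simp only [ne_eq, hA.2, not_false_eq_true, Mem.setN_N_ne, Mem.setN_N_self]
          rw [Function.update_of_ne (by omega), h2 i hi (by omega)]
        · rw [Mem.setN_N_ne _ _ _ _ _ h14, Mem.setN_N_ne _ _ _ _ _ hA', h3]
    · simp only [den, BExp.holds.eq_1, NExp.eval, nv_eval, h3, lt_irrefl, if_false]
      refine ⟨?_, ?_, Or.inr ⟨?_, ?_⟩⟩
      · intro i hi
        rw [Mem.setN_N_ne _ _ _ _ _ hA.2]
        rcases Nat.lt_succ_iff_lt_or_eq.1 hi with hi | rfl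
        · exact h1 i hi
        · rw [e3, digit_succ_of_not_dvd h4]
      · intro i hi hji
        rw [Mem.setN_N_ne _ _ _ _ _ hA.2]
        exact h2 i hi (by omega)
      · rw [Mem.setN_N_ne _ _ _ _ _ h14, h3]
      · rw [prod_range_succ]
        exact fun h => h4 (dvd_trans (Dvd.intro _ rfl) h)

/-- Copies the set `a` to the set `b`. -/
def copySet (a b : ℕ) : Prog :=
  rep 26 0 (ite (.mem (nv 26) (.const a)) (ins b (nv 26)) (del b (nv 26)))

open scoped Classical in
lemma copySet_S {f : Finset (Fin n) → ℝ} {s : Mem n} {a b : ℕ} (hn : s.N 0 0 = n) (hab : a ≠ b) :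
    ((copySet a b).den f s).S b = s.S a := by
  have main := rep_induction (f := f) (s := s) (v := 26) (b := 0)
    (c := ite (.mem (nv 26) (.const a)) (ins b (nv 26)) (del b (nv 26))) hn
    (fun j s' => ∀ e : Fin n, e < j → (e ∈ s'.S b ↔ e ∈ s.S a)) (by simp) ?_
  · ext e
    exact main e e.2
  · intro j hj s' hj' hN hR hS h e he
    have hSa : s'.S a = s.S a := hS a (by simp [wS, hab.symm])
    rw [den]
    simp only [mem_holds, nv_eval, hj', hSa]
    have hidx : HasIdx (s.S a) j ↔ (⟨j, hj⟩ : Fin n) ∈ s.S a := hasIdx_val (s.S a) ⟨j, hj⟩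
    split_ifs with hm
    · simp only [den, nv_eval, hj', Mem.setN_S, Mem.setS_S_self, mem_ins]
      rcases Nat.lt_succ_iff_lt_or_eq.1 he with he | he
      · rw [h e he]
        exact or_iff_left (by omega)
      · have : e = ⟨j, hj⟩ := Fin.ext he
        rw [this]
        exact iff_of_true (Or.inr rfl) (hidx.1 hm)
    · simp only [den, nv_eval, hj', Mem.setN_S, Mem.setS_S_self, rmv, hj, dif_pos, mem_erase]
      rcases Nat.lt_succ_iff_lt_or_eq.1 he with he | he
      · rw [h e he]
        exact and_iff_right (fun h' => by rw [h'] at he; exact lt_irrefl _ he)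
      · have : e = ⟨j, hj⟩ := Fin.ext he
        rw [this]
        exact iff_of_false (by simp) (fun h' => hm (hidx.2 h'))

end Prog


/-! ### Programs for sums, picks and the average gain -/

lemma weight_eq_sum_range (w : Fin n → ℝ) (A : Finset (Fin n)) [∀ j, Decidable (HasIdx A j)] :
    weight w A = ∑ j ∈ range n, if HasIdx A j then natExt w j else 0 := by
  rw [sum_range, weight, ← sum_filter]
  simp only [hasIdx_val, natExt_val]
  congr 1
  ext e
  simp

lemma pickUpTo_congr {k : ℕ} {pk τ τ' : ℕ → ℕ} {S : Finset (Fin n)} {j : ℕ}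
    (h : ∀ i < j, τ i = τ' i) : pickUpTo k pk τ S j = pickUpTo k pk τ' S j := by
  induction j with
  | zero => rfl
  | succ j ih => rw [pickUpTo, pickUpTo, ih fun i hi => h i (by omega), h j (by omega)]

namespace Prog
variable {f : Finset (Fin n) → ℝ}

lemma den_seq (c d : Prog) (s : Mem n) : (c ;; d).den f s = d.den f (c.den f s) := rfl

/-- The sum of the array `r` over the set `a`. -/
def sumSet (q r : Fin 32) (a : ℕ) : Prog :=
  setR q (.const 0) (.ofNat (.const 0)) ;;
  rep 20 0 (ite (.mem (nv 20) (.const a)) (setR q (.const 0) (.add (rv q) (ra r (nv 20)))) skip)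

open scoped Classical in
lemma sumSet_spec {s : Mem n} {q r : Fin 32} {a : ℕ} {w : Fin n → ℝ} (hn : s.N 0 0 = n)
    (hr : s.R r = natExt w) (hqr : r ≠ q) :
    ((sumSet q r a).den f s).R q 0 = weight w (s.S a) := by
  set s₁ := s.setR q 0 0 with hs₁
  have main := rep_induction (f := f) (s := s₁) (v := 20) (b := 0)
    (c := ite (.mem (nv 20) (.const a)) (setR q (.const 0) (.add (rv q) (ra r (nv 20)))) skip) hn
    (fun j s' => s'.R q 0 = ∑ i ∈ range j, if HasIdx (s.S a) i then natExt w i else 0)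
    (by simp [hs₁]) ?_
  · rw [weight_eq_sum_range, ← main]
    simp only [sumSet, den_seq]
    congr 2
    simp [den, hs₁]
  · intro j hj s' hj' hN hR hS h
    have hSa : s'.S a = s.S a := hS a rfl
    have hRr : s'.R r = natExt w := by
      rw [hR r (by simp [wR, hqr.symm]), hs₁, Mem.setR_R_ne _ _ _ _ _ hqr, hr]
    rw [sum_range_succ, ← h, den]
    simp only [mem_holds, nv_eval, hj', hSa]
    split_ifs with hm
    · simp [den, hRr, hj']
    · simp [den]

/-- Inserts the elements that the array `13` selects among the picks. -/
def insPicks (a : ℕ) : Prog := rep 20 2 (ins a (na 12 (.add (nv 20) (na 13 (nv 20)))))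

/-- The array `13` stores `k * τ i` instead of `τ i`, as natural-number expressions have no
multiplication; the index of a pick is then a sum. -/
lemma insPicks_spec {s : Mem n} {a k : ℕ} {τ : ℕ → ℕ} (hk : s.N 2 0 = k)
    (hτ : ∀ i < k, s.N 13 i = k * τ i) :
    ((insPicks a).den f s).S a = pickSet k (s.N 12) τ (s.S a) := by
  refine rep_induction (f := f) (s := s) (v := 20) (b := 2)
    (c := ins a (na 12 (.add (nv 20) (na 13 (nv 20))))) hk
    (fun j s' => s'.S a = pickUpTo k (s.N 12) τ (s.S a) j) rfl ?_
  intro j hj s' hj' hN hR hS h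
  have h12 : s'.N 12 = s.N 12 := hN 12 rfl
  have h13 : s'.N 13 = s.N 13 := hN 13 rfl
  simp [den, pickUpTo, hj', h, h12, h13, hτ j hj]

/-- The average gain of the set `3`, in the real cell `3`. -/
def evalG : Prog :=
  setR 2 (.const 0) (.ofNat (.const 0)) ;;
  rep 20 2 (setN 13 (nv 20) (.const 0)) ;;
  rep 19 7 (
    copySet 3 2 ;;
    insPicks 2 ;;
    query 1 2 ;;
    sumSet 9 30 2 ;;
    setR 2 (.const 0) (.add (rv 2) (.sub (rv 1) (rv 9))) ;;
    odo 13 2 (nv 2) (nv 3)) ;;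
  setR 3 (.const 0) (.div (rv 2) (.ofNat (nv 7)))

end Prog

/-- The memory contains the data of the instance. -/
structure Env (I : Inst n) (J : ℕ) (d : ℝ) (s : Mem n) : Prop where
  n_eq : s.N 0 0 = n
  m_eq : s.N 1 0 = I.m
  k_eq : s.N 2 0 = I.k
  P_eq : s.N 3 0 = I.k * I.m
  J_eq : s.N 4 0 = J
  mk_eq : s.N 7 0 = I.m ^ I.k
  w_eq : s.R 31 = natExt I.w
  l_eq : s.R 30 = natExt (lin I.f)
  d_eq : s.R 17 0 = d

/-- The command does not change the data of the instance. -/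
def Prog.safe (c : Prog) : Bool :=
  !(c.wN 0 || c.wN 1 || c.wN 2 || c.wN 3 || c.wN 4 || c.wN 7 || c.wR 31 || c.wR 30 || c.wR 17)

namespace Env
variable {I : Inst n} {J : ℕ} {d : ℝ} {s s' : Mem n}

lemma of_frame {c : Prog} (h : Env I J d s) (hc : c.safe)
    (hN : ∀ r, c.wN r = false → s'.N r = s.N r) (hR : ∀ r, c.wR r = false → s'.R r = s.R r) :
    Env I J d s' := by
  simp only [Prog.safe, Bool.not_eq_true', Bool.or_eq_false_iff] at hc
  obtain ⟨⟨⟨⟨⟨⟨⟨⟨h0, h1⟩, h2⟩, h3⟩, h4⟩, h7⟩, h31⟩, h30⟩, h17⟩ := hc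
  constructor
  · rw [hN _ h0, h.n_eq]
  · rw [hN _ h1, h.m_eq]
  · rw [hN _ h2, h.k_eq]
  · rw [hN _ h3, h.P_eq]
  · rw [hN _ h4, h.J_eq]
  · rw [hN _ h7, h.mk_eq]
  · rw [hR _ h31, h.w_eq]
  · rw [hR _ h30, h.l_eq]
  · rw [hR _ h17, h.d_eq]

lemma den {f : Finset (Fin n) → ℝ} {c : Prog} (h : Env I J d s) (hc : c.safe) :
    Env I J d (c.den f s) :=
  h.of_frame hc (fun _ hr => Prog.den_N hr s) fun _ hr => Prog.den_R hr s

end Env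

namespace Prog

/-- The counter in the array `13` runs through all `m ^ k` scenarios, and the set `2` holds the pick
set of the current one. Its stride is `k`, so the limit of every digit is the cell `k * m`. -/
lemma evalG_spec {I : Inst n} {J : ℕ} {d : ℝ} {s : Mem n} (h : Env I J d s) (hm : 0 < I.m)
    (hk : 0 < I.k) : (evalG.den I.f s).R 3 0 = I.G (s.N 12) (s.S 3) := by
  rw [evalG, den_seq, den_seq, den_seq]
  set s₁ := (setR 2 (.const 0) (.ofNat (.const 0))).den I.f s with hs₁
  set s₂ := (rep 20 2 (setN 13 (nv 20) (.const 0))).den I.f s₁ with hs₂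
  have e₁ : Env I J d s₁ := h.den rfl
  have e₂ : Env I J d s₂ := e₁.den rfl
  have a1 : s₁.R 2 0 = 0 := by simp [hs₁, den]
  have a2 : ∀ i < I.k, s₂.N 13 i = 0 := by
    refine rep_induction (f := I.f) (s := s₁) (v := 20) (b := 2)
      (c := setN 13 (nv 20) (.const 0)) e₁.k_eq (fun j s' => ∀ i < j, s'.N 13 i = 0) (by simp) ?_
    intro j hj s' hj' hN hR hS h i hi
    rcases Nat.lt_succ_iff_lt_or_eq.1 hi with hi | rfl
    · simp [den, hj', hi.ne, h i hi]
    · simp [den, hj']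
  have b2 : s₂.R 2 0 = 0 := by rw [hs₂, den_R rfl, a1]
  have b12 : s₂.N 12 = s.N 12 := by rw [hs₂, den_N rfl, hs₁, den_N rfl]
  have bS : s₂.S 3 = s.S 3 := by rw [hs₂, den_S rfl, hs₁, den_S rfl]
  set ρ : ℕ → ℕ := fun _ => I.m
  let F : (ℕ → ℕ) → ℝ := fun τ => curved I.f (pickSet I.k (s.N 12) τ (s.S 3))
  set body := copySet 3 2 ;; insPicks 2 ;; query 1 2 ;; sumSet 9 30 2 ;;
    setR 2 (.const 0) (.add (rv 2) (.sub (rv 1) (rv 9))) ;; odo 13 2 (nv 2) (nv 3) with hbody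
  have main := rep_induction (f := I.f) (s := s₂) (v := 19) (b := 7) (c := body) e₂.mk_eq
    (fun x s' => (∀ i < I.k, s'.N 13 i = I.k * digit ρ x i) ∧
      s'.R 2 0 = ∑ y ∈ range x, F (digit ρ y)) ?_ ?_
  · set s₃ := (rep 19 7 body).den I.f s₂ with hs₃
    have e₃ : Env I J d s₃ := e₂.den rfl
    simp only [den, Mem.setR_R_self, NExp.eval, Function.update_self, RExp.eval.eq_6, rv_eval,
      RExp.eval.eq_1, nv_eval, e₃.mk_eq, main.2]
    rw [sum_scenario F, Inst.G, avg, Nat.cast_pow]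
    intro τ τ' hτ
    simp only [F, pickSet, pickUpTo_congr hτ]
  · simp [digit_zero, b2]
    intro i hi
    exact a2 i hi
  · intro x hx s' hx' hN hR hS ⟨h1, h2⟩
    have e' : Env I J d s' := by
      refine e₂.of_frame (c := rep 19 7 body) rfl hN hR
    have c12 : s'.N 12 = s.N 12 := by rw [hN 12 rfl, b12]
    have cS : s'.S 3 = s.S 3 := by rw [hS 3 rfl, bS]
    rw [hbody, den_seq, den_seq, den_seq, den_seq, den_seq]
    set u₁ := (copySet 3 2).den I.f s' with hu₁
    set u₂ := (insPicks 2).den I.f u₁ with hu₂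
    set u₃ := (query 1 2).den I.f u₂ with hu₃
    set u₄ := (sumSet 9 30 2).den I.f u₃ with hu₄
    set u₅ := (setR 2 (.const 0) (.add (rv 2) (.sub (rv 1) (rv 9)))).den I.f u₄ with hu₅
    have f₁ : Env I J d u₁ := e'.den rfl
    have f₂ : Env I J d u₂ := f₁.den rfl
    have f₃ : Env I J d u₃ := f₂.den rfl
    have f₄ : Env I J d u₄ := f₃.den rfl
    have f₅ : Env I J d u₅ := f₄.den rfl
    have v1 : u₁.S 2 = s.S 3 := by rw [hu₁, copySet_S e'.n_eq (by decide), cS]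
    have v1' : ∀ i < I.k, u₁.N 13 i = I.k * digit ρ x i := by
      rw [hu₁, den_N rfl]; exact h1
    have v2 : u₂.S 2 = pickSet I.k (s.N 12) (digit ρ x) (s.S 3) := by
      rw [hu₂, insPicks_spec f₁.k_eq v1', v1]
      congr 1
      rw [hu₁, den_N rfl, c12]
    have v3 : u₃.R 1 0 = I.f (u₂.S 2) := by simp [hu₃, den]
    have v3' : u₃.S 2 = u₂.S 2 := den_S rfl _
    have v4 : u₄.R 9 0 = weight (lin I.f) (u₂.S 2) := by
      rw [hu₄, sumSet_spec f₃.n_eq f₃.l_eq (by decide), v3']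
    have v4' : u₄.R 1 0 = I.f (u₂.S 2) := by rw [hu₄, den_R rfl, v3]
    have v4'' : u₄.R 2 0 = s'.R 2 0 := by
      rw [hu₄, den_R rfl, hu₃, den_R rfl, hu₂, den_R rfl, hu₁, den_R rfl]
    have v5 : u₅.R 2 0 = s'.R 2 0 + F (digit ρ x) := by
      simp only [hu₅, den, Mem.setR_R_self, NExp.eval, Function.update_self, RExp.eval.eq_3,
        RExp.eval.eq_4, rv_eval, v4, v4', v4'', F, curved, v2]
    have v5' : ∀ i < I.k, u₅.N 13 i = I.k * digit ρ x i := by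
      rw [hu₅, den_N rfl, hu₄, den_N rfl, hu₃, den_N rfl, hu₂, den_N rfl]; exact v1'
    constructor
    · rw [Mem.setN_N_ne _ _ _ _ _ (by decide)]
      refine odo_spec (by decide) (by decide) f₅.k_eq hk (fun _ _ => hm) ?_ ?_ v5'
      · intro t ht
        rw [nv_eval, ht 2 (by decide) (by decide) (by decide), f₅.k_eq]
      · intro t ht _
        rw [nv_eval, ht 3 (by decide) (by decide) (by decide), f₅.P_eq]
    · rw [Mem.setN_R, den_R rfl, v5, h2, sum_range_succ]

end Prog


/-! ### Programs that search for a best element; the slots -/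

lemma argBest_cand {N : ℕ} {cand : ℕ → Prop} {better : ℕ → ℕ → Prop} {j : ℕ} :
    argBest N cand better j = N ∨ (argBest N cand better j < j ∧ cand (argBest N cand better j)) := by
  induction j with
  | zero => exact Or.inl rfl
  | succ j ih =>
    rw [argBest]
    split_ifs with h
    · exact Or.inr ⟨Nat.lt_succ_self j, h.1⟩
    · exact ih.imp_right fun h' => ⟨by omega, h'.2⟩

namespace Prog
variable {f : Finset (Fin n) → ℝ}

/-- The search for a best element, in the cell `22`; the loop variable is the cell `18`. -/
def scan (pre : Prog) (cand better : BExp) : Prog :=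
  setN 22 (.const 0) (nv 0) ;;
  rep 18 0 (pre ;; ite (.and cand (.not (.and (.natLt (nv 22) (nv 0)) (.not better))))
    (setN 22 (.const 0) (nv 18)) skip)

open scoped Classical in
lemma scan_spec {s : Mem n} {pre : Prog} {cand better : BExp} (C : ℕ → Prop) (Bt : ℕ → ℕ → Prop)
    (Inv : ℕ → (ℕ → ℕ) → (ℕ → ℝ) → Prop) (hn : s.N 0 0 = n)
    (hpre : pre.wN 0 = false ∧ pre.wN 18 = false ∧ pre.wN 22 = false)
    (hInv : Inv 0 (s.N 12) (s.R 29))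
    (hs : ∀ j < n, ∀ s' : Mem n, s'.N 18 0 = j →
      (∀ r, (scan pre cand better).wN r = false → s'.N r = s.N r) →
      (∀ r, pre.wR r = false → s'.R r = s.R r) → (∀ a, pre.wS a = false → s'.S a = s.S a) →
      Inv j (s'.N 12) (s'.R 29) →
      Inv (j + 1) ((pre.den f s').N 12) ((pre.den f s').R 29) ∧
      (cand.holds (pre.den f s').toStore ↔ C j) ∧
      (C j → ∀ r < j, C r → (pre.den f s').N 22 0 = r →
        (better.holds (pre.den f s').toStore ↔ Bt j r))) :
    ((scan pre cand better).den f s).N 22 0 = argBest n C Bt n ∧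
      Inv n (((scan pre cand better).den f s).N 12) (((scan pre cand better).den f s).R 29) := by
  set s₁ := s.setN 22 0 n with hs₁
  set body := pre ;; ite (.and cand (.not (.and (.natLt (nv 22) (nv 0)) (.not better))))
    (setN 22 (.const 0) (nv 18)) skip with hbody
  have hden : (scan pre cand better).den f s = (rep 18 0 body).den f s₁ := by
    simp only [scan, den_seq, ← hbody]
    congr 1
    simp only [den, NExp.eval, nv_eval, hn, hs₁]
  rw [hden]
  have main := rep_induction (f := f) (s := s₁) (v := 18) (b := 0) (c := body)
    (M := n) (by rw [hs₁, Mem.setN_N_ne _ _ _ _ _ (by decide), hn])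
    (fun j s' => s'.N 22 0 = argBest n C Bt j ∧ Inv j (s'.N 12) (s'.R 29)) ?_ ?_
  · exact main
  · refine ⟨?_, ?_⟩
    · rw [Mem.setN_N_ne _ _ _ _ _ (by decide)]; simp [hs₁, argBest]
    · rw [Mem.setN_N_ne _ _ _ _ _ (by decide), hs₁, Mem.setN_N_ne _ _ _ _ _ (by decide)]
      exact hInv
  · rintro j hj s' hj' hN hR hS ⟨h1, h2⟩
    have hN' : ∀ r, (scan pre cand better).wN r = false → s'.N r = s.N r := by
      intro r hr
      simp only [scan, wN, Bool.or_eq_false_iff, Bool.or_false] at hr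
      rw [hN r (by simp [hbody, wN, hr.2]), hs₁, Mem.setN_N_ne]
      rintro rfl
      simp at hr
    obtain ⟨i1, i2, i3⟩ := hs j hj s' hj' hN'
      (fun r hr => hR r (by simp [hbody, wR, hr]))
      (fun a ha => hS a (by simp [hbody, wS, ha])) h2
    rw [hbody, den_seq]
    set u := pre.den f s' with hu
    have u22 : u.N 22 0 = argBest n C Bt j := by rw [hu, den_N hpre.2.2, h1]
    have u0 : u.N 0 0 = n := by
      rw [hu, den_N hpre.1, hN 0 (by simp [hbody, wN, hpre.1]), hs₁,
        Mem.setN_N_ne _ _ _ _ _ (by decide), hn]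
    have u18 : u.N 18 0 = j := by rw [hu, den_N hpre.2.1, hj']
    have hcond : (BExp.and cand (.not (.and (.natLt (nv 22) (nv 0)) (.not better)))).holds
        u.toStore ↔ C j ∧ (¬ argBest n C Bt j < n ∨ Bt j (argBest n C Bt j)) := by
      simp only [BExp.holds.eq_5, BExp.holds.eq_4, BExp.holds.eq_1, nv_eval, u22, u0, i2, not_and,
        not_not]
      refine and_congr_right fun hC => ?_
      -- As long as there is no candidate, cell `22` holds `n` and the value of `better` is
      -- irrelevant. So `better` has to be correct only for two true candidates.
      rcases argBest_cand (N := n) (cand := C) (better := Bt) (j := j) with h | ⟨h, h'⟩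
      · simp [h]
      · rw [i3 hC _ h h' u22]
        tauto
    rw [argBest, den]
    simp only [hcond]
    rw [Mem.setN_N_ne _ _ _ _ _ (by decide), Mem.setN_N_ne _ _ _ _ _ (by decide), Mem.setN_R]
    split_ifs
    · rw [den]
      refine ⟨by simp [u18], ?_⟩
      rw [Mem.setN_N_ne _ _ _ _ _ (by decide), Mem.setN_R]
      exact i1
    · exact ⟨u22, i1⟩

/-- The test whether the element `e` belongs to the class `c`. -/
def inClass (e c : NExp) : BExp :=
  .and (.realLt (rv 5) (ra 31 e)) (.and (.not (.realLt (ra 30 e) (.mul (.ofNat c) (rv 7))))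
    (.realLt (ra 30 e) (.mul (.ofNat (.add c (.const 1))) (rv 7))))

variable {I : Inst n} {J : ℕ} {d : ℝ}

lemma inClass_holds {s : Mem n} (h : Env I J d s) (e c : NExp) :
    (inClass e c).holds s.toStore ↔
      I.InClass (s.R 5 0) (s.R 7 0) (c.eval s.toStore) (e.eval s.toStore) := by
  simp only [inClass, BExp.holds.eq_5, BExp.holds.eq_4, BExp.holds.eq_2, rv_eval, ra_eval, h.w_eq,
    h.l_eq, RExp.eval.eq_5, RExp.eval.eq_1, NExp.eval, Inst.InClass, Nat.cast_add, Nat.cast_one]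

/-- The pick of one slot; the index of the pick is in the cell `23`. -/
def slotProg : Prog :=
  copySet 1 3 ;; evalG ;; setR 4 (.const 0) (rv 3) ;;
  scan (setN 12 (nv 23) (nv 18) ;; evalG)
    (.and (inClass (nv 18) (na 10 (.add (.const 3) (nv 23))))
      (.not (.realLt (.sub (rv 3) (rv 4))
        (.mul (.ofNat (na 10 (.add (.add (.const 3) (nv 3)) (nv 23)))) (rv 7)))))
    (.realLt (ra 31 (nv 18)) (ra 31 (nv 22))) ;;
  setN 12 (nv 23) (nv 22)

lemma slotProg_spec {s : Mem n} (h : Env I J d s) (hm : 0 < I.m) (hk : 0 < I.k) {p : ℕ}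
    (hp : s.N 23 0 = p) :
    (slotProg.den I.f s).N 12 = Function.update (s.N 12) p
      (I.slotPick (s.R 5 0) (s.R 7 0) (s.N 10 (3 + p)) (s.N 10 (3 + I.k * I.m + p)) p (s.N 12)
        (s.S 1)) := by
  rw [slotProg, den_seq, den_seq, den_seq, den_seq]
  set u₁ := (copySet 1 3).den I.f s with hu₁
  set u₂ := evalG.den I.f u₁ with hu₂
  set u₃ := (setR 4 (.const 0) (rv 3)).den I.f u₂ with hu₃
  have f₁ : Env I J d u₁ := h.den rfl
  have f₂ : Env I J d u₂ := f₁.den rfl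
  have f₃ : Env I J d u₃ := f₂.den rfl
  have a1 : u₁.S 3 = s.S 1 := copySet_S h.n_eq (by decide)
  have a1' : u₁.N 12 = s.N 12 := den_N rfl _
  have a2 : u₂.R 3 0 = I.G (s.N 12) (s.S 1) := by rw [hu₂, evalG_spec f₁ hm hk, a1, a1']
  have a2' : u₂.N 12 = s.N 12 := by rw [hu₂, den_N rfl, a1']
  have a3 : u₃.R 4 0 = I.G (s.N 12) (s.S 1) := by simp [hu₃, den, a2]
  have a3' : u₃.N 12 = s.N 12 := by rw [hu₃, den_N rfl, a2']
  have a3S : u₃.S 3 = s.S 1 := by rw [hu₃, den_S rfl, hu₂, den_S rfl, a1]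
  have a23 : u₃.N 23 = s.N 23 := by rw [hu₃, den_N rfl, hu₂, den_N rfl, hu₁, den_N rfl]
  have a10 : u₃.N 10 = s.N 10 := by rw [hu₃, den_N rfl, hu₂, den_N rfl, hu₁, den_N rfl]
  have a5 : u₃.R 5 = s.R 5 := by rw [hu₃, den_R rfl, hu₂, den_R rfl, hu₁, den_R rfl]
  have a7 : u₃.R 7 = s.R 7 := by rw [hu₃, den_R rfl, hu₂, den_R rfl, hu₁, den_R rfl]
  set cand := BExp.and (inClass (nv 18) (na 10 (.add (.const 3) (nv 23))))
      (.not (.realLt (.sub (rv 3) (rv 4))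
        (.mul (.ofNat (na 10 (.add (.add (.const 3) (nv 3)) (nv 23)))) (rv 7)))) with hcand
  set better := BExp.realLt (ra 31 (nv 18)) (ra 31 (nv 22)) with hbetter
  -- Each trial overwrites the pick in cell `p`, so the invariant only says that the other picks are
  -- unchanged. The best trial is written back after the search.
  have main := scan_spec (f := I.f) (s := u₃) (pre := setN 12 (nv 23) (nv 18) ;; evalG)
    (cand := cand) (better := better)
    (fun e => I.InClass (s.R 5 0) (s.R 7 0) (s.N 10 (3 + p)) e ∧
      ¬ I.G (Function.update (s.N 12) p e) (s.S 1) - I.G (s.N 12) (s.S 1) <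
        (s.N 10 (3 + I.k * I.m + p) : ℕ) * s.R 7 0)
    (fun e b => natExt I.w e < natExt I.w b) (fun _ N _ => ∀ q, q ≠ p → N q = s.N 12 q)
    f₃.n_eq ⟨rfl, rfl, rfl⟩ (fun q _ => by rw [a3']) ?_
  · obtain ⟨m1, m2⟩ := main
    have m3 : ((scan (setN 12 (nv 23) (nv 18) ;; evalG) cand better).den I.f u₃).N 23 0 = p := by
      rw [den_N rfl, a23, hp]
    rw [den, Mem.setN_N_self, nv_eval, nv_eval, m1, m3]
    funext q
    by_cases hq : q = p
    · subst hq
      rw [Function.update_self, Function.update_self]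
      rfl
    · rw [Function.update_of_ne hq, Function.update_of_ne hq, m2 q hq]
  · intro j hj s' hj' hN hR hS hInv
    rw [den_seq]
    set t₁ := (setN 12 (nv 23) (nv 18)).den I.f s' with ht₁
    set t₂ := evalG.den I.f t₁ with ht₂
    have g' : Env I J d s' := by
      refine f₃.of_frame (c := scan (setN 12 (nv 23) (nv 18) ;; evalG) cand better) rfl hN ?_
      intro r hr
      refine hR r ?_
      simpa [scan, wR] using hr
    have g₁ : Env I J d t₁ := g'.den rfl
    have g₂ : Env I J d t₂ := g₁.den rfl
    have c23 : s'.N 23 0 = p := by rw [hN 23 rfl, a23, hp]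
    have b12 : t₁.N 12 = Function.update (s.N 12) p j := by
      simp only [ht₁, den, Mem.setN_N_self, nv_eval, hj', c23]
      funext q
      by_cases hq : q = p
      · subst hq; simp
      · rw [Function.update_of_ne hq, Function.update_of_ne hq, hInv q hq]
    have bS : t₁.S 3 = s.S 1 := by rw [ht₁, den_S rfl, hS 3 rfl, a3S]
    have c3 : t₂.R 3 0 = I.G (Function.update (s.N 12) p j) (s.S 1) := by
      rw [ht₂, evalG_spec g₁ hm hk, b12, bS]
    have c4 : t₂.R 4 0 = I.G (s.N 12) (s.S 1) := by
      rw [ht₂, den_R rfl, ht₁, den_R rfl, hR 4 rfl, a3]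
    have c5 : t₂.R 5 0 = s.R 5 0 := by
      rw [ht₂, den_R rfl, ht₁, den_R rfl, hR 5 rfl, a5]
    have c7 : t₂.R 7 0 = s.R 7 0 := by
      rw [ht₂, den_R rfl, ht₁, den_R rfl, hR 7 rfl, a7]
    have c10 : t₂.N 10 = s.N 10 := by rw [ht₂, den_N rfl, ht₁, den_N rfl, hN 10 rfl, a10]
    have c18 : t₂.N 18 0 = j := by rw [ht₂, den_N rfl, ht₁, den_N rfl, hj']
    have c23' : t₂.N 23 0 = p := by rw [ht₂, den_N rfl, ht₁, den_N rfl, c23]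
    have c12 : t₂.N 12 = Function.update (s.N 12) p j := by rw [ht₂, den_N rfl, b12]
    refine ⟨fun q hq => ?_, ?_, fun _ r _ _ hr => ?_⟩
    · rw [c12, Function.update_of_ne hq]
    · simp only [hcand, BExp.holds.eq_5, BExp.holds.eq_4, BExp.holds.eq_2, inClass_holds g₂,
        na_eval, NExp.eval, nv_eval, RExp.eval.eq_4, RExp.eval.eq_5, RExp.eval.eq_1, rv_eval,
        c3, c4, c5, c7, c10, c18, c23', g₂.P_eq]
    · simp only [hbetter, BExp.holds.eq_2, ra_eval, nv_eval, c18, hr, g₂.w_eq]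

/-- All slots of one stage. -/
def slotsProg : Prog :=
  rep 17 2 (slotProg ;; setN 23 (.const 0) (.add (nv 23) (.const 1)))

lemma slotsProg_spec {s : Mem n} (h : Env I J d s) (hm : 0 < I.m) (hk : 0 < I.k) {t : ℕ}
    (hp : s.N 23 0 = I.k * t) :
    (slotsProg.den I.f s).N 12 = I.slots (s.R 5 0) (s.R 7 0)
        (fun i => s.N 10 (3 + (i + I.k * t))) (fun i => s.N 10 (3 + I.k * I.m + (i + I.k * t))) t
        (s.N 12) (s.S 1) I.k ∧
      (slotsProg.den I.f s).N 23 0 = I.k * (t + 1) := by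
  set body := slotProg ;; setN 23 (.const 0) (.add (nv 23) (.const 1)) with hbody
  have main := rep_induction (f := I.f) (s := s) (v := 17) (b := 2) (c := body) h.k_eq
    (fun j s' => s'.N 12 = I.slots (s.R 5 0) (s.R 7 0)
        (fun i => s.N 10 (3 + (i + I.k * t))) (fun i => s.N 10 (3 + I.k * I.m + (i + I.k * t))) t
        (s.N 12) (s.S 1) j ∧ s'.N 23 0 = j + I.k * t) ?_ ?_
  · refine ⟨main.1, main.2.trans ?_⟩
    ring
  · refine ⟨?_, ?_⟩
    · rw [Mem.setN_N_ne _ _ _ _ _ (by decide)]; rfl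
    · rw [Mem.setN_N_ne _ _ _ _ _ (by decide), hp, Nat.zero_add]
  · rintro j hj s' hj' hN hR hS ⟨h1, h2⟩
    have g' : Env I J d s' := h.of_frame (c := rep 17 2 body) rfl hN hR
    have m1 := slotProg_spec g' hm hk h2
    rw [hR 5 rfl, hR 7 rfl, hN 10 rfl, hS 1 rfl] at m1
    rw [hbody, den_seq]
    set u := slotProg.den I.f s' with hu
    rw [den, Mem.setN_N_ne _ _ _ _ _ (by decide), Mem.setN_N_ne _ _ _ _ _ (by decide),
      Mem.setN_N_ne _ _ _ _ _ (by decide), m1, h1]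
    refine ⟨rfl, ?_⟩
    have : u.N 23 0 = j + I.k * t := by rw [hu, den_N rfl, h2]
    simp [this]
    ring

end Prog


/-! ### Programs for the small elements, the stages and the fills -/

lemma Inst.coef_succ (m t : ℕ) : coef m (t + 1) = coef m t * (((m : ℝ) + 1) / m) := by
  rw [coef, coef, pow_succ, mul_assoc]

namespace Prog
variable {I : Inst n} {J : ℕ} {d : ℝ}

/-- One round of the density greedy algorithm. -/
def smallProg : Prog :=
  sumSet 10 31 1 ;;
  ite (.realLt (rv 10) (.mul (.ofNat (na 10 (.add (.add (.const 3) (.add (nv 3) (nv 3))) (nv 16))))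
    (rv 6)))
    (copySet 1 3 ;; evalG ;; setR 4 (.const 0) (rv 3) ;;
      scan (copySet 1 3 ;; ins 3 (nv 18) ;; evalG ;;
          setR 29 (nv 18) (.add (.mul (rv 8) (.sub (rv 3) (rv 4))) (ra 30 (nv 18))))
        (.and (.realLt (.ofNat (.const 0)) (ra 31 (nv 18)))
          (.and (.not (.realLt (rv 5) (ra 31 (nv 18)))) (.not (.mem (nv 18) (.const 1)))))
        (.realLt (.mul (ra 29 (nv 22)) (ra 31 (nv 18))) (.mul (ra 29 (nv 18)) (ra 31 (nv 22)))) ;;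
      ins 1 (nv 22))
    skip

open scoped Classical in
lemma smallProg_spec {s : Mem n} (h : Env I J d s) (hm : 0 < I.m) (hk : 0 < I.k) :
    (smallProg.den I.f s).S 1 =
      if weight I.w (s.S 1) < s.N 10 (3 + (I.k * I.m + I.k * I.m) + s.N 16 0) * s.R 6 0 then
        SubmodKnapsack.ins (s.S 1) (I.smallPick (s.R 5 0) (s.R 8 0) (s.N 12) (s.S 1))
      else s.S 1 := by
  rw [smallProg, den_seq]
  set u₀ := (sumSet 10 31 1).den I.f s with hu₀
  have f₀ : Env I J d u₀ := h.den rfl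
  have a0 : u₀.R 10 0 = weight I.w (s.S 1) := sumSet_spec h.n_eq h.w_eq (by decide)
  have a0S : u₀.S 1 = s.S 1 := den_S rfl _
  have a0N : u₀.N 10 = s.N 10 := den_N rfl _
  have a06 : u₀.R 6 = s.R 6 := den_R rfl _
  have a016 : u₀.N 16 = s.N 16 := den_N rfl _
  rw [den]
  simp only [BExp.holds.eq_2, rv_eval, RExp.eval.eq_5, RExp.eval.eq_1, na_eval, NExp.eval, nv_eval,
    f₀.P_eq, a0, a0N, a06, a016]
  split_ifs
  swap
  · rw [den, a0S]
  rw [den_seq, den_seq, den_seq, den_seq]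
  set u₁ := (copySet 1 3).den I.f u₀ with hu₁
  set u₂ := evalG.den I.f u₁ with hu₂
  set u₃ := (setR 4 (.const 0) (rv 3)).den I.f u₂ with hu₃
  have f₁ : Env I J d u₁ := f₀.den rfl
  have f₂ : Env I J d u₂ := f₁.den rfl
  have f₃ : Env I J d u₃ := f₂.den rfl
  have a1 : u₁.S 3 = s.S 1 := by rw [hu₁, copySet_S f₀.n_eq (by decide), a0S]
  have a1' : u₁.N 12 = s.N 12 := by rw [hu₁, den_N rfl, hu₀, den_N rfl]
  have a2 : u₂.R 3 0 = I.G (s.N 12) (s.S 1) := by rw [hu₂, evalG_spec f₁ hm hk, a1, a1']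
  have a3 : u₃.R 4 0 = I.G (s.N 12) (s.S 1) := by simp [hu₃, den, a2]
  have a3' : u₃.N 12 = s.N 12 := by rw [hu₃, den_N rfl, hu₂, den_N rfl, a1']
  have a3S : u₃.S 1 = s.S 1 := by rw [hu₃, den_S rfl, hu₂, den_S rfl, hu₁, den_S rfl, a0S]
  have a5 : u₃.R 5 = s.R 5 := by
    rw [hu₃, den_R rfl, hu₂, den_R rfl, hu₁, den_R rfl, hu₀, den_R rfl]
  have a8 : u₃.R 8 = s.R 8 := by
    rw [hu₃, den_R rfl, hu₂, den_R rfl, hu₁, den_R rfl, hu₀, den_R rfl]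
  set pre := copySet 1 3 ;; ins 3 (nv 18) ;; evalG ;;
          setR 29 (nv 18) (.add (.mul (rv 8) (.sub (rv 3) (rv 4))) (ra 30 (nv 18))) with hpre
  set cand := BExp.and (.realLt (.ofNat (.const 0)) (ra 31 (nv 18)))
          (.and (.not (.realLt (rv 5) (ra 31 (nv 18)))) (.not (.mem (nv 18) (.const 1)))) with hcand
  set better := BExp.realLt (.mul (ra 29 (nv 22)) (ra 31 (nv 18)))
    (.mul (ra 29 (nv 18)) (ra 31 (nv 22))) with hbetter
  -- The values computed so far are kept in the array `29`, so a comparison with the best element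
  -- found needs no second evaluation of `G`.
  have main := scan_spec (f := I.f) (s := u₃) (pre := pre) (cand := cand) (better := better)
    (fun e => 0 < natExt I.w e ∧ ¬ s.R 5 0 < natExt I.w e ∧ ¬ HasIdx (s.S 1) e)
    (fun e b => I.smallVal (s.R 8 0) (s.N 12) (s.S 1) b * natExt I.w e <
      I.smallVal (s.R 8 0) (s.N 12) (s.S 1) e * natExt I.w b)
    (fun j _ V => ∀ e < j, V e = I.smallVal (s.R 8 0) (s.N 12) (s.S 1) e)
    f₃.n_eq ⟨rfl, rfl, rfl⟩ (by simp) ?_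
  · rw [den, Mem.setS_S_self, nv_eval, main.1, den_S rfl, a3S]
    rfl
  · intro j hj s' hj' hN hR hS hInv
    have g' : Env I J d s' := by
      refine f₃.of_frame (c := scan pre cand better) rfl hN ?_
      intro r hr
      refine hR r ?_
      simpa [scan, wR] using hr
    rw [hpre, den_seq, den_seq, den_seq]
    set t₁ := (copySet 1 3).den I.f s' with ht₁
    set t₂ := (ins 3 (nv 18)).den I.f t₁ with ht₂
    set t₃ := evalG.den I.f t₂ with ht₃
    set t₄ := (setR 29 (nv 18) (.add (.mul (rv 8) (.sub (rv 3) (rv 4))) (ra 30 (nv 18)))).den I.f t₃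
      with ht₄
    have g₁ : Env I J d t₁ := g'.den rfl
    have g₂ : Env I J d t₂ := g₁.den rfl
    have g₃ : Env I J d t₃ := g₂.den rfl
    have g₄ : Env I J d t₄ := g₃.den rfl
    have b1 : t₁.S 3 = s.S 1 := by rw [ht₁, copySet_S g'.n_eq (by decide), hS 1 rfl, a3S]
    have b18 : t₁.N 18 0 = j := by rw [ht₁, den_N rfl, hj']
    have b2 : t₂.S 3 = SubmodKnapsack.ins (s.S 1) j := by
      simp only [ht₂, den, Mem.setS_S_self, nv_eval, b1, b18]
    have b12 : t₂.N 12 = s.N 12 := by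
      rw [ht₂, den_N rfl, ht₁, den_N rfl, hN 12 rfl, a3']
    have b3 : t₃.R 3 0 = I.G (s.N 12) (SubmodKnapsack.ins (s.S 1) j) := by
      rw [ht₃, evalG_spec g₂ hm hk, b2, b12]
    have b4 : t₃.R 4 0 = I.G (s.N 12) (s.S 1) := by
      rw [ht₃, den_R rfl, ht₂, den_R rfl, ht₁, den_R rfl, hR 4 rfl, a3]
    have b8 : t₃.R 8 = s.R 8 := by
      rw [ht₃, den_R rfl, ht₂, den_R rfl, ht₁, den_R rfl, hR 8 rfl, a8]
    have b318 : t₃.N 18 0 = j := by rw [ht₃, den_N rfl, ht₂, den_N rfl, b18]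
    have b29 : t₃.R 29 = s'.R 29 := by rw [ht₃, den_R rfl, ht₂, den_R rfl, ht₁, den_R rfl]
    have b5 : t₄.R 5 = s.R 5 := by
      rw [ht₄, den_R rfl, ht₃, den_R rfl, ht₂, den_R rfl, ht₁, den_R rfl, hR 5 rfl, a5]
    have bS : t₄.S 1 = s.S 1 := by
      rw [ht₄, den_S rfl, ht₃, den_S rfl, ht₂, den_S rfl, ht₁, den_S rfl, hS 1 rfl, a3S]
    have b418 : t₄.N 18 0 = j := by rw [ht₄, den_N rfl, b318]
    have hval : ∀ e < j + 1, t₄.R 29 e = I.smallVal (s.R 8 0) (s.N 12) (s.S 1) e := by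
      intro e he
      simp only [ht₄, den, Mem.setR_R_self, nv_eval, RExp.eval.eq_3, RExp.eval.eq_4, RExp.eval.eq_5,
        rv_eval, ra_eval, b3, b4, b8, b318, g₃.l_eq]
      rcases Nat.lt_succ_iff_lt_or_eq.1 he with he | rfl
      · rw [Function.update_of_ne he.ne, b29, hInv e he]
      · rw [Function.update_self, Inst.smallVal]
    refine ⟨hval, ?_, fun _ r hrj _ hr => ?_⟩
    · simp only [hcand, BExp.holds.eq_5, BExp.holds.eq_4, BExp.holds.eq_2, mem_holds, RExp.eval.eq_1,
        NExp.eval, Nat.cast_zero, ra_eval, nv_eval, rv_eval, g₄.w_eq, b5, bS, b418]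
    · simp only [hbetter, BExp.holds.eq_2, RExp.eval.eq_5, ra_eval, nv_eval, g₄.w_eq, b418, hr,
        hval j (Nat.lt_succ_self j), hval r (by omega)]

/-- All rounds of the density greedy algorithm in one stage. -/
def smallsProg : Prog := rep 25 0 smallProg

lemma smallsProg_spec {s : Mem n} (h : Env I J d s) (hm : 0 < I.m) (hk : 0 < I.k) :
    (smallsProg.den I.f s).S 1 = I.smallRun (s.R 5 0) (s.R 8 0)
      (s.N 10 (3 + (I.k * I.m + I.k * I.m) + s.N 16 0) * s.R 6 0) (s.N 12) (s.S 1) n := by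
  refine rep_induction (f := I.f) (s := s) (v := 25) (b := 0) (c := smallProg) h.n_eq
    (fun j s' => s'.S 1 = I.smallRun (s.R 5 0) (s.R 8 0)
      (s.N 10 (3 + (I.k * I.m + I.k * I.m) + s.N 16 0) * s.R 6 0) (s.N 12) (s.S 1) j) rfl ?_
  intro j hj s' hj' hN hR hS h1
  have g' : Env I J d s' := h.of_frame (c := rep 25 0 smallProg) rfl hN hR
  have := smallProg_spec g' hm hk
  rw [hN 10 rfl, hN 12 rfl, hN 16 rfl, hR 5 rfl, hR 6 rfl, hR 8 rfl] at this
  rw [Mem.setN_S, this, h1]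
  rfl

/-- The guess that is stored in the array of digits. -/
def _root_.SubmodKnapsack.Inst.decode (I : Inst n) (D : ℕ → ℕ) (om y de : ℝ) : Guess where
  om := om
  y := y
  de := de
  cls t i := D (3 + (i + I.k * t))
  thr t i := D (3 + I.k * I.m + (i + I.k * t))
  beta t := D (3 + (I.k * I.m + I.k * I.m) + t)
  tau i := min I.m (D (3 + (I.k * I.m + I.k * I.m) + I.m + i))
  fil i := D (3 + (I.k * I.m + I.k * I.m) + I.m + I.k + i)

/-- All stages. -/
def stagesProg : Prog :=
  rep 16 1 (slotsProg ;; smallsProg ;;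
    setR 8 (.const 0) (.mul (rv 8) (.div (.ofNat (.add (nv 1) (.const 1))) (.ofNat (nv 1)))))

lemma stagesProg_spec {s : Mem n} (h : Env I J d s) (hm : 0 < I.m) (hk : 0 < I.k)
    (hp : s.N 23 0 = 0) (ha : s.R 8 0 = Inst.coef I.m 0) (hS : s.S 1 = I.zeros) :
    (stagesProg.den I.f s).N 12 =
        (I.state (I.decode (s.N 10) (s.R 5 0) (s.R 6 0) (s.R 7 0)) (s.N 12) I.m).1 ∧
      (stagesProg.den I.f s).S 1 =
        (I.state (I.decode (s.N 10) (s.R 5 0) (s.R 6 0) (s.R 7 0)) (s.N 12) I.m).2 := by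
  set g := I.decode (s.N 10) (s.R 5 0) (s.R 6 0) (s.R 7 0) with hg
  set body := slotsProg ;; smallsProg ;;
    setR 8 (.const 0) (.mul (rv 8) (.div (.ofNat (.add (nv 1) (.const 1))) (.ofNat (nv 1))))
    with hbody
  have main := rep_induction (f := I.f) (s := s) (v := 16) (b := 1) (c := body) h.m_eq
    (fun t s' => s'.N 12 = (I.state g (s.N 12) t).1 ∧ s'.S 1 = (I.state g (s.N 12) t).2 ∧
      s'.N 23 0 = I.k * t ∧ s'.R 8 0 = Inst.coef I.m t) ?_ ?_
  · exact ⟨main.1, main.2.1⟩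
  · refine ⟨?_, hS, ?_, ha⟩
    · rw [Mem.setN_N_ne _ _ _ _ _ (by decide)]; rfl
    · rw [Mem.setN_N_ne _ _ _ _ _ (by decide), hp, Nat.mul_zero]
  · rintro t ht s' hj' hN hR hS ⟨h1, h2, h3, h4⟩
    have g' : Env I J d s' := h.of_frame (c := rep 16 1 body) rfl hN hR
    obtain ⟨m1, m2⟩ := slotsProg_spec g' hm hk h3
    rw [hbody, den_seq, den_seq]
    set u₁ := slotsProg.den I.f s' with hu₁
    set u₂ := smallsProg.den I.f u₁ with hu₂
    have f₁ : Env I J d u₁ := g'.den rfl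
    have f₂ : Env I J d u₂ := f₁.den rfl
    have m3 := smallsProg_spec f₁ hm hk
    rw [← hu₂] at m3
    rw [show u₁.N 10 = s.N 10 by rw [hu₁, den_N rfl, hN 10 rfl],
      show u₁.R 5 = s.R 5 by rw [hu₁, den_R rfl, hR 5 rfl],
      show u₁.R 6 = s.R 6 by rw [hu₁, den_R rfl, hR 6 rfl],
      show u₁.R 8 = s'.R 8 by rw [hu₁, den_R rfl],
      show u₁.S 1 = s'.S 1 by rw [hu₁, den_S rfl],
      show u₁.N 16 0 = t by rw [hu₁, den_N rfl, hj'], m1, h4, h2, hN 10 rfl, hR 5 rfl,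
      hR 7 rfl, h1] at m3
    rw [hN 10 rfl, hR 5 rfl, hR 7 rfl, h1, h2] at m1
    have e12 : u₂.N 12 = u₁.N 12 := den_N rfl _
    have e23 : u₂.N 23 = u₁.N 23 := den_N rfl _
    have e8 : u₂.R 8 0 = Inst.coef I.m t := by rw [hu₂, den_R rfl, hu₁, den_R rfl, h4]
    refine ⟨?_, ?_, ?_, ?_⟩
    · rw [Mem.setN_N_ne _ _ _ _ _ (by decide), den_N rfl, e12, m1]
      rfl
    · rw [Mem.setN_S, den_S rfl, m3]
      rfl
    · rw [Mem.setN_N_ne _ _ _ _ _ (by decide), den_N rfl, e23, m2]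
    · rw [Inst.coef_succ, ← e8]
      simp [den, f₂.m_eq]

/-- Fills in the missing large elements. -/
def fillsProg : Prog :=
  rep 17 2 (scan skip (.and (inClass (nv 18) (na 10 (.add (.add (.add (.add (.const 3)
        (.add (nv 3) (nv 3))) (nv 1)) (nv 2)) (nv 17)))) (.not (.mem (nv 18) (.const 3))))
      (.realLt (ra 31 (nv 18)) (ra 31 (nv 22))) ;;
    ins 3 (nv 22))

lemma fillsProg_spec {s : Mem n} (h : Env I J d s) :
    (fillsProg.den I.f s).S 3 = I.fills
      (I.decode (s.N 10) (s.R 5 0) (s.R 6 0) (s.R 7 0)) (s.S 3) I.k := by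
  set g := I.decode (s.N 10) (s.R 5 0) (s.R 6 0) (s.R 7 0) with hg
  set cand := BExp.and (inClass (nv 18) (na 10 (.add (.add (.add (.add (.const 3)
        (.add (nv 3) (nv 3))) (nv 1)) (nv 2)) (nv 17)))) (.not (.mem (nv 18) (.const 3)))
    with hcand
  set better := BExp.realLt (ra 31 (nv 18)) (ra 31 (nv 22)) with hbetter
  set body := scan skip cand better ;; ins 3 (nv 22) with hbody
  refine rep_induction (f := I.f) (s := s) (v := 17) (b := 2) (c := body) h.k_eq
    (fun j s' => s'.S 3 = I.fills g (s.S 3) j) rfl ?_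
  intro j hj s' hj' hN hR hS h1
  have g' : Env I J d s' := h.of_frame (c := rep 17 2 body) rfl hN hR
  have main := scan_spec (f := I.f) (s := s') (pre := skip) (cand := cand) (better := better)
    (fun e => I.InClass g.om g.de (g.fil j) e ∧ ¬ HasIdx (I.fills g (s.S 3) j) e)
    (fun e b => natExt I.w e < natExt I.w b) (fun _ _ _ => True) g'.n_eq ⟨rfl, rfl, rfl⟩ trivial ?_
  · rw [hbody, den_seq, den, Mem.setN_S, Mem.setS_S_self, nv_eval, main.1, den_S rfl, h1]
    rfl
  · intro e he t he' hN' hR' hS' _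
    have g₁ : Env I J d t := by
      refine g'.of_frame (c := scan skip cand better) rfl hN' ?_
      intro r hr
      exact hR' r rfl
    have t10 : t.N 10 = s.N 10 := by rw [hN' 10 rfl, hN 10 rfl]
    have t17 : t.N 17 0 = j := by rw [hN' 17 rfl, hj']
    have t5 : t.R 5 = s.R 5 := by rw [hR' 5 rfl, hR 5 rfl]
    have t7 : t.R 7 = s.R 7 := by rw [hR' 7 rfl, hR 7 rfl]
    have tS : t.S 3 = I.fills g (s.S 3) j := by rw [hS' 3 rfl, h1]
    rw [den]
    refine ⟨trivial, ?_, fun _ r _ _ hr => ?_⟩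
    · simp only [hcand, BExp.holds.eq_5, BExp.holds.eq_4, inClass_holds g₁, mem_holds, na_eval,
        NExp.eval, nv_eval, g₁.P_eq, g₁.m_eq, g₁.k_eq, t10, t17, t5, t7, tS, he']
      rfl
    · simp only [hbetter, BExp.holds.eq_2, ra_eval, nv_eval, he', hr, g₁.w_eq]

end Prog


/-! ### Decoding a guess and searching through all guesses -/

namespace Inst
variable (I : Inst n)

/-- The guess that is described by the digits `D`. -/
def guessOf (J : ℕ) (d : ℝ) (D : ℕ → ℕ) : Guess :=
  I.decode D (natExt I.w (D 0)) (natExt I.w (D 0) * 2 ^ min J (D 1)) (d * 2 ^ min J (D 2))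

/-- The empty picks. -/
def noPicks (Z : ℕ → ℕ) (p : ℕ) : ℕ := if p < I.k * I.m then n else Z p

/-- The number of digits of a guess. -/
def numDigits : ℕ := 3 + (I.k * I.m + I.k * I.m) + I.m + I.k + I.k

variable {I}

lemma slot_index_lt {i t : ℕ} (hi : i < I.k) (ht : t < I.m) : i + I.k * t < I.k * I.m :=
  calc i + I.k * t < I.k + I.k * t := by omega
    _ = I.k * (t + 1) := by ring
    _ ≤ I.k * I.m := Nat.mul_le_mul_left _ ht

lemma slots_of_le {om de : ℝ} {c th : ℕ → ℕ} {t : ℕ} {pk : ℕ → ℕ} {S : Finset (Fin n)} {p : ℕ}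
    (ht : t < I.m) (hp : I.k * I.m ≤ p) {j : ℕ} (hj : j ≤ I.k) :
    I.slots om de c th t pk S j p = pk p := by
  induction j with
  | zero => rfl
  | succ j ih =>
    have := slot_index_lt (I := I) (show j < I.k by omega) ht
    rw [slots, Function.update_of_ne (by omega), ih (by omega)]

lemma state_fst_of_le {g : Guess} {pk : ℕ → ℕ} {p : ℕ} (hp : I.k * I.m ≤ p) {t : ℕ}
    (ht : t ≤ I.m) : (I.state g pk t).1 p = pk p := by
  induction t with
  | zero => rfl
  | succ t ih =>
    rw [state, stage]
    simp only
    rw [slots_of_le (by omega) hp le_rfl, ih (by omega)]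

lemma candidate_guessOf_congr {J : ℕ} {d : ℝ} {D D' : ℕ → ℕ} {pk : ℕ → ℕ}
    (h : ∀ i < I.numDigits, D i = D' i) :
    I.candidate (I.guessOf J d D) pk = I.candidate (I.guessOf J d D') pk := by
  have h' : ∀ i < 3 + (I.k * I.m + I.k * I.m) + I.m + I.k + I.k, D i = D' i := h
  apply candidate_congr
  · simp only [guessOf, decode, h' 0 (by omega)]
  · simp only [guessOf, decode, h' 0 (by omega), h' 1 (by omega)]
  · simp only [guessOf, decode, h' 2 (by omega)]
  · intro t ht i hi
    have := slot_index_lt (I := I) hi ht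
    exact h' _ (by omega)
  · intro t ht i hi
    have := slot_index_lt (I := I) hi ht
    exact h' _ (by omega)
  · intro t ht
    exact h' _ (by omega)
  · intro i hi
    simp only [guessOf, decode, h' _ (show 3 + (I.k * I.m + I.k * I.m) + I.m + i < _ by omega)]
  · intro i hi
    exact h' _ (by omega)

end Inst

namespace Prog
variable {I : Inst n} {J : ℕ} {d : ℝ}

/-- Doubles the real cell `q` as often as the digit `i` says. -/
def double (q : Fin 32) (i : ℕ) : Prog :=
  rep 24 4 (ite (.natLt (nv 24) (na 10 (.const i))) (setR q (.const 0) (.add (rv q) (rv q))) skip)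

/-- Loop bounds must not change during the search, so the loop runs `J` times and skips the
superfluous rounds; this is the origin of the `min` in `guessOf`. -/
lemma double_spec {f : Finset (Fin n) → ℝ} {s : Mem n} {q : Fin 32} {i : ℕ} (hJ : s.N 4 0 = J) :
    ((double q i).den f s).R q 0 = s.R q 0 * 2 ^ min J (s.N 10 i) := by
  refine rep_induction (f := f) (s := s) (v := 24) (b := 4)
    (c := ite (.natLt (nv 24) (na 10 (.const i))) (setR q (.const 0) (.add (rv q) (rv q))) skip) hJ
    (fun j s' => s'.R q 0 = s.R q 0 * 2 ^ min j (s.N 10 i)) (by simp) ?_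
  intro j hj s' hj' hN hR hS h
  have h10 : s'.N 10 = s.N 10 := hN 10 rfl
  rw [den]
  simp only [BExp.holds.eq_1, nv_eval, na_eval, NExp.eval, hj', h10]
  split_ifs with hc
  · simp only [den, Mem.setN_R, Mem.setR_R_self, NExp.eval, Function.update_self, RExp.eval.eq_3,
      rv_eval, h]
    rw [min_eq_left hc.le, min_eq_left hc, pow_succ]
    ring
  · rw [den, Mem.setN_R, h, min_eq_right (not_lt.1 hc), min_eq_right (by omega)]

def coefProg : Prog :=
  setR 8 (.const 0) (.ofNat (.const 1)) ;;
  rep 24 1 (setR 8 (.const 0)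
    (.mul (rv 8) (.div (.ofNat (nv 1)) (.ofNat (.add (nv 1) (.const 1))))))

lemma coefProg_spec {s : Mem n} (h : Env I J d s) :
    (coefProg.den I.f s).R 8 0 = Inst.coef I.m 0 := by
  set s₁ := (setR 8 (.const 0) (.ofNat (.const 1))).den I.f s with hs₁
  have h₁ : Env I J d s₁ := h.den rfl
  rw [coefProg, den_seq, ← hs₁, Inst.coef, pow_zero, mul_one]
  refine rep_induction (f := I.f) (s := s₁) (v := 24) (b := 1)
    (c := setR 8 (.const 0)
    (.mul (rv 8) (.div (.ofNat (nv 1)) (.ofNat (.add (nv 1) (.const 1)))))) h₁.m_eq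
    (fun j s' => s'.R 8 0 = ((I.m : ℝ) / (I.m + 1)) ^ j) (by simp [hs₁, den]) ?_
  intro j hj s' hj' hN hR hS hi
  have h1 : s'.N 1 0 = I.m := by rw [hN 1 rfl, h₁.m_eq]
  simp [den, hi, h1, pow_succ]

def zerosProg : Prog :=
  rep 24 0 (ite (.realLt (.ofNat (.const 0)) (ra 31 (nv 24))) (del 1 (nv 24)) (ins 1 (nv 24)))

open scoped Classical in
lemma zerosProg_spec {s : Mem n} (h : Env I J d s) : (zerosProg.den I.f s).S 1 = I.zeros := by
  have main := rep_induction (f := I.f) (s := s) (v := 24) (b := 0)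
    (c := ite (.realLt (.ofNat (.const 0)) (ra 31 (nv 24))) (del 1 (nv 24)) (ins 1 (nv 24))) h.n_eq
    (fun j s' => ∀ e : Fin n, e < j → (e ∈ s'.S 1 ↔ ¬ 0 < I.w e)) (by simp) ?_
  · ext e
    rw [zerosProg, main e e.2]
    simp [Inst.zeros]
  · intro j hj s' hj' hN hR hS hi e he
    have hw : s'.R 31 = natExt I.w := by rw [hR 31 rfl, h.w_eq]
    have hwj : natExt I.w j = I.w ⟨j, hj⟩ := natExt_val I.w ⟨j, hj⟩
    rw [den]
    simp only [BExp.holds.eq_2, RExp.eval.eq_1, NExp.eval, Nat.cast_zero, ra_eval, nv_eval, hj', hw,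
      hwj]
    split_ifs with hc
    · simp only [den, nv_eval, hj', Mem.setN_S, Mem.setS_S_self, rmv, hj, dif_pos, mem_erase]
      rcases Nat.lt_succ_iff_lt_or_eq.1 he with he | he
      · rw [hi e he]
        exact and_iff_right (fun h' => by rw [h'] at he; exact lt_irrefl _ he)
      · have : e = ⟨j, hj⟩ := Fin.ext he
        rw [this]
        exact iff_of_false (by simp) (fun h' => h' hc)
    · simp only [den, nv_eval, hj', Mem.setN_S, Mem.setS_S_self, mem_ins]
      rcases Nat.lt_succ_iff_lt_or_eq.1 he with he | he
      · rw [hi e he]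
        exact or_iff_left (by omega)
      · have : e = ⟨j, hj⟩ := Fin.ext he
        rw [this]
        exact iff_of_true (Or.inr rfl) hc

def noPicksProg : Prog := rep 24 3 (setN 12 (nv 24) (nv 0))

lemma noPicksProg_spec {s : Mem n} (h : Env I J d s) :
    (noPicksProg.den I.f s).N 12 = I.noPicks (s.N 12) := by
  have main := rep_induction (f := I.f) (s := s) (v := 24) (b := 3) (c := setN 12 (nv 24) (nv 0))
    h.P_eq (fun j s' => s'.N 12 = fun p => if p < j then n else s.N 12 p) ?_ ?_
  · exact main
  · rw [Mem.setN_N_ne _ _ _ _ _ (by decide)]; simp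
  · intro j hj s' hj' hN hR hS hi
    have h0 : s'.N 0 0 = n := by rw [hN 0 rfl, h.n_eq]
    rw [Mem.setN_N_ne _ _ _ _ _ (by decide), den, Mem.setN_N_self, nv_eval, nv_eval, hi, hj', h0]
    funext p
    rcases lt_trichotomy p j with hp | rfl | hp
    · rw [Function.update_of_ne hp.ne, if_pos hp, if_pos (by omega)]
    · rw [Function.update_self, if_pos (by omega)]
    · rw [Function.update_of_ne hp.ne', if_neg (by omega), if_neg (by omega)]

/-- Prepares the data of a guess. -/
def initProg : Prog :=
  setR 5 (.const 0) (ra 31 (na 10 (.const 0))) ;;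
  setR 6 (.const 0) (rv 5) ;; double 6 1 ;;
  setR 7 (.const 0) (rv 17) ;; double 7 2 ;;
  coefProg ;; zerosProg ;; noPicksProg ;; setN 23 (.const 0) (.const 0)

lemma initProg_spec {s : Mem n} (h : Env I J d s) :
    let u := initProg.den I.f s
    let g := I.guessOf J d (s.N 10)
    u.R 5 0 = g.om ∧ u.R 6 0 = g.y ∧ u.R 7 0 = g.de ∧ u.R 8 0 = Inst.coef I.m 0 ∧
      u.S 1 = I.zeros ∧ u.N 12 = I.noPicks (s.N 12) ∧ u.N 23 0 = 0 := by
  intro u g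
  simp only [u, initProg, den_seq]
  set u₁ := (setR 5 (.const 0) (ra 31 (na 10 (.const 0)))).den I.f s with hu₁
  set u₂ := (setR 6 (.const 0) (rv 5)).den I.f u₁ with hu₂
  set u₃ := (double 6 1).den I.f u₂ with hu₃
  set u₄ := (setR 7 (.const 0) (rv 17)).den I.f u₃ with hu₄
  set u₅ := (double 7 2).den I.f u₄ with hu₅
  set u₆ := coefProg.den I.f u₅ with hu₆
  set u₇ := zerosProg.den I.f u₆ with hu₇
  set u₈ := noPicksProg.den I.f u₇ with hu₈
  have f₁ : Env I J d u₁ := h.den rfl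
  have f₂ : Env I J d u₂ := f₁.den rfl
  have f₃ : Env I J d u₃ := f₂.den rfl
  have f₄ : Env I J d u₄ := f₃.den rfl
  have f₅ : Env I J d u₅ := f₄.den rfl
  have f₆ : Env I J d u₆ := f₅.den rfl
  have f₇ : Env I J d u₇ := f₆.den rfl
  have a1 : u₁.R 5 0 = g.om := by
    simp only [hu₁, den, Mem.setR_R_self, NExp.eval, Function.update_self, ra_eval, na_eval, h.w_eq]
    rfl
  have a10 : u₂.N 10 = s.N 10 := rfl
  have a2 : u₂.R 6 0 = g.om := by
    simp only [hu₂, den, Mem.setR_R_self, NExp.eval, Function.update_self, rv_eval, a1]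
  have a3 : u₃.R 6 0 = g.y := by
    rw [hu₃, double_spec f₂.J_eq, a2]; rfl
  have a4 : u₄.R 7 0 = d := by
    simp only [hu₄, den, Mem.setR_R_self, NExp.eval, Function.update_self, rv_eval, f₃.d_eq]
  have a410 : u₄.N 10 = s.N 10 := by rw [hu₄, den_N rfl, hu₃, den_N rfl, a10]
  have a5 : u₅.R 7 0 = g.de := by
    rw [hu₅, double_spec f₄.J_eq, a4, a410]; rfl
  refine ⟨?_, ?_, ?_, ?_, ?_, ?_, ?_⟩
  · rw [den_R rfl, hu₈, den_R rfl, hu₇, den_R rfl, hu₆, den_R rfl, hu₅, den_R rfl, hu₄, den_R rfl,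
      hu₃, den_R rfl, hu₂, den_R rfl, a1]
  · rw [den_R rfl, hu₈, den_R rfl, hu₇, den_R rfl, hu₆, den_R rfl, hu₅, den_R rfl, hu₄, den_R rfl, a3]
  · rw [den_R rfl, hu₈, den_R rfl, hu₇, den_R rfl, hu₆, den_R rfl, a5]
  · rw [den_R rfl, hu₈, den_R rfl, hu₇, den_R rfl, hu₆, coefProg_spec f₅]
  · rw [den_S rfl, hu₈, den_S rfl, hu₇, zerosProg_spec f₆]
  · rw [den_N rfl, hu₈, noPicksProg_spec f₇]
    rw [hu₇, den_N rfl, hu₆, den_N rfl, hu₅, den_N rfl, hu₄, den_N rfl, hu₃, den_N rfl]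
    rfl
  · simp [den]

/-- Stores the guessed scenario in the array `13`. -/
def tauProg : Prog :=
  rep 17 2 (setN 13 (nv 17) (.const 0) ;;
    rep 24 1 (ite (.natLt (nv 24) (na 10 (.add (.add (.add (.const 3) (.add (nv 3) (nv 3))) (nv 1))
      (nv 17)))) (setN 13 (nv 17) (.add (na 13 (nv 17)) (nv 2))) skip))

/-- The product `k * τ i` is formed by repeated addition in a loop of `m` rounds, which truncates
the digit at `m`. The value `m` is no time of a pick; it is harmless, because every candidate is
checked. -/
lemma tauProg_spec {s : Mem n} (h : Env I J d s) : ∀ i < I.k, (tauProg.den I.f s).N 13 i =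
    I.k * min I.m (s.N 10 (3 + (I.k * I.m + I.k * I.m) + I.m + i)) := by
  set inner := rep 24 1 (ite (.natLt (nv 24) (na 10 (.add (.add (.add (.const 3)
    (.add (nv 3) (nv 3))) (nv 1)) (nv 17)))) (setN 13 (nv 17) (.add (na 13 (nv 17)) (nv 2))) skip)
    with hinner
  refine rep_induction (f := I.f) (s := s) (v := 17) (b := 2)
    (c := setN 13 (nv 17) (.const 0) ;; inner) h.k_eq
    (fun j s' => ∀ i < j, s'.N 13 i =
      I.k * min I.m (s.N 10 (3 + (I.k * I.m + I.k * I.m) + I.m + i))) (by simp) ?_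
  intro j hj s' hj' hN hR hS hi
  have g' : Env I J d s' := h.of_frame (c := rep 17 2 (setN 13 (nv 17) (.const 0) ;; inner))
    rfl hN hR
  rw [den_seq]
  set u := (setN 13 (nv 17) (.const 0)).den I.f s' with hu
  have f₁ : Env I J d u := g'.den rfl
  have u17 : u.N 17 0 = j := by rw [hu, den_N rfl, hj']
  have u10 : u.N 10 = s.N 10 := by rw [hu, den_N rfl, hN 10 rfl]
  have u13 : u.N 13 = Function.update (s'.N 13) j 0 := by
    simp only [hu, den, Mem.setN_N_self, nv_eval, hj', NExp.eval]
  have main := rep_induction (f := I.f) (s := u) (v := 24) (b := 1)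
    (c := ite (.natLt (nv 24) (na 10 (.add (.add (.add (.const 3)
    (.add (nv 3) (nv 3))) (nv 1)) (nv 17)))) (setN 13 (nv 17) (.add (na 13 (nv 17)) (nv 2))) skip)
    f₁.m_eq (fun t s'' => s''.N 13 = Function.update (s'.N 13) j
      (I.k * min t (s.N 10 (3 + (I.k * I.m + I.k * I.m) + I.m + j)))) ?_ ?_
  · rw [Mem.setN_N_ne _ _ _ _ _ (by decide), hinner, main]
    intro i hi'
    rcases Nat.lt_succ_iff_lt_or_eq.1 hi' with hi' | rfl
    · rw [Function.update_of_ne hi'.ne, hi i hi']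
    · rw [Function.update_self]
  · rw [Mem.setN_N_ne _ _ _ _ _ (by decide), u13]; simp
  · intro t ht s'' ht' hN' hR' hS' hi'
    have g'' : Env I J d s'' := f₁.of_frame (c := inner) rfl hN' hR'
    have v10 : s''.N 10 = s.N 10 := by rw [hN' 10 rfl, u10]
    have v17 : s''.N 17 0 = j := by rw [hN' 17 rfl, u17]
    rw [den]
    simp only [BExp.holds.eq_1, nv_eval, na_eval, NExp.eval, ht', v10, v17, g''.P_eq, g''.m_eq]
    split_ifs with hc
    · simp only [den, NExp.eval, nv_eval, na_eval, v17, g''.k_eq, hi']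
      rw [Mem.setN_N_ne _ _ _ _ _ (by decide), Mem.setN_N_self, hi', Function.update_self,
        Function.update_idem, min_eq_left hc.le, min_eq_left hc, Nat.mul_succ]
    · rw [den, Mem.setN_N_ne _ _ _ _ _ (by decide), hi', min_eq_right (not_lt.1 hc),
        min_eq_right (by omega)]

/-- Computes the candidate of a guess, in the set `3`. -/
def buildProg : Prog :=
  initProg ;; stagesProg ;; tauProg ;; copySet 1 3 ;; insPicks 3 ;; fillsProg

/-- A digit truncated at `m` makes the program read the array `12` beyond its first `k * m` cells.
The second part says that these cells keep their contents, so that the candidate of a guess does not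
depend on earlier guesses. -/
lemma buildProg_spec {s : Mem n} (h : Env I J d s) (hm : 0 < I.m) (hk : 0 < I.k) :
    (buildProg.den I.f s).S 3 =
        I.candidate (I.guessOf J d (s.N 10)) (I.noPicks (s.N 12)) ∧
      ∀ p, I.k * I.m ≤ p → (buildProg.den I.f s).N 12 p = s.N 12 p := by
  obtain ⟨b1, b2, b3, b4, b5, b6, b7⟩ := initProg_spec h
  rw [buildProg, den_seq, den_seq, den_seq, den_seq, den_seq]
  set g := I.guessOf J d (s.N 10) with hg
  set u₁ := initProg.den I.f s with hu₁
  have f₁ : Env I J d u₁ := h.den rfl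
  obtain ⟨c1, c2⟩ := stagesProg_spec f₁ hm hk b7 b4 b5
  have hu10 : u₁.N 10 = s.N 10 := den_N rfl _
  have hgd : I.decode (s.N 10) g.om g.y g.de = g := rfl
  rw [b1, b2, b3, b6, hu10, hgd] at c1 c2
  set u₂ := stagesProg.den I.f u₁ with hu₂
  set u₃ := tauProg.den I.f u₂ with hu₃
  set u₄ := (copySet 1 3).den I.f u₃ with hu₄
  set u₅ := (insPicks 3).den I.f u₄ with hu₅
  have f₂ : Env I J d u₂ := f₁.den rfl
  have f₃ : Env I J d u₃ := f₂.den rfl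
  have f₄ : Env I J d u₄ := f₃.den rfl
  have f₅ : Env I J d u₅ := f₄.den rfl
  have v10 : u₂.N 10 = s.N 10 := by rw [hu₂, den_N rfl, hu10]
  have v13 : ∀ i < I.k, u₄.N 13 i = I.k * g.tau i := by
    intro i hi
    rw [hu₄, den_N rfl, hu₃, tauProg_spec f₂ i hi, v10]
    rfl
  have v4 : u₄.S 3 = u₂.S 1 := by
    rw [hu₄, copySet_S f₃.n_eq (by decide), hu₃, den_S rfl]
  have v4' : u₄.N 12 = u₂.N 12 := by rw [hu₄, den_N rfl, hu₃, den_N rfl]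
  have v5 : u₅.S 3 = pickSet I.k (u₂.N 12) g.tau (u₂.S 1) := by
    rw [hu₅, insPicks_spec f₄.k_eq v13, v4, v4']
  constructor
  · rw [fillsProg_spec f₅, v5, c1, c2,
      show u₅.N 10 = s.N 10 by rw [hu₅, den_N rfl, hu₄, den_N rfl, hu₃, den_N rfl, v10],
      show u₅.R 5 0 = g.om by
        rw [hu₅, den_R rfl, hu₄, den_R rfl, hu₃, den_R rfl, hu₂, den_R rfl, b1],
      show u₅.R 6 0 = g.y by
        rw [hu₅, den_R rfl, hu₄, den_R rfl, hu₃, den_R rfl, hu₂, den_R rfl, b2],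
      show u₅.R 7 0 = g.de by
        rw [hu₅, den_R rfl, hu₄, den_R rfl, hu₃, den_R rfl, hu₂, den_R rfl, b3], hgd]
    rfl
  · intro p hp
    rw [den_N rfl, hu₅, den_N rfl, v4', c1, Inst.state_fst_of_le hp le_rfl, Inst.noPicks,
      if_neg (not_lt.2 hp)]

/-- Keeps the best feasible set. -/
def checkProg : Prog :=
  sumSet 10 31 3 ;; query 12 3 ;;
  ite (.and (.not (.realLt (.ofNat (.const 1)) (rv 10))) (.realLt (rv 11) (rv 12)))
    (copySet 3 0 ;; setR 11 (.const 0) (rv 12)) skip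

lemma checkProg_spec {s : Mem n} (h : Env I J d s) (h1 : weight I.w (s.S 0) ≤ 1)
    (h2 : s.R 11 0 ≤ I.f (s.S 0)) :
    let u := checkProg.den I.f s
    weight I.w (u.S 0) ≤ 1 ∧ u.R 11 0 ≤ I.f (u.S 0) ∧ s.R 11 0 ≤ u.R 11 0 ∧
      (weight I.w (s.S 3) ≤ 1 → I.f (s.S 3) ≤ u.R 11 0) := by
  intro u
  simp only [u, checkProg, den_seq]
  set u₁ := (sumSet 10 31 3).den I.f s with hu₁
  set u₂ := (query 12 3).den I.f u₁ with hu₂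
  have f₁ : Env I J d u₁ := h.den rfl
  have f₂ : Env I J d u₂ := f₁.den rfl
  have a1 : u₂.R 10 0 = weight I.w (s.S 3) := by
    rw [hu₂, den_R rfl, hu₁, sumSet_spec h.n_eq h.w_eq (by decide)]
  have a2 : u₂.R 12 0 = I.f (s.S 3) := by
    simp only [hu₂, den, Mem.setR_R_self, Function.update_self]
    rw [hu₁, den_S rfl]
  have a3 : u₂.R 11 = s.R 11 := by rw [hu₂, den_R rfl, hu₁, den_R rfl]
  have aS : u₂.S 3 = s.S 3 := by rw [hu₂, den_S rfl, hu₁, den_S rfl]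
  have aS0 : u₂.S 0 = s.S 0 := by rw [hu₂, den_S rfl, hu₁, den_S rfl]
  rw [den]
  split_ifs with hc
  · simp only [BExp.holds.eq_5, BExp.holds.eq_4, BExp.holds.eq_2, RExp.eval.eq_1, NExp.eval,
      Nat.cast_one, rv_eval, a1, a2, a3, not_lt] at hc
    rw [den_seq]
    set u₃ := (copySet 3 0).den I.f u₂ with hu₃
    have b1 : u₃.S 0 = s.S 3 := by rw [hu₃, copySet_S f₂.n_eq (by decide), aS]
    have b2 : u₃.R 12 0 = I.f (s.S 3) := by rw [hu₃, den_R rfl, a2]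
    simp only [den, Mem.setR_S, Mem.setR_R_self, NExp.eval, Function.update_self, rv_eval, b1, b2]
    exact ⟨hc.1, le_rfl, hc.2.le, fun _ => le_rfl⟩
  · simp only [BExp.holds.eq_5, BExp.holds.eq_4, BExp.holds.eq_2, RExp.eval.eq_1, NExp.eval,
      Nat.cast_one, rv_eval, a1, a2, a3, not_lt, not_and] at hc
    rw [den, aS0, a3]
    exact ⟨h1, h2, le_rfl, hc⟩

/-- All guesses are tried. -/
def searchProg : Prog :=
  rep 15 8 (buildProg ;; checkProg ;; odo 10 6 (.const 1) (na 11 (nv 21)))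

theorem searchProg_spec {s : Mem n} (h : Env I J d s) (hm : 0 < I.m) (hk : 0 < I.k)
    (hL : s.N 6 0 = I.numDigits) (hρ : ∀ i < I.numDigits, 0 < s.N 11 i)
    (hN : s.N 8 0 = ∏ i ∈ range I.numDigits, s.N 11 i) (hD : ∀ i < I.numDigits, s.N 10 i = 0)
    (h1 : weight I.w (s.S 0) ≤ 1) (h2 : s.R 11 0 ≤ I.f (s.S 0)) :
    weight I.w ((searchProg.den I.f s).S 0) ≤ 1 ∧
    ∀ D : ℕ → ℕ, (∀ i < I.numDigits, D i < s.N 11 i) →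
      weight I.w (I.candidate (I.guessOf J d D) (I.noPicks (s.N 12))) ≤ 1 →
      I.f (I.candidate (I.guessOf J d D) (I.noPicks (s.N 12))) ≤
        I.f ((searchProg.den I.f s).S 0) := by
  set ρ := s.N 11 with hρdef
  set body := buildProg ;; checkProg ;; odo 10 6 (.const 1) (na 11 (nv 21)) with hbody
  have main := rep_induction (f := I.f) (s := s) (v := 15) (b := 8) (c := body) hN
    (fun x s' => (∀ i < I.numDigits, s'.N 10 i = 1 * digit ρ x i) ∧
      (∀ p, I.k * I.m ≤ p → s'.N 12 p = s.N 12 p) ∧ weight I.w (s'.S 0) ≤ 1 ∧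
      s'.R 11 0 ≤ I.f (s'.S 0) ∧
      ∀ y < x, weight I.w (I.candidate (I.guessOf J d (digit ρ y)) (I.noPicks (s.N 12))) ≤ 1 →
        I.f (I.candidate (I.guessOf J d (digit ρ y)) (I.noPicks (s.N 12))) ≤ s'.R 11 0) ?_ ?_
  · obtain ⟨_, _, m3, m4, m5⟩ := main
    refine ⟨m3, fun D hlt hw => ?_⟩
    obtain ⟨y, hy, hyD⟩ := exists_digit ρ D _ hlt
    have e := Inst.candidate_guessOf_congr (I := I) (J := J) (d := d)
      (pk := I.noPicks (s.N 12)) hyD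
    rw [← e] at hw ⊢
    exact (m5 y hy hw).trans m4
  · refine ⟨?_, ?_, h1, h2, by simp⟩
    · intro i hi
      rw [Mem.setN_N_ne _ _ _ _ _ (by decide), digit_zero, hD i hi]
    · intro p hp
      rw [Mem.setN_N_ne _ _ _ _ _ (by decide)]
  · rintro x hx s' hx' hN' hR' hS' ⟨i1, i2, i3, i4, i5⟩
    have g' : Env I J d s' := h.of_frame (c := rep 15 8 body) rfl hN' hR'
    obtain ⟨b1, b2⟩ := buildProg_spec g' hm hk
    rw [hbody, den_seq, den_seq]
    set u₁ := buildProg.den I.f s' with hu₁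
    set u₂ := checkProg.den I.f u₁ with hu₂
    set u₃ := (odo 10 6 (.const 1) (na 11 (nv 21))).den I.f u₂ with hu₃
    have f₁ : Env I J d u₁ := g'.den rfl
    have a11 : u₁.R 11 = s'.R 11 := by rw [hu₁, den_R rfl]
    have aS0 : u₁.S 0 = s'.S 0 := by rw [hu₁, den_S rfl]
    obtain ⟨c1, c2, c3, c4⟩ := checkProg_spec f₁ (by rw [aS0]; exact i3) (by rw [aS0, a11]; exact i4)
    rw [← hu₂] at c1 c2 c3 c4
    rw [a11] at c3
    have hpk : I.noPicks (s'.N 12) = I.noPicks (s.N 12) := by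
      funext p
      unfold Inst.noPicks
      split_ifs with hp
      · rfl
      · exact i2 p (not_lt.1 hp)
    have hT : u₁.S 3 = I.candidate (I.guessOf J d (digit ρ x)) (I.noPicks (s.N 12)) := by
      rw [b1, hpk]
      exact Inst.candidate_guessOf_congr fun i hi => by rw [i1 i hi, one_mul]
    rw [hT] at c4
    have a10 : u₂.N 10 = s'.N 10 := by rw [hu₂, den_N rfl, hu₁, den_N rfl]
    have a6 : u₂.N 6 0 = I.numDigits := by
      rw [hu₂, den_N rfl, hu₁, den_N rfl, hN' 6 rfl, hL]
    have a11' : u₂.N 11 = ρ := by rw [hu₂, den_N rfl, hu₁, den_N rfl, hN' 11 rfl]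
    have e12 : u₃.N 12 = u₁.N 12 := by rw [hu₃, den_N rfl, hu₂, den_N rfl]
    have eR : u₃.R 11 = u₂.R 11 := by rw [hu₃, den_R rfl]
    have eS : u₃.S 0 = u₂.S 0 := by rw [hu₃, den_S rfl]
    rw [Mem.setN_N_ne _ _ _ _ _ (by decide), Mem.setN_N_ne _ _ _ _ _ (by decide), Mem.setN_R,
      Mem.setN_S, e12, eR, eS]
    refine ⟨?_, fun p hp => by rw [b2 p hp, i2 p hp], c1, c2, fun y hy hw => ?_⟩
    · refine odo_spec (A := 10) (b := 6) (st := .const 1) (lim := na 11 (nv 21)) (s := u₂) (x := x)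
        (by decide) (by decide) a6 one_pos hρ (fun _ _ => rfl) ?_ ?_
      · intro t ht _
        rw [na_eval, nv_eval, ht 11 (by decide) (by decide) (by decide), a11', one_mul]
      · rw [a10]; exact i1
    · rcases Nat.lt_succ_iff_lt_or_eq.1 hy with hy | rfl
      · exact (i5 y hy hw).trans c3
      · exact c4 hw

end Prog


/-! ### The preparation of the data -/

/-- The memory as a family of arrays. -/
def Mem.ofStore (σ : Store n) : Mem n where
  N r i := σ.nat (32 * i + r)
  R r i := σ.real (32 * i + r)
  S := σ.sets

lemma Mem.toStore_ofStore (σ : Store n) : (Mem.ofStore σ).toStore = σ := by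
  have h : ∀ a : ℕ, 32 * (a / 32) + (Fin.ofNat 32 a : ℕ) = a := by
    intro a; simp only [Fin.ofNat]; omega
  simp only [Mem.toStore, Mem.ofStore, h]

namespace Prog
variable {f : Finset (Fin n) → ℝ} {w : Fin n → ℝ}

/-- Moves the weights to the array `31`. -/
def loadProg : Prog :=
  rep 24 0 (setN 26 (.const 0) (.sub (.sub (nv 0) (.const 1)) (nv 24)) ;;
    setR 31 (nv 26) (.cell (.add (.const 1) (nv 26))))

lemma toStore_real_setR (s : Mem n) (r : Fin 32) (i : ℕ) (v : ℝ) :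
    (s.setR r i v).toStore.real = Function.update s.toStore.real (32 * i + r) v := by
  rw [← toStore_setReal]; rfl

/-- Cell `i` of the array `31` has address `32 * i + 31`, above the address `i + 1` from which its
weight is read. Moving the weights in order of decreasing index therefore never destroys one that is
still to be read. -/
lemma loadProg_spec {s : Mem n} (hn : s.N 0 0 = n)
    (hw : ∀ a, 1 ≤ a → s.toStore.real a = natExt w (a - 1)) :
    (loadProg.den f s).R 31 = natExt w ∧ ∀ i, n ≤ i → (loadProg.den f s).R 30 i = 0 := by
  have hR : ∀ (t : Mem n) (r : Fin 32) i, t.R r i = t.toStore.real (32 * i + r) := by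
    intro t r i
    simp only [Mem.toStore, addr_div, addr_ofNat]
  have main := rep_induction (f := f) (s := s) (v := 24) (b := 0)
    (c := setN 26 (.const 0) (.sub (.sub (nv 0) (.const 1)) (nv 24)) ;;
    setR 31 (nv 26) (.cell (.add (.const 1) (nv 26)))) hn
    (fun j s' => (∀ i, n ≤ i + j → s'.R 31 i = natExt w i) ∧
      ∀ a, a + j ≤ n → s'.toStore.real a = s.toStore.real a) ?_ ?_
  · refine ⟨funext fun i => main.1 i (by omega), fun i hi => ?_⟩
    rw [show (loadProg.den f s).R 30 = s.R 30 from den_R rfl s, hR, hw _ (by simp), natExt_of_le]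
    simp only [Fin.isValue, Fin.coe_ofNat_eq_mod]
    omega
  · refine ⟨fun i hi => ?_, fun a _ => rfl⟩
    rw [Mem.setN_R, hR, hw _ (by simp), natExt_of_le w (x := i) (by omega), natExt_of_le]
    simp only [Fin.isValue, Fin.coe_ofNat_eq_mod]
    omega
  · rintro j hj s' hj' hN _ _ ⟨h1, h2⟩
    have h0 : s'.N 0 0 = n := by rw [hN 0 rfl, hn]
    rw [den_seq]
    set u := (setN 26 (.const 0) (.sub (.sub (nv 0) (.const 1)) (nv 24))).den f s' with hu
    have u26 : u.N 26 0 = n - 1 - j := by simp [hu, den, h0, hj']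
    have uR : u.toStore.real = s'.toStore.real := rfl
    have uR' : u.R = s'.R := rfl
    have hx : u.toStore.real (1 + (n - 1 - j)) = natExt w (n - 1 - j) := by
      rw [uR, h2 _ (by omega), hw _ (by omega)]
      congr 1
      omega
    have e : (setR 31 (nv 26) (.cell (.add (.const 1) (nv 26)))).den f u =
        u.setR 31 (n - 1 - j) (natExt w (n - 1 - j)) := by
      rw [den, nv_eval, u26, RExp.eval, NExp.eval, NExp.eval, nv_eval, u26, hx]
    rw [e]
    refine ⟨fun i hi => ?_, fun a ha => ?_⟩
    · rw [Mem.setN_R, Mem.setR_R_self, uR']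
      by_cases hi' : i = n - 1 - j
      · rw [hi', Function.update_self]
      · rw [Function.update_of_ne hi', h1 i (by omega)]
    · have : (((u.setR 31 (n - 1 - j) (natExt w (n - 1 - j))).setN 24 0 (j + 1)).toStore.real) a =
          (u.setR 31 (n - 1 - j) (natExt w (n - 1 - j))).toStore.real a := rfl
      rw [this, toStore_real_setR, Function.update_of_ne, uR, h2 a (by omega)]
      simp only [Fin.isValue, Fin.coe_ofNat_eq_mod]
      omega

/-- Computes the linear part of the function. -/
def linProg : Prog :=
  rep 24 0 (ins 6 (nv 24)) ;; query 18 6 ;;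
  rep 24 0 (del 6 (nv 24) ;; query 19 6 ;; setR 30 (nv 24) (.sub (rv 18) (rv 19)) ;; ins 6 (nv 24))

lemma linProg_spec {s : Mem n} (hn : s.N 0 0 = n) (h30 : ∀ i, n ≤ i → s.R 30 i = 0) :
    (linProg.den f s).R 30 = natExt (lin f) := by
  rw [linProg, den_seq, den_seq]
  set u₁ := (rep 24 0 (ins 6 (nv 24))).den f s with hu₁
  set u₂ := (query 18 6).den f u₁ with hu₂
  have a1 : u₁.S 6 = univ := by
    have main := rep_induction (f := f) (s := s) (v := 24) (b := 0) (c := ins 6 (nv 24)) hn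
      (fun j s' => ∀ e : Fin n, e < j → e ∈ s'.S 6) (by simp) ?_
    · ext e
      simp [hu₁, main e e.2]
    · intro j hj s' hj' _ _ _ h e he
      rw [Mem.setN_S, den, Mem.setS_S_self, nv_eval, hj', mem_ins]
      rcases Nat.lt_succ_iff_lt_or_eq.1 he with he | he
      · exact Or.inl (h e he)
      · exact Or.inr he.symm
  have a2 : u₂.R 18 0 = f univ := by simp [hu₂, den, a1]
  have a2S : u₂.S 6 = univ := by rw [hu₂, den_S rfl, a1]
  have a2n : u₂.N 0 0 = n := by rw [hu₂, den_N rfl, hu₁, den_N rfl, hn]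
  have a230 : u₂.R 30 = s.R 30 := by rw [hu₂, den_R rfl, hu₁, den_R rfl]
  have main := rep_induction (f := f) (s := u₂) (v := 24) (b := 0)
    (c := del 6 (nv 24) ;; query 19 6 ;; setR 30 (nv 24) (.sub (rv 18) (rv 19)) ;; ins 6 (nv 24))
    a2n (fun j s' => s'.S 6 = univ ∧
      ∀ i, i < j ∨ n ≤ i → s'.R 30 i = natExt (lin f) i) ?_ ?_
  · exact funext fun i => main.2 i (by omega)
  · refine ⟨a2S, fun i hi => ?_⟩
    have hi : n ≤ i := by omega
    rw [Mem.setN_R, a230, h30 i hi, natExt_of_le _ hi]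
  · rintro j hj s' hj' hN hR _ ⟨h1, h2⟩
    have h18 : s'.R 18 0 = f univ := by rw [hR 18 rfl, a2]
    have hl : natExt (lin f) j = lin f ⟨j, hj⟩ := natExt_val (lin f) ⟨j, hj⟩
    simp only [den_seq]
    set t₁ := (del 6 (nv 24)).den f s' with ht₁
    set t₂ := (query 19 6).den f t₁ with ht₂
    set t₃ := (setR 30 (nv 24) (.sub (rv 18) (rv 19))).den f t₂ with ht₃
    have b1 : t₁.S 6 = univ.erase ⟨j, hj⟩ := by
      simp [ht₁, den, hj', rmv, hj, h1]
    have b2 : t₂.R 19 0 = f (univ.erase ⟨j, hj⟩) := by simp [ht₂, den, b1]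
    have b18 : t₂.R 18 0 = f univ := by rw [ht₂, den_R rfl, ht₁, den_R rfl, h18]
    have b30 : t₂.R 30 = s'.R 30 := by rw [ht₂, den_R rfl, ht₁, den_R rfl]
    have b24 : t₂.N 24 0 = j := by rw [ht₂, den_N rfl, ht₁, den_N rfl, hj']
    have b3 : t₃.R 30 = Function.update (s'.R 30) j (lin f ⟨j, hj⟩) := by
      simp only [ht₃, den, Mem.setR_R_self, nv_eval, b24, RExp.eval.eq_4, rv_eval, b18, b2, b30]
      rfl
    have b3S : t₃.S 6 = univ.erase ⟨j, hj⟩ := by rw [ht₃, den_S rfl, ht₂, den_S rfl, b1]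
    have b324 : t₃.N 24 0 = j := by rw [ht₃, den_N rfl, b24]
    refine ⟨?_, fun i hi => ?_⟩
    · rw [Mem.setN_S, den, Mem.setS_S_self, nv_eval, b324, b3S]
      ext e
      rw [mem_ins, mem_erase]
      simp only [mem_univ, and_true, iff_true]
      by_cases h : (e : ℕ) = j
      · exact Or.inr h.symm
      · exact Or.inl fun h' => h (Fin.ext_iff.1 h')
    · rw [Mem.setN_R, den_R rfl, b3]
      by_cases hij : i = j
      · rw [hij, Function.update_self, hl]
      · rw [Function.update_of_ne hij, h2 i (by omega)]

/-- Computes the largest value of a singleton. -/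
def maxProg : Prog :=
  setR 16 (.const 0) (.ofNat (.const 0)) ;;
  rep 24 0 (ins 7 (nv 24) ;; query 19 7 ;;
    ite (.realLt (rv 16) (rv 19)) (setR 16 (.const 0) (rv 19)) skip ;; del 7 (nv 24))

open scoped Classical in
lemma maxProg_spec {s : Mem n} (hn : s.N 0 0 = n) (hS : s.S 7 = ∅) :
    (∀ e, f {e} ≤ (maxProg.den f s).R 16 0) ∧
      ((maxProg.den f s).R 16 0 = 0 ∨ ∃ e, f {e} = (maxProg.den f s).R 16 0) := by
  rw [maxProg, den_seq]
  set u₁ := (setR 16 (.const 0) (.ofNat (.const 0))).den f s with hu₁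
  have main := rep_induction (f := f) (s := u₁) (v := 24) (b := 0)
    (c := ins 7 (nv 24) ;; query 19 7 ;;
    ite (.realLt (rv 16) (rv 19)) (setR 16 (.const 0) (rv 19)) skip ;; del 7 (nv 24)) (M := n) hn
    (fun j s' => s'.S 7 = ∅ ∧ (∀ e : Fin n, e < j → f {e} ≤ s'.R 16 0) ∧
      (s'.R 16 0 = 0 ∨ ∃ e, f {e} = s'.R 16 0)) ?_ ?_
  · exact ⟨fun e => main.2.1 e e.2, main.2.2⟩
  · refine ⟨hS, by simp, Or.inl ?_⟩
    simp [hu₁, den]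
  · rintro j hj s' hj' hN hR _ ⟨h1, h2, h3⟩
    simp only [den_seq]
    set t₁ := (ins 7 (nv 24)).den f s' with ht₁
    set t₂ := (query 19 7).den f t₁ with ht₂
    set t₃ := (ite (.realLt (rv 16) (rv 19)) (setR 16 (.const 0) (rv 19)) skip).den f t₂ with ht₃
    have b1 : t₁.S 7 = {⟨j, hj⟩} := by
      simp [ht₁, den, hj', SubmodKnapsack.ins, hj, h1]
    have b2 : t₂.R 19 0 = f {⟨j, hj⟩} := by simp [ht₂, den, b1]
    have b16 : t₂.R 16 0 = s'.R 16 0 := by rw [ht₂, den_R rfl, ht₁, den_R rfl]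
    have b3 : t₃.R 16 0 = if s'.R 16 0 < f {⟨j, hj⟩} then f {⟨j, hj⟩} else s'.R 16 0 := by
      rw [ht₃, den]
      simp only [BExp.holds.eq_2, rv_eval, b16, b2]
      split_ifs
      · simp [den, b2]
      · rw [den, b16]
    have b3S : t₃.S 7 = {⟨j, hj⟩} := by rw [ht₃, den_S rfl, ht₂, den_S rfl, b1]
    have b324 : t₃.N 24 0 = j := by rw [ht₃, den_N rfl, ht₂, den_N rfl, ht₁, den_N rfl, hj']
    rw [Mem.setN_R, Mem.setN_S, den, Mem.setS_R, Mem.setS_S_self, nv_eval, b324, b3S, b3]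
    refine ⟨by simp [rmv, hj], fun e he => ?_, ?_⟩
    · rcases Nat.lt_succ_iff_lt_or_eq.1 he with he | he
      · refine (h2 e he).trans ?_
        split_ifs with h
        · exact h.le
        · exact le_rfl
      · rw [show e = ⟨j, hj⟩ from Fin.ext he]
        split_ifs with h
        · exact le_rfl
        · exact not_lt.1 h
    · split_ifs
      · exact Or.inr ⟨_, rfl⟩
      · exact h3

/-- Multiplies the cell `27` by the cell `b`. -/
def mulBy (b : Fin 32) : Prog :=
  setN 28 (.const 0) (.const 0) ;; rep 24 b (setN 28 (.const 0) (.add (nv 28) (nv 27))) ;;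
  setN 27 (.const 0) (nv 28)

lemma mulBy_spec {s : Mem n} {b : Fin 32} (hb : b ≠ 28) :
    ((mulBy b).den f s).N 27 0 = s.N 27 0 * s.N b 0 := by
  set u₁ := (setN 28 (.const 0) (.const 0)).den f s with hu₁
  have main := rep_induction (f := f) (s := u₁) (v := 24) (b := b)
    (c := setN 28 (.const 0) (.add (nv 28) (nv 27))) (M := s.N b 0)
    (by rw [hu₁, den, Mem.setN_N_ne _ _ _ _ _ hb])
    (fun j s' => s'.N 28 0 = s.N 27 0 * j) (by simp [hu₁, den]) ?_
  · rw [mulBy, den_seq, den_seq, ← hu₁, den, Mem.setN_N_self, NExp.eval, Function.update_self,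
      nv_eval, main]
  · intro j hj s' hj' hN _ _ h
    have : s'.N 27 0 = s.N 27 0 := by rw [hN 27 rfl, hu₁, den_N rfl]
    simp [den, h, this, Nat.mul_succ]

/-- Multiplies the cell `27` by a power of the cell `b`. -/
lemma rep_mulBy_spec {s : Mem n} {b c : Fin 32} (hb : b ≠ 28 ∧ b ≠ 24 ∧ b ≠ 27 ∧ b ≠ 25) :
    ((rep 25 c (mulBy b)).den f s).N 27 0 = s.N 27 0 * s.N b 0 ^ s.N c 0 := by
  refine rep_induction (f := f) (s := s) (v := 25) (b := c) (c := mulBy b) rfl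
    (fun j s' => s'.N 27 0 = s.N 27 0 * s.N b 0 ^ j) (by simp) ?_
  intro j hj s' hj' hN _ _ h
  have hb' : s'.N b 0 = s.N b 0 := by
    rw [hN b (by simp [wN, mulBy, hb.1.symm, hb.2.1.symm, hb.2.2.1.symm, hb.2.2.2.symm])]
  rw [Mem.setN_N_ne _ _ _ _ _ (by decide), mulBy_spec hb.1, h, hb', pow_succ, mul_assoc]

/-- Eight times a number. -/
def times8 (e : NExp) : NExp :=
  let d (x : NExp) : NExp := .add x x
  d (d (d e))

@[simp] lemma times8_eval (σ : Store n) (e : NExp) : (times8 e).eval σ = 8 * e.eval σ := by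
  simp only [times8, NExp.eval]; ring

/-- Computes the number of slots, the number of picks and the base of the digits. -/
def sizesProg : Prog :=
  setN 27 (.const 0) (.const 1) ;; mulBy 1 ;; mulBy 1 ;; mulBy 1 ;;
  setN 2 (.const 0) (times8 (nv 27)) ;; mulBy 1 ;; mulBy 1 ;;
  setN 29 (.const 0) (times8 (nv 27)) ;;
  setN 5 (.const 0) (.add (.add (nv 29) (nv 29)) (.const 2)) ;;
  setR 17 (.const 0) (.div (rv 16) (.ofNat (nv 29))) ;;
  setN 27 (.const 0) (nv 2) ;; mulBy 1 ;; setN 3 (.const 0) (nv 27)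

lemma sizesProg_spec {s : Mem n} {K : ℕ} (hK : s.N 1 0 = K) :
    let u := sizesProg.den f s
    u.N 2 0 = 8 * K ^ 3 ∧ u.N 3 0 = 8 * K ^ 3 * K ∧ u.N 5 0 = 16 * K ^ 5 + 2 ∧
      u.R 17 0 = s.R 16 0 / (8 * K ^ 5 : ℕ) := by
  intro u
  simp only [u, sizesProg, den_seq]
  set u₁ := (setN 27 (.const 0) (.const 1)).den f s with hu₁
  set u₂ := (mulBy 1).den f u₁ with hu₂
  set u₃ := (mulBy 1).den f u₂ with hu₃
  set u₄ := (mulBy 1).den f u₃ with hu₄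
  set u₅ := (setN 2 (.const 0) (times8 (nv 27))).den f u₄ with hu₅
  set u₆ := (mulBy 1).den f u₅ with hu₆
  set u₇ := (mulBy 1).den f u₆ with hu₇
  set u₈ := (setN 29 (.const 0) (times8 (nv 27))).den f u₇ with hu₈
  set u₉ := (setN 5 (.const 0) (.add (.add (nv 29) (nv 29)) (.const 2))).den f u₈ with hu₉
  set v₁ := (setR 17 (.const 0) (.div (rv 16) (.ofNat (nv 29)))).den f u₉ with hv₁
  set v₂ := (setN 27 (.const 0) (nv 2)).den f v₁ with hv₂
  set v₃ := (mulBy 1).den f v₂ with hv₃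
  have k1 : u₁.N 1 0 = K := by rw [hu₁, den_N rfl, hK]
  have k2 : u₂.N 1 0 = K := by rw [hu₂, den_N rfl, k1]
  have k3 : u₃.N 1 0 = K := by rw [hu₃, den_N rfl, k2]
  have k4 : u₄.N 1 0 = K := by rw [hu₄, den_N rfl, k3]
  have k5 : u₅.N 1 0 = K := by rw [hu₅, den_N rfl, k4]
  have k6 : u₆.N 1 0 = K := by rw [hu₆, den_N rfl, k5]
  have k7 : u₇.N 1 0 = K := by rw [hu₇, den_N rfl, k6]
  have k8 : v₂.N 1 0 = K := by
    rw [hv₂, den_N rfl, hv₁, den_N rfl, hu₉, den_N rfl, hu₈, den_N rfl, k7]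
  have x1 : u₁.N 27 0 = 1 := by simp [hu₁, den]
  have x2 : u₂.N 27 0 = K := by rw [hu₂, mulBy_spec (by decide), x1, k1, one_mul]
  have x3 : u₃.N 27 0 = K * K := by rw [hu₃, mulBy_spec (by decide), x2, k2]
  have x4 : u₄.N 27 0 = K * K * K := by rw [hu₄, mulBy_spec (by decide), x3, k3]
  have x5 : u₅.N 27 0 = K * K * K := by rw [hu₅, den_N rfl, x4]
  have y5 : u₅.N 2 0 = 8 * K ^ 3 := by simp [hu₅, den, x4]; ring
  have x6 : u₆.N 27 0 = K * K * K * K := by rw [hu₆, mulBy_spec (by decide), x5, k5]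
  have x7 : u₇.N 27 0 = K * K * K * K * K := by rw [hu₇, mulBy_spec (by decide), x6, k6]
  have y8 : u₈.N 29 0 = 8 * K ^ 5 := by simp [hu₈, den, x7]; ring
  have y9 : u₉.N 5 0 = 16 * K ^ 5 + 2 := by simp [hu₉, den, y8]; ring
  have y9' : u₉.N 29 0 = 8 * K ^ 5 := by rw [hu₉, den_N rfl, y8]
  have r9 : u₉.R 16 = s.R 16 := by
    rw [hu₉, den_R rfl, hu₈, den_R rfl, hu₇, den_R rfl, hu₆, den_R rfl, hu₅, den_R rfl, hu₄,
      den_R rfl, hu₃, den_R rfl, hu₂, den_R rfl, hu₁, den_R rfl]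
  have z1 : v₁.R 17 0 = s.R 16 0 / (8 * K ^ 5 : ℕ) := by simp [hv₁, den, y9', r9]
  have c2 : v₁.N 2 0 = 8 * K ^ 3 := by
    rw [hv₁, den_N rfl, hu₉, den_N rfl, hu₈, den_N rfl, hu₇, den_N rfl, hu₆, den_N rfl, y5]
  have x8 : v₂.N 27 0 = 8 * K ^ 3 := by simp [hv₂, den, c2]
  have x9 : v₃.N 27 0 = 8 * K ^ 3 * K := by rw [hv₃, mulBy_spec (by decide), x8, k8]
  refine ⟨?_, ?_, ?_, ?_⟩
  · rw [den_N rfl, hv₃, den_N rfl, hv₂, den_N rfl, c2]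
  · simp [den, x9]
  · rw [den_N rfl, hv₃, den_N rfl, hv₂, den_N rfl, hv₁, den_N rfl, y9]
  · rw [den_R rfl, hv₃, den_R rfl, hv₂, den_R rfl, z1]

/-- Computes the number of scenarios. -/
def scenProg : Prog :=
  setN 27 (.const 0) (.const 1) ;; rep 25 2 (mulBy 1) ;; setN 7 (.const 0) (nv 27)

lemma scenProg_spec {s : Mem n} : (scenProg.den f s).N 7 0 = s.N 1 0 ^ s.N 2 0 := by
  rw [scenProg, den_seq, den_seq]
  set u := (setN 27 (.const 0) (.const 1)).den f s with hu
  have h := rep_mulBy_spec (f := f) (s := u) (b := 1) (c := 2) (by decide)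
  have h1 : u.N 1 = s.N 1 := by rw [hu, den_N rfl]
  have h2 : u.N 2 = s.N 2 := by rw [hu, den_N rfl]
  rw [show u.N 27 0 = 1 by simp [hu, den], one_mul, h1, h2] at h
  rw [den, Mem.setN_N_self, NExp.eval, Function.update_self, nv_eval, h]

/-- Computes the number of doublings. -/
def logProg : Prog :=
  setN 4 (.const 0) (.const 1) ;; setN 27 (.const 0) (.const 1) ;;
  rep 24 0 (ite (.natLt (nv 27) (nv 0))
    (setN 27 (.const 0) (.add (nv 27) (nv 27)) ;; setN 4 (.const 0) (.add (nv 4) (.const 1))) skip)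

lemma logProg_spec {s : Mem n} (hn : s.N 0 0 = n) :
    (logProg.den f s).N 4 0 = Nat.clog 2 n + 1 := by
  rw [logProg, den_seq, den_seq]
  set u₁ := (setN 4 (.const 0) (.const 1)).den f s with hu₁
  set u₂ := (setN 27 (.const 0) (.const 1)).den f u₁ with hu₂
  have a4 : u₂.N 4 0 = 1 := by rw [hu₂, den_N rfl]; simp [hu₁, den]
  have main := rep_induction (f := f) (s := u₂) (v := 24) (b := 0)
    (c := ite (.natLt (nv 27) (nv 0))
    (setN 27 (.const 0) (.add (nv 27) (nv 27)) ;; setN 4 (.const 0) (.add (nv 4) (.const 1))) skip)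
    (M := n) (by rw [hu₂, den_N rfl, hu₁, den_N rfl, hn])
    (fun j s' => s'.N 4 0 = min j (Nat.clog 2 n) + 1 ∧ s'.N 27 0 = 2 ^ min j (Nat.clog 2 n)) ?_ ?_
  · rw [main.1, min_eq_right]
    exact Nat.clog_le_of_le_pow Nat.lt_two_pow_self.le
  · refine ⟨?_, ?_⟩
    · rw [Mem.setN_N_ne _ _ _ _ _ (by decide), a4]; simp
    · rw [Mem.setN_N_ne _ _ _ _ _ (by decide)]; simp [hu₂, den]
  · rintro j hj s' hj' hN _ _ ⟨h1, h2⟩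
    have h0 : s'.N 0 0 = n := by rw [hN 0 rfl, hu₂, den_N rfl, hu₁, den_N rfl, hn]
    -- Doubling goes on exactly below `clog 2 n`, so the remaining rounds of the fixed-length loop
    -- do nothing.
    have hlt : 2 ^ min j (Nat.clog 2 n) < n ↔ j < Nat.clog 2 n := by
      rw [← Nat.lt_clog_iff_pow_lt Nat.one_lt_two]
      omega
    rw [den]
    simp only [BExp.holds.eq_1, nv_eval, h0, h2, hlt]
    split_ifs with hc
    · rw [min_eq_left hc.le] at h1 h2
      rw [min_eq_left (Nat.succ_le_of_lt hc)]
      simp [den, h1, h2, pow_succ]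
      ring
    · rw [den, Mem.setN_N_ne _ _ _ _ _ (by decide), Mem.setN_N_ne _ _ _ _ _ (by decide), h1, h2,
        min_eq_right (not_lt.1 hc), min_eq_right (by omega)]
      exact ⟨rfl, rfl⟩

/-- Computes the number of digits of a guess. -/
def digitsProg : Prog :=
  setN 9 (.const 0) (.add (nv 0) (.const 1)) ;;
  setN 30 (.const 0) (.add (.add (.add (.add (nv 3) (nv 3)) (nv 1)) (nv 2)) (nv 2)) ;;
  setN 6 (.const 0) (.add (.const 3) (nv 30))

/-- Stores the radices of the digits. -/
def radixProg : Prog :=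
  setN 11 (.const 0) (nv 9) ;; setN 11 (.const 1) (nv 4) ;; setN 11 (.const 2) (nv 4) ;;
  rep 24 30 (setN 11 (.add (.const 3) (nv 24)) (nv 5)) ;;
  setN 27 (.const 0) (nv 9) ;; mulBy 4 ;; mulBy 4 ;; rep 25 30 (mulBy 5) ;;
  setN 8 (.const 0) (nv 27)

lemma radixProg_spec {s : Mem n} {a J B q : ℕ} (h9 : s.N 9 0 = a) (h4 : s.N 4 0 = J)
    (h5 : s.N 5 0 = B) (h30 : s.N 30 0 = q) :
    let u := radixProg.den f s
    u.N 11 0 = a ∧ u.N 11 1 = J ∧ u.N 11 2 = J ∧ (∀ i < q, u.N 11 (3 + i) = B) ∧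
      u.N 8 0 = a * J * J * B ^ q := by
  intro u
  simp only [u, radixProg, den_seq]
  set u₁ := (setN 11 (.const 0) (nv 9)).den f s with hu₁
  set u₂ := (setN 11 (.const 1) (nv 4)).den f u₁ with hu₂
  set u₃ := (setN 11 (.const 2) (nv 4)).den f u₂ with hu₃
  set u₄ := (rep 24 30 (setN 11 (.add (.const 3) (nv 24)) (nv 5))).den f u₃ with hu₄
  set u₅ := (setN 27 (.const 0) (nv 9)).den f u₄ with hu₅
  set u₆ := (mulBy 4).den f u₅ with hu₆
  set u₇ := (mulBy 4).den f u₆ with hu₇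
  set u₈ := (rep 25 30 (mulBy 5)).den f u₇ with hu₈
  have b4 : u₁.N 4 0 = J := by rw [hu₁, den_N rfl, h4]
  have b4' : u₂.N 4 0 = J := by rw [hu₂, den_N rfl, b4]
  have b11 : u₃.N 11 0 = a ∧ u₃.N 11 1 = J ∧ u₃.N 11 2 = J := by
    have e1 : u₁.N 11 = Function.update (s.N 11) 0 a := by simp [hu₁, den, h9]
    have e2 : u₂.N 11 = Function.update (u₁.N 11) 1 J := by simp [hu₂, den, b4]
    have e3 : u₃.N 11 = Function.update (u₂.N 11) 2 J := by simp [hu₃, den, b4']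
    rw [e3, e2, e1]
    simp
  have b30 : u₃.N 30 0 = q := by rw [hu₃, den_N rfl, hu₂, den_N rfl, hu₁, den_N rfl, h30]
  have b5 : u₃.N 5 0 = B := by rw [hu₃, den_N rfl, hu₂, den_N rfl, hu₁, den_N rfl, h5]
  have b9 : u₄.N 9 0 = a := by
    rw [hu₄, den_N rfl, hu₃, den_N rfl, hu₂, den_N rfl, hu₁, den_N rfl, h9]
  have main : u₄.N 11 0 = a ∧ u₄.N 11 1 = J ∧ u₄.N 11 2 = J ∧ ∀ i < q, u₄.N 11 (3 + i) = B := by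
    refine rep_induction (f := f) (s := u₃) (v := 24) (b := 30)
      (c := setN 11 (.add (.const 3) (nv 24)) (nv 5)) b30
      (fun j s' => s'.N 11 0 = a ∧ s'.N 11 1 = J ∧ s'.N 11 2 = J ∧
        ∀ i < j, s'.N 11 (3 + i) = B) (by simp [b11]) ?_
    rintro j hj s' hj' hN _ _ ⟨i1, i2, i3, i4⟩
    have c5 : s'.N 5 0 = B := by rw [hN 5 rfl, b5]
    rw [Mem.setN_N_ne _ _ _ _ _ (by decide), den, Mem.setN_N_self, NExp.eval, NExp.eval, nv_eval,
      nv_eval, hj', c5, Function.update_of_ne (by omega), Function.update_of_ne (by omega),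
      Function.update_of_ne (by omega)]
    refine ⟨i1, i2, i3, fun i hi => ?_⟩
    rcases Nat.lt_succ_iff_lt_or_eq.1 hi with hi | rfl
    · rw [Function.update_of_ne (by omega), i4 i hi]
    · rw [Function.update_self]
  have c27 : u₅.N 27 0 = a := by simp [hu₅, den, b9]
  have c4 : u₅.N 4 0 = J := by rw [hu₅, den_N rfl, hu₄, den_N rfl, hu₃, den_N rfl, b4']
  have d27 : u₆.N 27 0 = a * J := by rw [hu₆, mulBy_spec (by decide), c27, c4]
  have d4 : u₆.N 4 0 = J := by rw [hu₆, den_N rfl, c4]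
  have e27 : u₇.N 27 0 = a * J * J := by rw [hu₇, mulBy_spec (by decide), d27, d4]
  have e5 : u₇.N 5 0 = B := by
    rw [hu₇, den_N rfl, hu₆, den_N rfl, hu₅, den_N rfl, hu₄, den_N rfl, b5]
  have e30 : u₇.N 30 0 = q := by
    rw [hu₇, den_N rfl, hu₆, den_N rfl, hu₅, den_N rfl, hu₄, den_N rfl, b30]
  have g27 : u₈.N 27 0 = a * J * J * B ^ q := by
    rw [hu₈, rep_mulBy_spec (by decide), e27, e5, e30]
  have g11 : u₈.N 11 = u₄.N 11 := by
    rw [hu₈, den_N rfl, hu₇, den_N rfl, hu₆, den_N rfl, hu₅, den_N rfl]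
  rw [den_N rfl, g11]
  refine ⟨main.1, main.2.1, main.2.2.1, main.2.2.2, ?_⟩
  simp [den, g27]

end Prog


/-! ### Encoding a good guess by digits; the guarantee of the search -/

namespace Inst
variable {I : Inst n}

/-- The digits that describe a guess. -/
def encode (I : Inst n) (es j₁ j₂ : ℕ) (g : Guess) (x : ℕ) : ℕ :=
  if x = 0 then es else if x = 1 then j₁ else if x = 2 then j₂
  else if x < 3 + I.k * I.m then g.cls ((x - 3) / I.k) ((x - 3) % I.k)
  else if x < 3 + (I.k * I.m + I.k * I.m) then
    g.thr ((x - 3 - I.k * I.m) / I.k) ((x - 3 - I.k * I.m) % I.k)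
  else if x < 3 + (I.k * I.m + I.k * I.m) + I.m then g.beta (x - (3 + (I.k * I.m + I.k * I.m)))
  else if x < 3 + (I.k * I.m + I.k * I.m) + I.m + I.k then
    g.tau (x - (3 + (I.k * I.m + I.k * I.m) + I.m))
  else g.fil (x - (3 + (I.k * I.m + I.k * I.m) + I.m + I.k))

lemma encode_le {es j₁ j₂ : ℕ} {g : Guess} {M : ℕ} (h1 : ∀ t i, g.cls t i ≤ M)
    (h2 : ∀ t i, g.thr t i ≤ M) (h3 : ∀ t, g.beta t ≤ M) (h4 : ∀ i, g.tau i ≤ M)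
    (h5 : ∀ i, g.fil i ≤ M) {x : ℕ} (hx : 3 ≤ x) : I.encode es j₁ j₂ g x ≤ M := by
  rw [encode, if_neg (by omega), if_neg (by omega), if_neg (by omega)]
  split_ifs
  exacts [h1 _ _, h2 _ _, h3 _, h4 _, h5 _]

lemma candidate_encode {J : ℕ} {d : ℝ} {es j₁ j₂ : ℕ} {g : Guess} {pk : ℕ → ℕ}
    (hom : g.om = natExt I.w es) (hy : g.y = g.om * 2 ^ j₁) (hde : g.de = d * 2 ^ j₂)
    (h₁ : j₁ ≤ J) (h₂ : j₂ ≤ J) (htau : ∀ i, g.tau i ≤ I.m) :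
    I.candidate (I.guessOf J d (I.encode es j₁ j₂ g)) pk = I.candidate g pk := by
  have e0 : I.encode es j₁ j₂ g 0 = es := rfl
  have e1 : I.encode es j₁ j₂ g 1 = j₁ := rfl
  have e2 : I.encode es j₁ j₂ g 2 = j₂ := rfl
  apply candidate_congr
  · simp only [guessOf, decode, e0, hom]
  · simp only [guessOf, decode, e0, e1, hy, hom, min_eq_right h₁]
  · simp only [guessOf, decode, e2, hde, min_eq_right h₂]
  · intro t ht i hi
    have := slot_index_lt (I := I) hi ht
    simp only [guessOf, decode, encode]
    rw [if_neg (by omega), if_neg (by omega), if_neg (by omega), if_pos (by omega),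
      Nat.add_sub_cancel_left, Nat.add_mul_div_left _ _ (by omega), Nat.add_mul_mod_self_left,
      Nat.div_eq_of_lt hi, Nat.mod_eq_of_lt hi, Nat.zero_add]
  · intro t ht i hi
    have := slot_index_lt (I := I) hi ht
    simp only [guessOf, decode, encode]
    rw [if_neg (by omega), if_neg (by omega), if_neg (by omega), if_neg (by omega),
      if_pos (by omega), Nat.sub_sub,
      Nat.add_sub_cancel_left, Nat.add_mul_div_left _ _ (by omega), Nat.add_mul_mod_self_left,
      Nat.div_eq_of_lt hi, Nat.mod_eq_of_lt hi, Nat.zero_add]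
  · intro t ht
    simp only [guessOf, decode, encode]
    rw [if_neg (by omega), if_neg (by omega), if_neg (by omega), if_neg (by omega),
      if_neg (by omega), if_pos (by omega), Nat.add_sub_cancel_left]
  · intro i hi
    simp only [guessOf, decode, encode]
    rw [if_neg (by omega), if_neg (by omega), if_neg (by omega), if_neg (by omega),
      if_neg (by omega), if_neg (by omega), if_pos (by omega), Nat.add_sub_cancel_left,
      min_eq_right (htau i)]
  · intro i hi
    simp only [guessOf, decode, encode]
    rw [if_neg (by omega), if_neg (by omega), if_neg (by omega), if_neg (by omega),
      if_neg (by omega), if_neg (by omega), if_neg (by omega), Nat.add_sub_cancel_left]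

/-- The search over all digits finds a good set. -/
theorem exists_good_digits {K : ℕ} {M₁ : ℝ} {O : Finset (Fin n)} {ρ : ℕ → ℕ}
    (hK : 0 < K) (hIm : I.m = K) (hIk : I.k = 8 * K ^ 3)
    (hmono : Monotone I.f) (hsub : IsSubmodular I.f) (h0 : ∀ S, 0 ≤ I.f S)
    (hw : ∀ e, 0 ≤ I.w e ∧ I.w e ≤ 1) (hO : IsOptimal I.f I.w O) (hOne : O.Nonempty)
    (hM₁ : 0 < M₁) (hM₁le : ∀ e, I.f {e} ≤ M₁) (hM₁e : ∃ e, I.f {e} = M₁)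
    (h₀ : ρ 0 = n + 1) (h₁ : ρ 1 = Nat.clog 2 n + 1) (h₂ : ρ 2 = Nat.clog 2 n + 1)
    (h₃ : ∀ i, 3 ≤ i → i < I.numDigits → ρ i = 16 * K ^ 5 + 2) (Z : ℕ → ℕ) :
    ∃ D : ℕ → ℕ, (∀ i < I.numDigits, D i < ρ i) ∧
      weight I.w (I.candidate (I.guessOf (Nat.clog 2 n + 1) (M₁ / (8 * K ^ 5 : ℕ)) D)
        (I.noPicks Z)) ≤ 1 ∧
      (1 - curvature I.f / Real.exp 1 - 7 / K) * I.f O ≤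
        I.f (I.candidate (I.guessOf (Nat.clog 2 n + 1) (M₁ / (8 * K ^ 5 : ℕ)) D)
          (I.noPicks Z)) := by
  obtain ⟨es, hes, j₁, hj₁, j₂, hj₂, g, g1, g2, g3, g4, g5, g6, g7, g8, g9, g10⟩ :=
    exists_good_guess (J := Nat.clog 2 n + 1) hK hIm hIk hmono hsub h0 hw hO hOne hM₁ hM₁le hM₁e
      (Nat.succ_pos _) (Nat.le_pow_clog Nat.one_lt_two n) (pk := I.noPicks Z)
      (fun p hp => if_pos hp)
  have hKK : K ≤ 16 * K ^ 5 + 1 := by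
    have : K ^ 1 ≤ K ^ 5 := Nat.pow_le_pow_right hK (by norm_num)
    rw [pow_one] at this
    omega
  refine ⟨I.encode es j₁ j₂ g, fun i hi => ?_, ?_⟩
  · rcases Nat.lt_or_ge i 3 with hi3 | hi3
    · interval_cases i
      · rw [h₀]; exact Nat.lt_succ_of_le hes
      · rw [h₁]; exact hj₁
      · rw [h₂]; exact hj₂
    · rw [h₃ i hi3 hi]
      exact Nat.lt_succ_of_le (encode_le g4 g5 g6
        (fun i => ((g7 i).le.trans_eq hIm).trans hKK) g8 hi3)
  · rw [candidate_encode g1 g2 g3 hj₁.le hj₂.le fun i => (g7 i).le]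
    exact ⟨g9, g10⟩

end Inst

/-- Allows the empty optimal set, for which `f ∅` may be positive, to be replaced by a nonempty one.
-/
lemma isOptimal_singleton {f : Finset (Fin n) → ℝ} {w : Fin n → ℝ} (hmono : Monotone f)
    (hw : ∀ e, 0 ≤ w e ∧ w e ≤ 1) (h : IsOptimal f w ∅) (e : Fin n) :
    IsOptimal f w {e} ∧ f {e} = f ∅ := by
  have hwe : weight w {e} ≤ 1 := by simpa [weight] using (hw e).2
  have h1 : f {e} = f ∅ := le_antisymm (h.2 _ hwe) (hmono (empty_subset _))
  exact ⟨⟨hwe, fun T hT => by rw [h1]; exact h.2 T hT⟩, h1⟩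

/-- The guarantee of the search. -/
theorem search_guarantee {f : Finset (Fin n) → ℝ} {w : Fin n → ℝ} {ε : ℝ} {K : ℕ} {M₁ : ℝ}
    {ρ Z : ℕ → ℕ} {S : Finset (Fin n)} (hn : 0 < n) (h0 : ∀ S, 0 ≤ f S) (hmono : Monotone f)
    (hsub : IsSubmodular f) (hw : ∀ e, 0 ≤ w e ∧ w e ≤ 1) (hK : 8 ≤ K * ε)
    (hM₁le : ∀ e, f {e} ≤ M₁) (hM₁e : M₁ = 0 ∨ ∃ e, f {e} = M₁)
    (h₀ : ρ 0 = n + 1) (h₁ : ρ 1 = Nat.clog 2 n + 1) (h₂ : ρ 2 = Nat.clog 2 n + 1)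
    (h₃ : ∀ i, 3 ≤ i → i < (Inst.mk f w K (8 * K ^ 3)).numDigits → ρ i = 16 * K ^ 5 + 2)
    (hS : ∀ D : ℕ → ℕ, (∀ i < (Inst.mk f w K (8 * K ^ 3)).numDigits, D i < ρ i) →
      weight w ((Inst.mk f w K (8 * K ^ 3)).candidate ((Inst.mk f w K (8 * K ^ 3)).guessOf
        (Nat.clog 2 n + 1) (M₁ / (8 * K ^ 5 : ℕ)) D) ((Inst.mk f w K (8 * K ^ 3)).noPicks Z)) ≤ 1 →
      f ((Inst.mk f w K (8 * K ^ 3)).candidate ((Inst.mk f w K (8 * K ^ 3)).guessOf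
        (Nat.clog 2 n + 1) (M₁ / (8 * K ^ 5 : ℕ)) D) ((Inst.mk f w K (8 * K ^ 3)).noPicks Z)) ≤ f S)
    {O : Finset (Fin n)} (hO : IsOptimal f w O) :
    (1 - curvature f / Real.exp 1 - ε) * f O ≤ f S := by
  wlog hOne : O.Nonempty generalizing O
  · rw [not_nonempty_iff_eq_empty] at hOne
    obtain ⟨h1, h2⟩ := isOptimal_singleton hmono hw (hOne ▸ hO) ⟨0, hn⟩
    rw [hOne, ← h2]
    exact this h1 (singleton_nonempty _)
  have hdr := MonoDR.of_submodular hmono hsub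
  have hM0 : 0 ≤ M₁ := (h0 _).trans (hM₁le ⟨0, hn⟩)
  -- If all singletons have value zero, there is no unit `de` to work with, but then `f O = 0` and
  -- any set will do.
  rcases hM0.eq_or_lt with hM | hM
  · have h1 : f O = 0 := by
      refine le_antisymm ?_ (h0 O)
      refine (le_sum_single hdr h0 hOne).trans (sum_nonpos fun e _ => ?_)
      rw [hM]
      exact hM₁le e
    rw [h1, mul_zero]
    exact h0 S
  · have hKpos : 0 < K := by
      refine Nat.pos_of_ne_zero ?_
      rintro rfl
      norm_num at hK
    obtain ⟨D, d1, d2, d3⟩ := Inst.exists_good_digits (I := ⟨f, w, K, 8 * K ^ 3⟩) (O := O) hKpos rfl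
      rfl hmono hsub h0 hw hO hOne hM hM₁le (hM₁e.resolve_left hM.ne') h₀ h₁ h₂ h₃ Z
    refine le_trans ?_ (d3.trans (hS D d1 d2))
    have hK' : (0 : ℝ) < K := by exact_mod_cast hKpos
    have : (7 : ℝ) / K ≤ ε := by
      rw [div_le_iff₀ hK']
      linarith [mul_comm ε (K : ℝ)]
    exact mul_le_mul_of_nonneg_right (by linarith) (h0 O)


/-! ### The program -/

/-- Counts the natural-number cell `1` up to the accuracy. -/
def accuracyCmd : Cmd :=
  .loop (.realLt (.mul (.ofNat (.cell (.const 1))) (.cell (.const 0))) (.ofNat (.const 8)))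
    (.setNat (.const 1) (.add (.cell (.const 1)) (.const 1)))

/-- The only loop whose length is not given by a stored bound: `⌈8 / ε⌉` is found by counting up
until the real test fails, two units of time per round. -/
lemma accuracyCmd_exec {f : Finset (Fin n) → ℝ} {σ : Store n} (hε : 0 < σ.real 0)
    (h1 : σ.nat 1 = 0) : ∃ t ≤ 2 * ⌈8 / σ.real 0⌉₊ + 1,
      Exec f accuracyCmd σ (σ.setNat 1 ⌈8 / σ.real 0⌉₊) t := by
  set K := ⌈8 / σ.real 0⌉₊ with hK
  have hcond : ∀ j : ℕ, (BExp.realLt (.mul (.ofNat (.cell (.const 1))) (.cell (.const 0)))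
      (.ofNat (.const 8))).holds (σ.setNat 1 j) ↔ j < K := by
    intro j
    rw [hK, Nat.lt_ceil, lt_div_iff₀ hε]
    simp [BExp.holds, RExp.eval, Store.setNat]
  have key : ∀ d j, j + d = K → Exec f accuracyCmd (σ.setNat 1 j) (σ.setNat 1 K) (2 * d + 1) := by
    intro d
    induction d with
    | zero =>
      rintro j rfl
      exact Exec.loop_false (by rw [hcond]; omega)
    | succ d ih =>
      intro j hj
      have h2 := Exec.loop_true (f := f) ((hcond j).2 (by omega))
        (Exec.of_step (c := .setNat (.const 1) (.add (.cell (.const 1)) (.const 1)))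
          (σ₁ := σ.setNat 1 (j + 1)) fun L => ?_) (ih (j + 1) (by omega))
      · rwa [show 1 + (2 * d + 1) + 1 = 2 * (d + 1) + 1 by ring] at h2
      · simp [step, Store.setNat]
  have h0 : σ.setNat 1 0 = σ := by
    have : Function.update σ.nat 1 0 = σ.nat := by rw [← h1, Function.update_eq_self]
    rw [Store.setNat, this]
  have := key K 0 (Nat.zero_add K)
  rw [h0] at this
  exact ⟨_, le_rfl, this⟩

namespace Prog

def valuesProg : Prog := loadProg ;; linProg ;; maxProg

def countsProg : Prog := logProg ;; digitsProg

def tableProg : Prog := radixProg ;; setR 11 (.const 0) (.ofNat (.const 0))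

end Prog

open Prog in
/-- The whole program. -/
def mainCmd : Cmd :=
  .seq accuracyCmd (.seq valuesProg.compile (.seq sizesProg.compile (.seq scenProg.compile
    (.seq countsProg.compile (.seq tableProg.compile searchProg.compile)))))

/-- The set of arrays whose index is in a list. -/
def inList (l : List (Fin 32)) (r : Fin 32) : Bool := l.contains r

/-- Bounds for the loops of the program. -/
structure Bounds (n K : ℕ) (β : Fin 32 → ℕ) : Prop where
  b0 : β 0 = n
  b1 : β 1 = K
  b2 : β 2 = 8 * K ^ 3
  b3 : β 3 = 8 * K ^ 3 * K
  b4 : β 4 = Nat.clog 2 n + 1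
  b5 : β 5 = 16 * K ^ 5 + 2
  b6 : β 6 = 3 + β 30
  b7 : β 7 = K ^ (8 * K ^ 3)
  b8 : β 8 = (n + 1) * (Nat.clog 2 n + 1) * (Nat.clog 2 n + 1) * (16 * K ^ 5 + 2) ^ β 30
  b30 : β 30 = 8 * K ^ 3 * K + 8 * K ^ 3 * K + K + 8 * K ^ 3 + 8 * K ^ 3

lemma exists_bounds (n K : ℕ) : ∃ β, Bounds n K β := by
  let q := 8 * K ^ 3 * K + 8 * K ^ 3 * K + K + 8 * K ^ 3 + 8 * K ^ 3
  refine ⟨fun r => if r = 0 then n else if r = 1 then K else if r = 2 then 8 * K ^ 3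
    else if r = 3 then 8 * K ^ 3 * K else if r = 4 then Nat.clog 2 n + 1
    else if r = 5 then 16 * K ^ 5 + 2 else if r = 6 then 3 + q else if r = 7 then K ^ (8 * K ^ 3)
    else if r = 8 then (n + 1) * (Nat.clog 2 n + 1) * (Nat.clog 2 n + 1) * (16 * K ^ 5 + 2) ^ q
    else q, ?_⟩
  constructor
  all_goals simp [q]

open Prog in
-- The program is cut into phases, because the loop bounds of one phase are computed in an earlier
-- one, whereas `Prog.exec` demands that they be constant within a phase. `σ.sets 0` starts empty
-- with recorded value zero, hence is feasible throughout.
theorem mainCmd_exec {f : Finset (Fin n) → ℝ} {w : Fin n → ℝ} {ε : ℝ} (hn : 0 < n)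
    (h0 : ∀ S, 0 ≤ f S) (hmono : Monotone f) (hsub : IsSubmodular f)
    (hw : ∀ e, 0 ≤ w e ∧ w e ≤ 1) (hε : 0 < ε) {β : Fin 32 → ℕ} (hβ : Bounds n ⌈8 / ε⌉₊ β) :
    ∃ t ≤ 2 * ⌈8 / ε⌉₊ + 1 + (valuesProg.cost β + (sizesProg.cost β + (scenProg.cost β +
        (countsProg.cost β + (tableProg.cost β + searchProg.cost β + 1) + 1) + 1) + 1) + 1) + 1,
      ∃ σ : Store n, Exec f mainCmd (init mainCmd w ε).store σ t ∧ weight w (σ.sets 0) ≤ 1 ∧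
        ∀ O, IsOptimal f w O → (1 - curvature f / Real.exp 1 - ε) * f O ≤ f (σ.sets 0) := by
  set σ₀ := (init mainCmd w ε).store with hσ₀
  have hreal0 : σ₀.real 0 = ε := by simp [hσ₀, init]
  obtain ⟨t₀, ht₀, e₀⟩ := accuracyCmd_exec (f := f) (σ := σ₀) (by rw [hreal0]; exact hε)
    (by simp [hσ₀, init])
  rw [hreal0] at ht₀ e₀
  set K := ⌈8 / ε⌉₊ with hK
  have hKpos : 0 < K := Nat.ceil_pos.2 (by positivity)
  have hKε : 8 ≤ K * ε := by
    have := Nat.le_ceil (8 / ε)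
    rwa [div_le_iff₀ hε] at this
  set s₀ := Mem.ofStore (σ₀.setNat 1 K) with hs₀
  rw [← Mem.toStore_ofStore (σ₀.setNat 1 K), ← hs₀] at e₀
  have a0 : s₀.N 0 0 = n := by simp [hs₀, Mem.ofStore, Store.setNat, hσ₀, init]
  have a1 : s₀.N 1 0 = K := by simp [hs₀, Mem.ofStore, Store.setNat]
  have a10 : ∀ i, s₀.N 10 i = 0 := by
    intro i
    have : 32 * i + 10 ≠ 1 := by omega
    simp [hs₀, Mem.ofStore, Store.setNat, hσ₀, init, this]
  have aS : ∀ a, s₀.S a = ∅ := fun a => rfl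
  have aR : ∀ a, 1 ≤ a → s₀.toStore.real a = natExt w (a - 1) := by
    intro a ha
    rw [hs₀, Mem.toStore_ofStore]
    have : a ≠ 0 := by omega
    simp [Store.setNat, hσ₀, init, this, natExt]
  obtain ⟨t₁, ht₁, e₁⟩ := exec (f := f) (X := inList [0]) (c := valuesProg) rfl (s := s₀) (β := β)
    (by
      intro r hr
      simp only [inList, List.contains_cons, List.contains_nil, Bool.or_false, beq_iff_eq] at hr
      rw [hr, a0, hβ.b0])
  set s₁ := valuesProg.den f s₀ with hs₁
  obtain ⟨l1, l2⟩ := loadProg_spec (f := f) a0 aR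
  set r₁ := loadProg.den f s₀ with hr₁
  set r₂ := linProg.den f r₁ with hr₂
  have hs₁' : s₁ = maxProg.den f r₂ := rfl
  have r0 : r₁.N 0 0 = n := by rw [hr₁, den_N rfl, a0]
  have l3 := linProg_spec (f := f) r0 l2
  have r0' : r₂.N 0 0 = n := by rw [hr₂, den_N rfl, r0]
  have rS : r₂.S 7 = ∅ := by rw [hr₂, den_S rfl, hr₁, den_S rfl, aS]
  obtain ⟨m1, m2⟩ := maxProg_spec (f := f) r0' rS
  rw [← hs₁'] at m1 m2
  set M₁ := s₁.R 16 0 with hM₁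
  have v31 : s₁.R 31 = natExt w := by rw [hs₁', den_R rfl, hr₂, den_R rfl, l1]
  have v30 : s₁.R 30 = natExt (lin f) := by rw [hs₁', den_R rfl, hr₂, l3]
  have v0 : s₁.N 0 0 = n := by rw [hs₁, den_N rfl, a0]
  have v1 : s₁.N 1 0 = K := by rw [hs₁, den_N rfl, a1]
  have v10 : s₁.N 10 = s₀.N 10 := by rw [hs₁, den_N rfl]
  have vS : s₁.S 0 = ∅ := by rw [hs₁, den_S rfl, aS]
  obtain ⟨t₂, ht₂, e₂⟩ := exec (f := f) (X := inList [1]) (c := sizesProg) rfl (s := s₁) (β := β)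
    (by
      intro r hr
      simp only [inList, List.contains_cons, List.contains_nil, Bool.or_false, beq_iff_eq] at hr
      rw [hr, v1, hβ.b1])
  obtain ⟨z2, z3, z5, z17⟩ := sizesProg_spec (f := f) v1
  set s₂ := sizesProg.den f s₁ with hs₂
  have y0 : s₂.N 0 0 = n := by rw [hs₂, den_N rfl, v0]
  have y1 : s₂.N 1 0 = K := by rw [hs₂, den_N rfl, v1]
  obtain ⟨t₃, ht₃, e₃⟩ := exec (f := f) (X := inList [1, 2]) (c := scenProg) rfl (s := s₂) (β := β)
    (by
      intro r hr
      simp only [inList, List.contains_cons, List.contains_nil, Bool.or_false, Bool.or_eq_true,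
        beq_iff_eq] at hr
      rcases hr with rfl | rfl
      · rw [y1, hβ.b1]
      · rw [z2, hβ.b2])
  have z7 := scenProg_spec (f := f) (s := s₂)
  rw [y1, z2] at z7
  set s₃ := scenProg.den f s₂ with hs₃
  have x0 : s₃.N 0 0 = n := by rw [hs₃, den_N rfl, y0]
  obtain ⟨t₄, ht₄, e₄⟩ := exec (f := f) (X := inList [0]) (c := countsProg) rfl (s := s₃) (β := β)
    (by
      intro r hr
      simp only [inList, List.contains_cons, List.contains_nil, Bool.or_false, beq_iff_eq] at hr
      rw [hr, x0, hβ.b0])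
  set s₄ := countsProg.den f s₃ with hs₄
  obtain ⟨r₄, hr₄⟩ : ∃ r, r = logProg.den f s₃ := ⟨_, rfl⟩
  have x4 : r₄.N 4 0 = Nat.clog 2 n + 1 := by rw [hr₄, logProg_spec x0]
  have hs₄' : s₄ = digitsProg.den f r₄ := by rw [hr₄, hs₄, countsProg, den_seq]
  have q0 : r₄.N 0 0 = n := by rw [hr₄, den_N rfl, x0]
  have q1 : r₄.N 1 0 = K := by rw [hr₄, den_N rfl, hs₃, den_N rfl, y1]
  have q2 : r₄.N 2 0 = 8 * K ^ 3 := by rw [hr₄, den_N rfl, hs₃, den_N rfl, z2]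
  have q3 : r₄.N 3 0 = 8 * K ^ 3 * K := by rw [hr₄, den_N rfl, hs₃, den_N rfl, z3]
  have p4 : s₄.N 4 0 = Nat.clog 2 n + 1 := by rw [hs₄', den_N rfl, x4]
  have p5 : s₄.N 5 0 = 16 * K ^ 5 + 2 := by rw [hs₄, den_N rfl, hs₃, den_N rfl, z5]
  have p9 : s₄.N 9 0 = n + 1 := by simp [hs₄', digitsProg, den, q0]
  have p30 : s₄.N 30 0 = β 30 := by simp [hs₄', digitsProg, den, q1, q2, q3, hβ.b30]
  have p6 : s₄.N 6 0 = β 6 := by simp [hs₄', digitsProg, den, q1, q2, q3, hβ.b6, hβ.b30]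
  obtain ⟨t₅, ht₅, e₅⟩ := exec (f := f) (X := inList [4, 5, 30]) (c := tableProg) rfl (s := s₄)
    (β := β) (by
      intro r hr
      simp only [inList, List.contains_cons, List.contains_nil, Bool.or_false, Bool.or_eq_true,
        beq_iff_eq] at hr
      rcases hr with rfl | rfl | rfl
      · rw [p4, hβ.b4]
      · rw [p5, hβ.b5]
      · rw [p30])
  obtain ⟨s₅, hs₅⟩ : ∃ s, s = tableProg.den f s₄ := ⟨_, rfl⟩
  obtain ⟨r₅, hr₅⟩ : ∃ r, r = radixProg.den f s₄ := ⟨_, rfl⟩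
  obtain ⟨w0, w1, w2, w3, w8⟩ := radixProg_spec (f := f) p9 p4 p5 p30
  rw [← hr₅] at w0 w1 w2 w3 w8
  rw [← hs₅] at e₅
  have hs₅' : s₅ = (setR 11 (.const 0) (.ofNat (.const 0))).den f r₅ := by
    rw [hr₅, hs₅, tableProg, den_seq]
  have c11 : s₅.N 11 = r₅.N 11 := by rw [hs₅', den_N rfl]
  rw [← c11] at w0 w1 w2 w3
  have c8 : s₅.N 8 0 = β 8 := by rw [hs₅', den_N rfl, w8, hβ.b8]
  have c6 : s₅.N 6 0 = β 6 := by rw [hs₅, den_N rfl, p6]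
  have c10 : s₅.N 10 = s₀.N 10 := by
    rw [hs₅, den_N rfl, hs₄, den_N rfl, hs₃, den_N rfl, hs₂, den_N rfl, v10]
  have cS : s₅.S 0 = ∅ := by
    rw [hs₅, den_S rfl, hs₄, den_S rfl, hs₃, den_S rfl, hs₂, den_S rfl, vS]
  have cR : s₅.R 11 0 = 0 := by simp [hs₅', den]
  set I : Inst n := ⟨f, w, K, 8 * K ^ 3⟩ with hI
  have hnum : I.numDigits = β 6 := by
    rw [hβ.b6, hβ.b30]
    simp only [Inst.numDigits, hI]
    ring
  have henv : Env I (Nat.clog 2 n + 1) (M₁ / (8 * K ^ 5 : ℕ)) s₅ := by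
    constructor
    · rw [hs₅, den_N rfl, hs₄, den_N rfl, x0]
    · rw [hs₅, den_N rfl, hs₄', den_N rfl, q1]
    · rw [hs₅, den_N rfl, hs₄', den_N rfl, q2]
    · rw [hs₅, den_N rfl, hs₄', den_N rfl, q3]
    · rw [hs₅, den_N rfl, p4]
    · rw [hs₅, den_N rfl, hs₄, den_N rfl, z7]
    · rw [hs₅, den_R rfl, hs₄, den_R rfl, hs₃, den_R rfl, hs₂, den_R rfl, v31]
    · rw [hs₅, den_R rfl, hs₄, den_R rfl, hs₃, den_R rfl, hs₂, den_R rfl, v30]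
    · rw [hs₅, den_R rfl, hs₄, den_R rfl, hs₃, den_R rfl, z17]
  have hrad : ∀ i, 3 ≤ i → i < I.numDigits → s₅.N 11 i = 16 * K ^ 5 + 2 := by
    intro i hi hi'
    rw [hnum, hβ.b6] at hi'
    have := w3 (i - 3) (by omega)
    rwa [Nat.add_sub_cancel' hi] at this
  obtain ⟨g1, g2⟩ := searchProg_spec henv hKpos (by simp only [hI]; positivity)
    (by rw [c6, hnum]) (by
      intro i hi
      rcases Nat.lt_or_ge i 3 with hi3 | hi3
      · interval_cases i
        · rw [w0]; omega
        · rw [w1]; omega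
        · rw [w2]; omega
      · rw [hrad i hi3 hi]; omega)
    (by
      rw [c8, hnum, hβ.b8, hβ.b6, prod_range_add, prod_congr rfl fun i hi => w3 i (mem_range.1 hi),
        prod_const, card_range]
      simp only [prod_range_succ, prod_range_zero, one_mul, w0, w1, w2])
    (by intro i _; rw [c10, a10]) (by rw [cS]; simp [weight]) (by rw [cR]; exact h0 _)
  obtain ⟨t₆, ht₆, e₆⟩ := exec (f := f) (X := inList [0, 1, 2, 3, 4, 6, 7, 8]) (c := searchProg) rfl
    (s := s₅) (β := β) (by
      intro r hr
      simp only [inList, List.contains_cons, List.contains_nil, Bool.or_false, Bool.or_eq_true,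
        beq_iff_eq] at hr
      rcases hr with rfl | rfl | rfl | rfl | rfl | rfl | rfl | rfl
      · rw [henv.n_eq, hβ.b0]
      · rw [henv.m_eq, hβ.b1]
      · rw [henv.k_eq, hβ.b2]
      · rw [henv.P_eq, hβ.b3]
      · rw [henv.J_eq, hβ.b4]
      · rw [c6]
      · rw [henv.mk_eq, hβ.b7]
      · rw [c8])
  refine ⟨_, ?_, _, e₀.seq (e₁.seq (e₂.seq (e₃.seq (e₄.seq (e₅.seq e₆))))), g1, fun O hO => ?_⟩
  · omega
  · exact search_guarantee hn h0 hmono hsub hw hKε m1 m2 w0 w1 w2 hrad g2 hO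


/-! ### The running time -/

namespace Prog

/-- Each of the `β 7` scenarios costs time linear in the number `β 0` of elements and the number `β
2` of slots. In the cost lemmas `B` dominates the quantities that are polynomial in `K`. -/
lemma evalG_cost {β : Fin 32 → ℕ} {B : ℕ} (h0 : 1 ≤ β 0) (h2 : β 2 ≤ B) (h7 : 1 ≤ β 7)
    (hB : 1 ≤ B) : evalG.cost β ≤ 100 * (β 0 * B * β 7) := by
  have e0 : β 0 * β 7 ≤ β 0 * B * β 7 := by
    calc β 0 * β 7 = β 0 * 1 * β 7 := by ring
      _ ≤ _ := by gcongr
  have e2 : β 2 * β 7 ≤ β 0 * B * β 7 := by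
    calc β 2 * β 7 = 1 * β 2 * β 7 := by ring
      _ ≤ _ := by gcongr
  have e3 : β 2 ≤ β 2 * β 7 := Nat.le_mul_of_pos_right _ h7
  have e4 : β 7 ≤ β 0 * β 7 := Nat.le_mul_of_pos_left _ h0
  simp only [evalG, copySet, insPicks, sumSet, odo, cost]
  generalize β 0 * B * β 7 = E at *
  linarith

lemma slotsProg_cost {β : Fin 32 → ℕ} {B : ℕ} (h0 : 1 ≤ β 0) (h2 : β 2 ≤ B) (h7 : 1 ≤ β 7)
    (hB : 1 ≤ B) : slotsProg.cost β ≤ 500 * (B * (β 0 * (β 0 * B * β 7))) := by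
  have hE := evalG_cost h0 h2 h7 hB
  have e1 : 1 ≤ β 0 * B * β 7 := Nat.one_le_iff_ne_zero.2 (by positivity)
  simp only [slotsProg, slotProg, copySet, scan, cost]
  generalize β 0 * B * β 7 = E at *
  generalize evalG.cost β = e at *
  have a1 : β 0 ≤ β 0 * E := Nat.le_mul_of_pos_right _ e1
  have a2 : β 0 * e ≤ β 0 * (100 * E) := Nat.mul_le_mul_left _ hE
  have a3 : E ≤ β 0 * E := Nat.le_mul_of_pos_left _ h0
  have a4 : β 0 * E ≤ B * (β 0 * E) := Nat.le_mul_of_pos_left _ hB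
  refine (Nat.add_le_add_right (Nat.mul_le_mul h2 (show _ ≤ 400 * (β 0 * E) by linarith)) 3).trans ?_
  linarith

lemma smallsProg_cost {β : Fin 32 → ℕ} {B : ℕ} (h0 : 1 ≤ β 0) (h2 : β 2 ≤ B) (h7 : 1 ≤ β 7)
    (hB : 1 ≤ B) : smallsProg.cost β ≤ 500 * (β 0 * (β 0 * (β 0 * B * β 7))) := by
  have hE := evalG_cost h0 h2 h7 hB
  have e1 : 1 ≤ β 0 * B * β 7 := Nat.one_le_iff_ne_zero.2 (by positivity)
  have e0 : β 0 ≤ β 0 * B * β 7 := by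
    calc β 0 = β 0 * 1 * 1 := by ring
      _ ≤ _ := by gcongr
  simp only [smallsProg, smallProg, sumSet, copySet, scan, cost]
  generalize β 0 * B * β 7 = E at *
  generalize evalG.cost β = e at *
  have a1 : β 0 ≤ β 0 * E := Nat.le_mul_of_pos_right _ e1
  have a2 : β 0 * e ≤ β 0 * (100 * E) := Nat.mul_le_mul_left _ hE
  have a3 : E ≤ β 0 * E := Nat.le_mul_of_pos_left _ h0
  have a4 : β 0 * E ≤ β 0 * (β 0 * E) := Nat.le_mul_of_pos_left _ h0
  have a5 : β 0 * β 0 ≤ β 0 * E := Nat.mul_le_mul_left _ e0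
  refine (Nat.add_le_add_right (Nat.mul_le_mul_left _ (show _ ≤ 400 * (β 0 * E) by linarith))
    3).trans ?_
  linarith

lemma buildProg_cost {β : Fin 32 → ℕ} {B : ℕ} (h0 : 1 ≤ β 0) (h1 : β 1 ≤ B) (h2 : β 2 ≤ B)
    (h3 : β 3 ≤ B) (h4 : β 4 ≤ 2 * β 0) (h7 : 1 ≤ β 7) (hB : 1 ≤ B) :
    buildProg.cost β ≤ 2000 * (B * B * (β 0 * (β 0 * (β 0 * B * β 7)))) := by
  have e1 : 1 ≤ β 0 * B * β 7 := Nat.one_le_iff_ne_zero.2 (by positivity)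
  have s1 := slotsProg_cost h0 h2 h7 hB
  have s2 := smallsProg_cost h0 h2 h7 hB
  generalize β 0 * B * β 7 = E at *
  have c1 : stagesProg.cost β ≤ 1100 * (B * B * (β 0 * (β 0 * E))) := by
    simp only [stagesProg, cost]
    have a1 : B * (β 0 * E) ≤ B * (β 0 * (β 0 * E)) :=
      Nat.mul_le_mul_left _ (Nat.le_mul_of_pos_left _ h0)
    have a2 : β 0 * (β 0 * E) ≤ B * (β 0 * (β 0 * E)) := Nat.le_mul_of_pos_left _ hB
    have a3 : 1 ≤ B * (β 0 * (β 0 * E)) := Nat.one_le_iff_ne_zero.2 (by positivity)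
    have a4 : B * (β 0 * (β 0 * E)) ≤ B * (B * (β 0 * (β 0 * E))) := Nat.le_mul_of_pos_left _ hB
    refine (Nat.add_le_add_right (Nat.mul_le_mul h1
      (show _ ≤ 1010 * (B * (β 0 * (β 0 * E))) by linarith)) 3).trans ?_
    linarith
  have c2 : initProg.cost β ≤ 100 * (B * B * (β 0 * (β 0 * E))) := by
    simp only [initProg, double, coefProg, zerosProg, noPicksProg, cost]
    have a1 : B ≤ B * B * (β 0 * (β 0 * E)) := by
      calc B = B * 1 * (1 * (1 * 1)) := by ring
        _ ≤ _ := by gcongr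
    have a2 : β 0 ≤ B * B * (β 0 * (β 0 * E)) := by
      calc β 0 = 1 * 1 * (β 0 * (1 * 1)) := by ring
        _ ≤ _ := by gcongr
    linarith
  have c3 : tauProg.cost β ≤ 30 * (B * B * (β 0 * (β 0 * E))) := by
    simp only [tauProg, cost]
    have a1 : B ≤ B * B := Nat.le_mul_of_pos_left _ hB
    have a2 : B * B ≤ B * B * (β 0 * (β 0 * E)) :=
      Nat.le_mul_of_pos_right _ (by positivity)
    refine (Nat.add_le_add_right (Nat.mul_le_mul h2
      (show _ ≤ 6 * B + 10 by linarith)) 3).trans ?_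
    linarith
  have c4 : fillsProg.cost β ≤ 30 * (B * B * (β 0 * (β 0 * E))) := by
    simp only [fillsProg, scan, cost]
    have a1 : B * β 0 ≤ B * B * (β 0 * (β 0 * E)) := by
      calc B * β 0 = B * 1 * (β 0 * (1 * 1)) := by ring
        _ ≤ _ := by gcongr
    have a2 : B ≤ B * β 0 := Nat.le_mul_of_pos_right _ h0
    refine (Nat.add_le_add_right (Nat.mul_le_mul h2
      (show _ ≤ 9 * β 0 + 10 by linarith)) 3).trans ?_
    linarith
  have c5 : β 0 ≤ B * B * (β 0 * (β 0 * E)) := by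
    calc β 0 = 1 * 1 * (β 0 * (1 * 1)) := by ring
      _ ≤ _ := by gcongr
  have c6 : B ≤ B * B * (β 0 * (β 0 * E)) := by
    calc B = B * 1 * (1 * (1 * 1)) := by ring
      _ ≤ _ := by gcongr
  simp only [buildProg, copySet, insPicks, cost]
  generalize B * B * (β 0 * (β 0 * E)) = Y at *
  linarith

lemma searchProg_cost {β : Fin 32 → ℕ} {B : ℕ} (h0 : 1 ≤ β 0) (h1 : β 1 ≤ B) (h2 : β 2 ≤ B)
    (h3 : β 3 ≤ B) (h4 : β 4 ≤ 2 * β 0) (h6 : β 6 ≤ B) (h7 : 1 ≤ β 7) (h8 : 1 ≤ β 8) (hB : 1 ≤ B) :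
    searchProg.cost β ≤ 2200 * (β 8 * (B * B * (β 0 * (β 0 * (β 0 * B * β 7))))) := by
  have hb := buildProg_cost h0 h1 h2 h3 h4 h7 hB
  have e1 : 1 ≤ β 0 * B * β 7 := Nat.one_le_iff_ne_zero.2 (by positivity)
  generalize β 0 * B * β 7 = E at *
  have c5 : β 0 ≤ B * B * (β 0 * (β 0 * E)) := by
    calc β 0 = 1 * 1 * (β 0 * (1 * 1)) := by ring
      _ ≤ _ := by gcongr
  have c6 : B ≤ B * B * (β 0 * (β 0 * E)) := by
    calc B = B * 1 * (1 * (1 * 1)) := by ring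
      _ ≤ _ := by gcongr
  simp only [searchProg, checkProg, copySet, sumSet, odo, cost]
  generalize B * B * (β 0 * (β 0 * E)) = Y at *
  have a1 : 1 ≤ β 8 * Y := Nat.one_le_iff_ne_zero.2 (by
    have : 1 ≤ Y := hB.trans c6
    positivity)
  refine (Nat.add_le_add_right (Nat.mul_le_mul_left _ (show _ ≤ 2150 * Y by linarith)) 3).trans ?_
  linarith

lemma preparation_cost {β : Fin 32 → ℕ} {B : ℕ} (h0 : 1 ≤ β 0) (h1 : β 1 ≤ B) (h2 : β 2 ≤ B)
    (h4 : β 4 ≤ 2 * β 0) (h5 : β 5 ≤ B) (h30 : β 30 ≤ B) (hB : 1 ≤ B) :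
    valuesProg.cost β + sizesProg.cost β + scenProg.cost β + countsProg.cost β +
      tableProg.cost β ≤ 500 * (B * B * β 0) := by
  have a0 : β 0 ≤ B * B * β 0 := Nat.le_mul_of_pos_left _ (by positivity)
  have a1 : B * B ≤ B * B * β 0 := Nat.le_mul_of_pos_right _ h0
  have a2 : B ≤ B * B := Nat.le_mul_of_pos_left _ hB
  have a3 : β 2 * β 1 ≤ B * B := Nat.mul_le_mul h2 h1
  have a4 : β 30 * β 5 ≤ B * B := Nat.mul_le_mul h30 h5
  simp only [valuesProg, loadProg, linProg, maxProg, sizesProg, scenProg, countsProg, logProg,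
    digitsProg, tableProg, radixProg, mulBy, cost]
  generalize B * B * β 0 = Y at *
  generalize B * B = Z at *
  linarith

end Prog

lemma clog_le_self (n : ℕ) : Nat.clog 2 n ≤ n := Nat.clog_le_of_le_pow Nat.lt_two_pow_self.le

/-- The program takes time `O(n ^ 4 * log (n) ^ 2)` for every fixed accuracy. -/
lemma total_cost {K : ℕ} {β : Fin 32 → ℕ} (hβ : Bounds n K β) (hn : 0 < n) (hK : 9 ≤ K) :
    2 * K + 1 + (Prog.valuesProg.cost β + (Prog.sizesProg.cost β + (Prog.scenProg.cost β +
        (Prog.countsProg.cost β + (Prog.tableProg.cost β + Prog.searchProg.cost β + 1) + 1) + 1) + 1)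
        + 1) + 1 ≤
      10000 * (n ^ 4 * (Nat.clog 2 n + 1) ^ 2 * (16 * K ^ 5 + 2) ^ (16 * K ^ 5 + 2)) := by
  obtain ⟨b0, b1, b2, b3, b4, b5, b6, b7, b8, b30⟩ := hβ
  have k2 : K ^ 2 = K * K := by ring
  have k3 : K ^ 3 = K * K ^ 2 := by ring
  have k4 : 8 * K ^ 3 * K = 8 * K ^ 4 := by ring
  have k4' : K ^ 4 = K * K ^ 3 := by ring
  have k5 : K ^ 5 = K * K ^ 4 := by ring
  -- For `K ≥ 9` the lower powers of `K` are small compared with `K ^ 5`. With these linear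
  -- relations between the powers, `omega` fits all sizes, and later the total exponent, below `B`.
  have l2 : 9 * K ≤ K ^ 2 := by rw [k2]; exact Nat.mul_le_mul_right _ hK
  have l3 : 9 * K ^ 2 ≤ K ^ 3 := by rw [k3]; exact Nat.mul_le_mul_right _ hK
  have l4 : 9 * K ^ 3 ≤ K ^ 4 := by rw [k4']; exact Nat.mul_le_mul_right _ hK
  have l5 : 9 * K ^ 4 ≤ K ^ 5 := by rw [k5]; exact Nat.mul_le_mul_right _ hK
  rw [k4] at b3 b30
  set B := 16 * K ^ 5 + 2 with hB
  have hB1 : 1 ≤ B := by omega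
  have hJ : Nat.clog 2 n + 1 ≤ 2 * n := by have := clog_le_self n; omega
  have h7 : 1 ≤ β 7 := by rw [b7]; exact Nat.one_le_pow _ _ (by omega)
  have h8 : 1 ≤ β 8 := by rw [b8]; exact Nat.one_le_iff_ne_zero.2 (by positivity)
  have h0 : 1 ≤ β 0 := by omega
  have h1 : β 1 ≤ B := by omega
  have h2 : β 2 ≤ B := by omega
  have h3 : β 3 ≤ B := by omega
  have h4 : β 4 ≤ 2 * β 0 := by omega
  have h6 : β 6 ≤ B := by omega
  have h30 : β 30 ≤ B := by omega
  have c1 := Prog.searchProg_cost h0 h1 h2 h3 h4 h6 h7 h8 hB1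
  have c2 := Prog.preparation_cost h0 h1 h2 h4 b5.le h30 hB1
  set J := Nat.clog 2 n + 1 with hJdef
  have h7' : β 7 ≤ B ^ (8 * K ^ 3) := by
    rw [b7]
    exact Nat.pow_le_pow_left (by omega) _
  -- One factor `n` comes from the number of guesses and three from building a candidate; the two
  -- factors `J` come from the two dyadic guesses. All the rest is a power of `B`.
  have main : β 8 * (B * B * (β 0 * (β 0 * (β 0 * B * β 7)))) ≤ 2 * (n ^ 4 * J ^ 2 * B ^ B) := by
    rw [b8, b0]
    calc (n + 1) * J * J * B ^ β 30 * (B * B * (n * (n * (n * B * β 7))))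
        ≤ (2 * n) * J * J * B ^ β 30 * (B * B * (n * (n * (n * B * B ^ (8 * K ^ 3))))) := by
          gcongr
          omega
      _ = 2 * (n ^ 4 * J ^ 2 * B ^ (β 30 + 3 + 8 * K ^ 3)) := by rw [pow_add, pow_add]; ring
      _ ≤ 2 * (n ^ 4 * J ^ 2 * B ^ B) := by
          gcongr
          omega
  have hY : B * B * β 0 ≤ n ^ 4 * J ^ 2 * B ^ B := by
    rw [b0]
    calc B * B * n = n ^ 1 * 1 ^ 2 * B ^ 2 := by ring
      _ ≤ n ^ 4 * J ^ 2 * B ^ B := by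
          gcongr <;> omega
  have hBY : B ≤ B * B * β 0 := by
    calc B = B * 1 * 1 := by ring
      _ ≤ _ := by gcongr
  generalize n ^ 4 * J ^ 2 * B ^ B = Y at *
  generalize β 8 * (B * B * (β 0 * (β 0 * (β 0 * B * β 7)))) = Y' at *
  have hKB : K ≤ B := b1 ▸ h1
  linarith


/-! ### From the number of steps to the stated time bound -/

lemma clog_add_one_le (hn : 0 < n) : ((Nat.clog 2 n + 1 : ℕ) : ℝ) ≤ 2 + 2 * Real.log n := by
  have hn' : (1 : ℝ) ≤ n := by exact_mod_cast hn
  have hlog : 0 ≤ Real.log n := Real.log_nonneg hn'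
  rcases Nat.lt_or_ge 1 n with h | h
  · have h1 := (Nat.pow_pred_clog_lt_self Nat.one_lt_two h).le
    have h2 : ((2 : ℝ)) ^ (Nat.clog 2 n).pred ≤ n := by exact_mod_cast h1
    have h3 := Real.log_le_log (by positivity) h2
    rw [Real.log_pow] at h3
    have h4 : 1 / 2 ≤ Real.log 2 := by linarith [Real.log_two_gt_d9]
    have h5 : ((Nat.clog 2 n).pred : ℝ) * (1 / 2) ≤ (Nat.clog 2 n).pred * Real.log 2 :=
      mul_le_mul_of_nonneg_left h4 (Nat.cast_nonneg _)
    have h6 : (Nat.clog 2 n + 1 : ℕ) = (Nat.clog 2 n).pred + 2 := by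
      have := Nat.clog_pos Nat.one_lt_two h
      simp only [Nat.pred_eq_sub_one]
      omega
    rw [h6]
    push_cast
    linarith
  · have : n = 1 := by omega
    subst this
    simp

/-- For `X ≥ 2` the constant is absorbed, `10 ^ 6 ≤ 2 ^ 20 ≤ X ^ 20`, so `B ≤ X ^ 25`. Near `X = 1`
powers of `X` cannot absorb constants, but there `B` is bounded and the factor `C` takes over. -/
lemma exists_pow_self_bound : ∃ C : ℝ, 1 ≤ C ∧ ∀ (X : ℝ) (B : ℕ), 1 ≤ X → 1 ≤ B →
    (B : ℝ) ≤ 10 ^ 6 * X ^ 5 → (B : ℝ) ^ B ≤ C * X ^ (25 * 10 ^ 6 * X ^ 5 : ℝ) := by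
  obtain ⟨M, hM⟩ := exists_nat_ge (10 ^ 6 * 2 ^ 5 : ℝ)
  have hM1 : (1 : ℝ) ≤ M := le_trans (by norm_num) hM
  refine ⟨(M : ℝ) ^ M, one_le_pow₀ hM1, fun X B hX hB hBX => ?_⟩
  have hB' : (1 : ℝ) ≤ B := by exact_mod_cast hB
  have hX1 : 1 ≤ X ^ (25 * 10 ^ 6 * X ^ 5 : ℝ) := Real.one_le_rpow hX (by positivity)
  have hMM : 1 ≤ (M : ℝ) ^ M := one_le_pow₀ hM1
  rcases le_or_gt 2 X with h | h
  · have h1 : (B : ℝ) ≤ X ^ (25 : ℝ) := by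
      have h2 : (2 : ℝ) ^ 20 ≤ X ^ 20 := by gcongr
      calc (B : ℝ) ≤ 10 ^ 6 * X ^ 5 := hBX
        _ ≤ 2 ^ 20 * X ^ 5 := by gcongr; norm_num
        _ ≤ X ^ 20 * X ^ 5 := by gcongr
        _ = X ^ (25 : ℝ) := by
          rw [← pow_add, ← Real.rpow_natCast]; norm_num
    calc (B : ℝ) ^ B = (B : ℝ) ^ (B : ℝ) := (Real.rpow_natCast _ _).symm
      _ ≤ (X ^ (25 : ℝ)) ^ (B : ℝ) := Real.rpow_le_rpow (by positivity) h1 (by positivity)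
      _ = X ^ (25 * (B : ℝ)) := (Real.rpow_mul (by linarith) _ _).symm
      _ ≤ X ^ (25 * 10 ^ 6 * X ^ 5 : ℝ) :=
        Real.rpow_le_rpow_of_exponent_le hX (by linarith)
      _ ≤ _ := le_mul_of_one_le_left (by positivity) hMM
  · have h1 : B ≤ M := by
      have : (B : ℝ) ≤ M := by
        calc (B : ℝ) ≤ 10 ^ 6 * X ^ 5 := hBX
          _ ≤ 10 ^ 6 * 2 ^ 5 := by gcongr
          _ ≤ M := hM
      exact_mod_cast this
    calc (B : ℝ) ^ B ≤ (M : ℝ) ^ B := by gcongr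
      _ ≤ (M : ℝ) ^ M := pow_le_pow_right₀ hM1 h1
      _ ≤ _ := le_mul_of_one_le_right (by positivity) hX1

lemma accuracy_bounds {ε : ℝ} (h0 : 0 < ε) (h1 : ε < 1) :
    9 ≤ ⌈8 / ε⌉₊ ∧ ((16 * ⌈8 / ε⌉₊ ^ 5 + 2 : ℕ) : ℝ) ≤ 10 ^ 6 * (1 / ε) ^ 5 := by
  have hX : 1 ≤ 1 / ε := by rw [le_div_iff₀ h0]; linarith
  have h8 : 8 < 8 / ε := by rw [lt_div_iff₀ h0]; linarith
  constructor
  · exact Nat.lt_ceil.2 (by exact_mod_cast h8)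
  · have h2 := (Nat.ceil_lt_add_one (show 0 ≤ 8 / ε by positivity)).le
    -- The unit lost in rounding up is at most `1 / ε`, since `ε < 1`. Then `16 * 9 ^ 5 + 2 < 10 ^
    -- 6` gives the constant.
    have h3 : (⌈8 / ε⌉₊ : ℝ) ≤ 9 * (1 / ε) := by
      have : 8 / ε = 8 * (1 / ε) := by ring
      linarith
    have h4 : (⌈8 / ε⌉₊ : ℝ) ^ 5 ≤ (9 * (1 / ε)) ^ 5 := by gcongr
    have h5 : 1 ≤ (1 / ε) ^ 5 := one_le_pow₀ hX
    rw [mul_pow] at h4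
    push_cast
    linarith

/-- The time bound grows with the curvature. -/
lemma curvature_bound_mono {X A c D : ℝ} (hX : 1 ≤ X) (hA : 0 ≤ A) (hD : 0 ≤ D) (h0 : 0 ≤ c)
    (h1 : c < 1) : D * X ^ A ≤ D / (1 - c) ^ 2 * (X * (1 + Real.log (1 / (1 - c)))) ^ (A / (1 - c)) := by
  have hc : 0 < 1 - c := by linarith
  have hinv : 1 ≤ 1 / (1 - c) := by rw [le_div_iff₀ hc]; linarith
  have hlog := Real.log_nonneg hinv
  have hbase : X ≤ X * (1 + Real.log (1 / (1 - c))) := le_mul_of_one_le_right (by linarith)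
    (by linarith)
  have hexp : A ≤ A / (1 - c) := by
    rw [le_div_iff₀ hc]
    nlinarith
  refine mul_le_mul ?_ ?_ (Real.rpow_nonneg (by linarith) _) (by positivity)
  · rw [le_div_iff₀ (by positivity)]
    have : (1 - c) ^ 2 ≤ 1 := pow_le_one₀ hc.le (by linarith)
    exact mul_le_of_le_one_right hD this
  · exact (Real.rpow_le_rpow (by linarith) hbase hA).trans
      (Real.rpow_le_rpow_of_exponent_le (hX.trans hbase) hexp)

lemma expect_pure (f : Finset (Fin n) → ℝ) (S : Finset (Fin n)) : expect (PMF.pure S) f = f S := by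
  classical
  rw [expect, sum_eq_single S]
  · simp
  · intro T _ hT
    simp [PMF.pure_apply, hT]
  · simp

end SubmodKnapsack

end

/-! ### The main theorem -/

theorem mainTheorem3 :
    ∃ (prog : SubmodKnapsack.Cmd) (C : ℝ) (polylog poly : Polynomial ℝ),
      ∀ (n : ℕ) (f : Finset (Fin n) → ℝ) (w : Fin n → ℝ) (ε : ℝ),
        0 < n → (∀ S, 0 ≤ f S) → Monotone f → SubmodKnapsack.IsSubmodular f →
        (∀ e, 0 ≤ w e ∧ w e ≤ 1) → 0 < ε → ε < 1 →
        ∃ T : ℕ,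
          SubmodKnapsack.HaltsWithin prog f w ε T ∧
          (SubmodKnapsack.curvature f < 1 →
            (T : ℝ) ≤
              C * ((n : ℝ) ^ 4 * polylog.eval (Real.log n) /
                  (1 - SubmodKnapsack.curvature f) ^ 2) *
                (1 / ε * (1 + Real.log (1 / (1 - SubmodKnapsack.curvature f)))) ^
                  (poly.eval (1 / ε) / (1 - SubmodKnapsack.curvature f))) ∧
          (∀ S ∈ (SubmodKnapsack.output prog f w ε T).support,
            SubmodKnapsack.weight w S ≤ 1) ∧
          ∀ O : Finset (Fin n), SubmodKnapsack.IsOptimal f w O →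
            (1 - SubmodKnapsack.curvature f / Real.exp 1 - ε) * f O ≤
              SubmodKnapsack.expect (SubmodKnapsack.output prog f w ε T) f := by
  open SubmodKnapsack in
  obtain ⟨C, hC, hpow⟩ := exists_pow_self_bound
  -- The first polynomial is the square of the bound `2 + 2 * log n` for the number of doublings,
  -- the second one the exponent from `exists_pow_self_bound`.
  refine ⟨mainCmd, 10000 * C, (Polynomial.C 2 + Polynomial.C 2 * Polynomial.X) ^ 2,
    Polynomial.C (25 * 10 ^ 6) * Polynomial.X ^ 5, ?_⟩
  intro n f w ε hn h0 hmono hsub hw hε hε1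
  obtain ⟨hK, hB⟩ := accuracy_bounds hε hε1
  obtain ⟨β, hβ⟩ := exists_bounds n ⌈8 / ε⌉₊
  obtain ⟨T, hT, σ, hexec, hfeas, hopt⟩ := mainCmd_exec hn h0 hmono hsub hw hε hβ
  have hT' := hT.trans (total_cost hβ hn hK)
  -- No coin is tossed, so the final configuration and the output are point masses and the
  -- expectation is a single value.
  have hrun : run f T (init mainCmd w ε) = PMF.pure ⟨[], σ⟩ := hexec []
  have hout : output mainCmd f w ε T = PMF.pure (σ.sets 0) := by
    rw [output, hrun, PMF.pure_map]
  refine ⟨T, ?_, fun hc => ?_, ?_, fun O hO => ?_⟩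
  · intro c hc
    rw [hrun, PMF.support_pure, Set.mem_singleton_iff] at hc
    rw [hc]
  · have hX : 1 ≤ 1 / ε := by rw [le_div_iff₀ hε]; linarith
    have hn' : (1 : ℝ) ≤ n := by exact_mod_cast hn
    have hlog := Real.log_nonneg hn'
    have h1 := hpow (1 / ε) _ hX (by omega) hB
    have h2 := clog_add_one_le hn
    simp only [Polynomial.eval_pow, Polynomial.eval_add, Polynomial.eval_mul, Polynomial.eval_C,
      Polynomial.eval_X]
    have h3 := curvature_bound_mono (D := n ^ 4 * (2 + 2 * Real.log n) ^ 2)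
      (A := 25 * 10 ^ 6 * (1 / ε) ^ 5) hX (by positivity) (by positivity)
      (curvature_mem (MonoDR.of_submodular hmono hsub) h0).1 hc
    have h4 : (T : ℝ) ≤ 10000 * (n ^ 4 * ((Nat.clog 2 n + 1 : ℕ) : ℝ) ^ 2 *
        ((16 * ⌈8 / ε⌉₊ ^ 5 + 2 : ℕ) : ℝ) ^ (16 * ⌈8 / ε⌉₊ ^ 5 + 2)) := by
      exact_mod_cast hT'
    calc (T : ℝ) ≤ _ := h4
      _ ≤ 10000 * (n ^ 4 * (2 + 2 * Real.log n) ^ 2 *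
          (C * (1 / ε) ^ (25 * 10 ^ 6 * (1 / ε) ^ 5 : ℝ))) := by gcongr
      _ = 10000 * C * (n ^ 4 * (2 + 2 * Real.log n) ^ 2 *
          (1 / ε) ^ (25 * 10 ^ 6 * (1 / ε) ^ 5 : ℝ)) := by ring
      _ ≤ 10000 * C * _ := mul_le_mul_of_nonneg_left h3 (by linarith)
      _ = _ := (mul_assoc _ _ _).symm
  · intro S hS
    rw [hout, PMF.support_pure, Set.mem_singleton_iff] at hS
    rw [hS]
    exact hfeas
  · rw [hout, expect_pure]
    exact hopt O hO
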